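/- Let $d\ge 0$ and $m\ge 1$ be integers, $n=d+m$, and let $A\in\mathbb{R}^{(d+1)\times m}$. Let $$\mathcal{L}_A=\{(\mathbf{x},\widetilde{\mathbf{x}}A):\mathbf{x}\in\mathbb{R}^d\}\subseteq\mathbb{R}^n,\qquad \widetilde{\mathbf{x}}=(1,\mathbf{x}),$$ a $d$-dimensional affine subspace of $\mathbb{R}^n$. Write $|\cdot|$ for the supremum norm and $\|\mathbf{y}\|=\min_{\mathbf{k}\in\mathbb{Z}^r}|\mathbf{y}-\mathbf{k}|$ for $\mathbf{y}\in\mathbb{R}^r$. Let $\omega(A)\in[-\infty,\infty]$ be the supremum of the set of $\omega\in\mathbb{R}$ such that $\|A\mathbf{q}^{\mathrm{T}}\|<|\mathbf{q}|^{-\omega}$ holds for infinitely many $\mathbf{q}\in\mathbb{Z}^m$. For $\psi:\mathbb{N}\to\mathbb{R}_{\ge 0}$ (where $\mathbb{N}=\{1,2,\dots\}$) let $$\mathcal{S}_n(\psi)=\{\mathbf{y}\in\mathbb{R}^n:\|q\mathbf{y}\|<\psi(q)\text{ for infinitely many }q\in\mathbb{N}\}.$$ A $d$-dimensional submanifold $\mathcal{M}\subseteq\mathbb{R}^n$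 is said to be of Khintchine type if, for every non-increasing $\psi:\mathbb{N}\to\mathbb{R}_{\ge 0}$, the set $\mathcal{S}_n(\psi)\cap\mathcal{M}$ has measure zero in $\mathcal{M}$ when $\sum_{q\ge1}\psi(q)^n<\infty$, while its complement in $\mathcal{M}$ has measure zero when $\sum_{q\ge1}\psi(q)^n=\infty$. Here measure means the induced $d$-dimensional Lebesgue measure on $\mathcal{M}$ (counting measure if $d=0$). **Theorem.** Assume that $\omega(A)\ne n$. Then $\mathcal{L}_A$ is of Khintchine type if and only if $\omega(A)<n$. -/

import Mathlib

open scoped NNReal MeasureTheory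

noncomputable section

namespace KhintchineAffine

/-- `‖y‖ = min_{k ∈ ℤⁿ} |y - k|`: the distance of `y ∈ ℝⁿ` to the nearest integer vector in the
supremum norm (the norm of the function type `Fin n → ℝ` is the supremum norm). -/
def distInt {n : ℕ} (y : Fin n → ℝ) : ℝ :=
  ⨅ k : Fin n → ℤ, ‖fun i => y i - (k i : ℝ)‖

/-- The Diophantine exponent `ω(A)` of a real `r × m` matrix: the supremum, in the extended reals,
of the real `w` such that `‖A qᵀ‖ < |q|^(-w)` for infinitely many `q ∈ ℤᵐ`. -/
def diophantineExponent {r m : ℕ} (A : Matrix (Fin r) (Fin m) ℝ) : EReal :=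
  sSup ((fun w : ℝ => (w : EReal)) ''
    {w : ℝ | {q : Fin m → ℤ |
      distInt (A.mulVec fun j => (q j : ℝ)) < ‖fun j => (q j : ℝ)‖ ^ (-w)}.Infinite})

/-- `S_n(ψ)`: the points `y ∈ ℝⁿ` with `‖q y‖ < ψ(q)` for infinitely many positive integers `q`. -/
def approximable {n : ℕ} (ψ : ℕ+ → ℝ≥0) : Set (EuclideanSpace ℝ (Fin n)) :=
  {y | {q : ℕ+ | distInt (fun i => ((q : ℕ) : ℝ) * y i) < (ψ q : ℝ)}.Infinite}

/-- A `d`-dimensional submanifold `M` of `ℝⁿ` is of Khintchine type if for every non-increasing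
`ψ : ℕ → ℝ_{≥ 0}` the set `S_n(ψ) ∩ M` is null in `M` when `∑ ψ(q)ⁿ` converges, and its complement
in `M` is null when `∑ ψ(q)ⁿ` diverges. The induced Lebesgue measure on `M` is the `d`-dimensional
Hausdorff measure of the Euclidean metric, normalised to be Lebesgue measure on `ℝᵈ`. -/
def IsKhintchineType {n : ℕ} (d : ℕ) (M : Set (EuclideanSpace ℝ (Fin n))) : Prop :=
  ∀ ψ : ℕ+ → ℝ≥0, Antitone ψ →
    ((Summable fun q => ψ q ^ n) →
      MeasureTheory.Measure.euclideanHausdorffMeasure d (approximable ψ ∩ M) = 0) ∧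
    ((¬ Summable fun q => ψ q ^ n) →
      MeasureTheory.Measure.euclideanHausdorffMeasure d (M \ approximable ψ) = 0)

/-- The affine subspace `L_A = {(x, x̃ A) : x ∈ ℝᵈ}` of `ℝ^(d+m)`, where `x̃ = (1, x)`. -/
def affineSubspaceOf {d m : ℕ} (A : Matrix (Fin (d + 1)) (Fin m) ℝ) :
    Set (EuclideanSpace ℝ (Fin (d + m))) :=
  {y | ∃ x : Fin d → ℝ,
    y = WithLp.toLp 2 (Fin.append x (Matrix.vecMul (Matrix.vecCons 1 x) A))}

end KhintchineAffine

end

/-!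
# Khintchine's theorem on affine subspaces

Put `n = d + m`. As `x ↦ (x, x̃ A)` is bi-Lipschitz, null sets of `L_A` are images of Lebesgue null
sets of `ℝᵈ` (`isKhintchineType_iff`), and one studies the set `approxParam A ψ` of parameters of
the `ψ`-approximable points. Such a parameter `x` is close to rational points `a / q` for which
`‖(q, a) A‖` is small, so everything depends on the number of integer vectors `v = (q, a)` of a
region with `‖v A‖ ≤ δ`.

If `ω(A) < n`, then `‖A qᵀ‖ ≥ c |q|^(-w)` for all `q ≠ 0` and some `w < n`
(`exists_le_distInt_of_exponent_lt`), so the points `A k` with `|k| < J` are well separated modulo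
`1`. A large sieve inequality, proved with the Fejér kernel (`card_mul_card_le`), then gives the
expected upper bound `O(R ^ D δ ^ m)` for the number of `v` in a cube of side `R` with `‖v A‖ ≤ δ`,
for all `δ ≥ R ^ (-κ)` with some `κ > 1 / n` (`exists_card_cube_le`). Approximation to the order
`q ^ (-κ)` belongs to the convergence case, and functions that are not smaller than this are in the
range of the bound.

* Convergence: the bound and the Borel–Cantelli lemma over dyadic blocks of denominators
  (`volume_approxParam_eq_zero`).
* Divergence: by Dirichlet's theorem each `x` has a good rational approximation `a / q` with
  `q ≤ 2 ^ k` and `‖(q, a) A‖` small. By the upper bound, those with `q` much smaller than `2 ^ k`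
  serve only a small proportion of any ball, so the others form a ubiquitous system
  (`eventually_exists_separated`). A second moment argument shows that the limsup set fills a fixed
  proportion of every ball (`le_volume_frequently_of_ubiquity`), and Lebesgue's density theorem
  turns this into full measure (`volume_compl_approxParam_eq_zero`).

The bound also excludes `d = 0`, where always `ω(A) ≥ n` (`dim_pos`).

If `ω(A) > n`, a very small `‖A qᵀ‖` gives a very small value of an integral linear form at
`(1, y)`, for every point `y` of `L_A` at once. Khintchine's transference principle, here in a
pigeonhole form, makes all points of `L_A` simultaneously approximable to some order `κ > 1 / n`
(`exists_approxParam_eq_univ`), which contradicts the convergence case for `ψ(q) = q ^ (-κ)`.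
-/

open scoped NNReal MeasureTheory

namespace KhintchineAffine

open MeasureTheory Filter Topology

/-! ### Distance to the nearest integer point -/

theorem distInt_le {n : ℕ} (y : Fin n → ℝ) (k : Fin n → ℤ) :
    distInt y ≤ ‖fun i => y i - (k i : ℝ)‖ :=
  ciInf_le ⟨0, by rintro _ ⟨k, rfl⟩; exact norm_nonneg _⟩ k

theorem distInt_eq_norm_sub_round {n : ℕ} (y : Fin n → ℝ) :
    distInt y = ‖fun i => y i - (round (y i) : ℝ)‖ := by
  refine le_antisymm (distInt_le y _) (le_ciInf fun k => ?_)
  refine (pi_norm_le_iff_of_nonneg (norm_nonneg _)).2 fun i => ?_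
  exact (round_le (y i) (k i)).trans (norm_le_pi_norm (fun i => y i - (k i : ℝ)) i)

theorem distInt_nonneg {n : ℕ} (y : Fin n → ℝ) : 0 ≤ distInt y := by
  rw [distInt_eq_norm_sub_round]; exact norm_nonneg _

theorem exists_int_of_distInt_lt {n : ℕ} {y : Fin n → ℝ} {δ : ℝ} (h : distInt y < δ) :
    ∃ k : Fin n → ℤ, ∀ i, |y i - k i| < δ := by
  rw [distInt_eq_norm_sub_round] at h
  exact ⟨fun i => round (y i), fun i => (norm_le_pi_norm (fun i => y i - (round (y i) : ℝ)) i).trans_lt h⟩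

theorem exists_int_of_distInt_le {n : ℕ} {y : Fin n → ℝ} {δ : ℝ} (h : distInt y ≤ δ) :
    ∃ k : Fin n → ℤ, ∀ i, |y i - k i| ≤ δ := by
  rw [distInt_eq_norm_sub_round] at h
  exact ⟨fun i => round (y i), fun i => (norm_le_pi_norm (fun i => y i - (round (y i) : ℝ)) i).trans h⟩

theorem distInt_lt_of_forall {n : ℕ} {y : Fin n → ℝ} {δ : ℝ} (hδ : 0 < δ) (k : Fin n → ℤ)
    (h : ∀ i, |y i - k i| < δ) : distInt y < δ :=
  (distInt_le y k).trans_lt ((pi_norm_lt_iff hδ).2 h)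

theorem distInt_le_of_forall {n : ℕ} {y : Fin n → ℝ} {δ : ℝ} (hδ : 0 ≤ δ) (k : Fin n → ℤ)
    (h : ∀ i, |y i - k i| ≤ δ) : distInt y ≤ δ :=
  (distInt_le y k).trans ((pi_norm_le_iff_of_nonneg hδ).2 h)

/-! ### Exponential sums and the large sieve -/

/-- The additive character `e(x) = exp(2πix)` of `ℝ / ℤ`. -/
noncomputable def addExp (x : ℝ) : ℂ := Complex.exp (((2 * Real.pi * x : ℝ) : ℂ) * Complex.I)

theorem addExp_add (x y : ℝ) : addExp (x + y) = addExp x * addExp y := by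
  simp only [addExp, ← Complex.exp_add]; congr 1; push_cast; ring

theorem addExp_zero : addExp 0 = 1 := by simp [addExp]

theorem norm_addExp (x : ℝ) : ‖addExp x‖ = 1 := Complex.norm_exp_ofReal_mul_I _

theorem addExp_int (k : ℤ) : addExp k = 1 := by
  rw [addExp, Complex.exp_eq_one_iff]; exact ⟨k, by push_cast; ring⟩

theorem addExp_sub_int (x : ℝ) (k : ℤ) : addExp (x - k) = addExp x := by
  have h := addExp_add (x - k) k
  rw [sub_add_cancel, addExp_int, mul_one] at h
  exact h.symm

theorem conj_addExp (x : ℝ) : (starRingEnd ℂ) (addExp x) = addExp (-x) := by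
  rw [addExp, addExp, ← Complex.exp_conj, map_mul, Complex.conj_ofReal, Complex.conj_I]
  congr 1; push_cast; ring

theorem addExp_nat_mul (n : ℕ) (x : ℝ) : addExp (n * x) = addExp x ^ n := by
  rw [addExp, addExp, ← Complex.exp_nat_mul]; congr 1; push_cast; ring

theorem addExp_sum {ι : Type*} (s : Finset ι) (f : ι → ℝ) :
    addExp (∑ i ∈ s, f i) = ∏ i ∈ s, addExp (f i) := by
  classical
  induction s using Finset.induction_on with
  | empty => simp [addExp_zero]
  | insert a s ha ih => rw [Finset.sum_insert ha, Finset.prod_insert ha, addExp_add, ih]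

theorem re_addExp (x : ℝ) : (addExp x).re = Real.cos (2 * Real.pi * x) :=
  Complex.exp_ofReal_mul_I_re _

theorem four_mul_abs_le_norm_addExp_sub_one {x : ℝ} (hx : |x| ≤ 1 / 2) :
    4 * |x| ≤ ‖addExp x - 1‖ := by
  have hpi := Real.pi_pos
  rw [addExp, mul_comm _ Complex.I, Complex.norm_exp_I_mul_ofReal_sub_one]
  have h := Real.mul_abs_le_abs_sin (x := Real.pi * x) (by
    rw [abs_mul, abs_of_pos hpi]; nlinarith)
  rw [show 2 * Real.pi * x / 2 = Real.pi * x by ring, norm_mul, Real.norm_eq_abs, Real.norm_eq_abs,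
    abs_two]
  rw [abs_mul, abs_of_pos hpi, ← mul_assoc, div_mul_cancel₀ _ hpi.ne'] at h
  linarith

/-- The Dirichlet kernel `∑_{0 ≤ s < L} e(sθ)`. -/
noncomputable def dirichletSum (L : ℕ) (θ : ℝ) : ℂ := ∑ s ∈ Finset.range L, addExp (s * θ)

theorem norm_dirichletSum_le (L : ℕ) (θ : ℝ) : ‖dirichletSum L θ‖ ≤ L := by
  refine (norm_sum_le _ _).trans ?_
  simp [norm_addExp]

theorem norm_dirichletSum_mul_le (L : ℕ) (θ : ℝ) :
    ‖dirichletSum L θ‖ * |θ - round θ| ≤ 1 / 2 := by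
  have h1 : dirichletSum L θ * (addExp (θ - round θ) - 1) = addExp (L * θ) - 1 := by
    rw [addExp_sub_int, dirichletSum, addExp_nat_mul, ← geom_sum_mul]
    simp_rw [addExp_nat_mul]
  have h2 := four_mul_abs_le_norm_addExp_sub_one (abs_sub_round θ)
  have h3 : ‖addExp (L * θ) - 1‖ ≤ 2 := by
    refine (norm_sub_le _ _).trans ?_
    rw [norm_addExp, norm_one]; norm_num
  rw [← h1, norm_mul] at h3
  have := mul_le_mul_of_nonneg_left h2 (norm_nonneg (dirichletSum L θ))
  linarith

/-- Pointwise majorant of the Fejér kernel in terms of the cell of length `1 / R` that contains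
the representative of `θ` in `[-1/2, 1/2]`. -/
theorem sq_norm_dirichletSum_le {R : ℕ} (θ : ℝ) :
    ‖dirichletSum (2 * R) θ‖ ^ 2 ≤
      13 * (R : ℝ) ^ 2 * (1 / (1 + (⌊R * (θ - round θ)⌋ : ℝ) ^ 2)) := by
  set t := θ - round θ
  set l := ⌊R * t⌋
  have h1 := norm_dirichletSum_le (2 * R) θ
  have h2 := norm_dirichletSum_mul_le (2 * R) θ
  have h0 := norm_nonneg (dirichletSum (2 * R) θ)
  set N := ‖dirichletSum (2 * R) θ‖
  push_cast at h1
  have hl : (l : ℝ) ^ 2 ≤ 2 * (R * t) ^ 2 + 2 := by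
    have a := Int.floor_le (R * t)
    have b := Int.lt_floor_add_one (R * t)
    change (l : ℝ) ≤ R * t at a
    change R * t < l + 1 at b
    nlinarith [sq_nonneg (R * t + (R * t - l))]
  rw [mul_one_div, le_div_iff₀ (by positivity)]
  have h3 : N ^ 2 ≤ 4 * (R : ℝ) ^ 2 := by nlinarith
  have h4 : (N * |t|) ^ 2 ≤ 1 / 4 := by
    have : 0 ≤ N * |t| := by positivity
    nlinarith
  rw [mul_pow, sq_abs] at h4
  have h5 : N ^ 2 * (R * t) ^ 2 ≤ 1 / 4 * (R : ℝ) ^ 2 := by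
    have := mul_le_mul_of_nonneg_right h4 (sq_nonneg (R : ℝ))
    nlinarith
  nlinarith [mul_le_mul_of_nonneg_left hl (sq_nonneg N), sq_nonneg (R : ℝ)]

theorem exists_sum_one_div_one_add_sq_le :
    ∃ C : ℝ, 0 < C ∧ ∀ s : Finset ℤ, ∑ l ∈ s, 1 / (1 + (l : ℝ) ^ 2) ≤ C := by
  have h : Summable fun l : ℤ => 1 / (1 + (l : ℝ) ^ 2) := by
    have h0 := (Real.summable_one_div_int_pow (p := 2)).2 (by norm_num)
    refine Summable.of_norm_bounded_eventually (g := fun l : ℤ => 1 / (l : ℝ) ^ 2) h0 ?_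
    rw [Filter.eventually_cofinite]
    refine (Set.finite_singleton (0 : ℤ)).subset fun l hl => ?_
    by_contra h'
    apply hl
    have : (0 : ℝ) < (l : ℝ) ^ 2 := by
      have : (l : ℝ) ≠ 0 := by exact_mod_cast h'
      positivity
    rw [Real.norm_of_nonneg (by positivity)]
    exact one_div_le_one_div_of_le this (by linarith)
  refine ⟨(∑' l : ℤ, 1 / (1 + (l : ℝ) ^ 2)) + 1, ?_, fun s => ?_⟩
  · have : 0 ≤ ∑' l : ℤ, 1 / (1 + (l : ℝ) ^ 2) := tsum_nonneg fun l => by positivity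
    linarith
  · have := h.sum_le_tsum s fun l _ => by positivity
    linarith

/-- The Fejér kernel summed over points of the torus that are `1 / R`-separated: every cell of side
`1 / R` contains at most one point. -/
theorem sum_prod_sq_norm_dirichletSum_le {C : ℝ}
    (hC : ∀ s : Finset ℤ, ∑ l ∈ s, 1 / (1 + (l : ℝ) ^ 2) ≤ C) {ι : Type*} {D R : ℕ} (hR : 0 < R)
    (S : Finset ι) (θ : ι → Fin D → ℝ)
    (hθ : ∀ j ∈ S, ∀ j' ∈ S, j ≠ j' → 1 / (R : ℝ) ≤ distInt (fun i => θ j i - θ j' i)) :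
    ∑ j ∈ S, ∏ i, ‖dirichletSum (2 * R) (θ j i)‖ ^ 2 ≤ (13 * (R : ℝ) ^ 2 * C) ^ D := by
  classical
  have hR' : (0 : ℝ) < R := by exact_mod_cast hR
  set cell : ι → Fin D → ℤ := fun j i => ⌊R * (θ j i - round (θ j i))⌋ with hcell
  set g : ℤ → ℝ := fun l => 13 * (R : ℝ) ^ 2 * (1 / (1 + (l : ℝ) ^ 2)) with hg
  have hg0 : ∀ l, 0 ≤ g l := fun l => by simp only [hg]; positivity
  have hinj : Set.InjOn cell S := by
    intro j hj j' hj' h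
    by_contra hne
    refine absurd (hθ j hj j' hj' hne) (not_le.2 ?_)
    refine distInt_lt_of_forall (by positivity) (fun i => round (θ j i) - round (θ j' i)) fun i => ?_
    have h1 := Int.abs_sub_lt_one_of_floor_eq_floor (congrFun h i)
    rw [lt_div_iff₀ hR', ← abs_of_pos hR', ← abs_mul]
    convert h1 using 2
    push_cast; ring
  calc ∑ j ∈ S, ∏ i, ‖dirichletSum (2 * R) (θ j i)‖ ^ 2
      ≤ ∑ j ∈ S, ∏ i, g (cell j i) := Finset.sum_le_sum fun j _ =>
        Finset.prod_le_prod (fun i _ => by positivity) fun i _ => sq_norm_dirichletSum_le _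
    _ = ∑ c ∈ S.image cell, ∏ i, g (c i) := by
        rw [Finset.sum_image hinj]
    _ ≤ ∑ c ∈ Fintype.piFinset fun i => (S.image fun j => cell j i), ∏ i, g (c i) := by
        refine Finset.sum_le_sum_of_subset_of_nonneg ?_ fun c _ _ =>
          Finset.prod_nonneg fun i _ => hg0 _
        intro c hc
        obtain ⟨j, hj, rfl⟩ := Finset.mem_image.1 hc
        exact Fintype.mem_piFinset.2 fun i => Finset.mem_image.2 ⟨j, hj, rfl⟩
    _ = ∏ i : Fin D, ∑ l ∈ S.image fun j => cell j i, g l := (Finset.prod_univ_sum _ _).symm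
    _ ≤ ∏ _i : Fin D, (13 * (R : ℝ) ^ 2 * C) := by
        refine Finset.prod_le_prod (fun i _ => Finset.sum_nonneg fun l _ => hg0 l) fun i _ => ?_
        simp only [hg]
        rw [← Finset.mul_sum]
        exact mul_le_mul_of_nonneg_left (hC _) (by positivity)
    _ = _ := by simp

theorem sum_piFinset_addExp (D L : ℕ) (θ : Fin D → ℝ) :
    ∑ s ∈ Fintype.piFinset fun _ : Fin D => Finset.range L, addExp (∑ i, (s i : ℝ) * θ i) =
      ∏ i, dirichletSum L (θ i) := by
  simp only [dirichletSum, Finset.prod_univ_sum, addExp_sum]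

/-- Opening the square and summing the Fejér weights `s - t` gives products of Fejér kernels. -/
theorem sum_sum_sq_norm_le {ι : Type*} {D L : ℕ} (S : Finset ι) (θ : ι → Fin D → ℝ)
    (v₀ : Fin D → ℤ) :
    ∑ s ∈ Fintype.piFinset fun _ : Fin D => Finset.range L,
      ∑ t ∈ Fintype.piFinset fun _ : Fin D => Finset.range L,
        ‖∑ j ∈ S, addExp (∑ i, ((v₀ i : ℝ) + s i - t i) * θ j i)‖ ^ 2 ≤
    ∑ j' ∈ S, ∑ j ∈ S, ∏ i, ‖dirichletSum L (θ j i - θ j' i)‖ ^ 2 := by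
  set B := Fintype.piFinset fun _ : Fin D => Finset.range L
  set F : ι → ι → ℂ := fun j' j => ∑ s ∈ B, ∑ t ∈ B,
    addExp (∑ i, ((v₀ i : ℝ) + s i - t i) * (θ j i - θ j' i))
  have h1 : ((∑ s ∈ B, ∑ t ∈ B,
      ‖∑ j ∈ S, addExp (∑ i, ((v₀ i : ℝ) + s i - t i) * θ j i)‖ ^ 2 : ℝ) : ℂ) =
      ∑ j' ∈ S, ∑ j ∈ S, F j' j := by
    simp only [F]
    have hpt : ∀ s t : Fin D → ℕ,
        (((‖∑ j ∈ S, addExp (∑ i, ((v₀ i : ℝ) + s i - t i) * θ j i)‖ ^ 2 : ℝ)) : ℂ) =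
        ∑ j' ∈ S, ∑ j ∈ S, addExp (∑ i, ((v₀ i : ℝ) + s i - t i) * (θ j i - θ j' i)) := by
      intro s t
      rw [Complex.ofReal_pow, ← Complex.mul_conj', map_sum, Finset.sum_mul_sum, Finset.sum_comm]
      refine Finset.sum_congr rfl fun j' _ => Finset.sum_congr rfl fun j _ => ?_
      rw [conj_addExp, ← addExp_add, ← sub_eq_add_neg, ← Finset.sum_sub_distrib]
      simp_rw [mul_sub]
    rw [Complex.ofReal_sum]
    simp_rw [Complex.ofReal_sum, hpt]
    rw [Finset.sum_congr rfl fun s _ => Finset.sum_comm, Finset.sum_comm]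
    refine Finset.sum_congr rfl fun j' _ => ?_
    rw [Finset.sum_congr rfl fun s _ => Finset.sum_comm, Finset.sum_comm]
  have h2 : ∀ j' j, ‖F j' j‖ = ∏ i, ‖dirichletSum L (θ j i - θ j' i)‖ ^ 2 := by
    intro j' j
    have : F j' j = addExp (∑ i, (v₀ i : ℝ) * (θ j i - θ j' i)) *
        ((∑ s ∈ B, addExp (∑ i, (s i : ℝ) * (θ j i - θ j' i))) *
          (starRingEnd ℂ) (∑ t ∈ B, addExp (∑ i, (t i : ℝ) * (θ j i - θ j' i)))) := by
      simp only [F]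
      rw [map_sum, Finset.sum_mul_sum, Finset.mul_sum]
      refine Finset.sum_congr rfl fun s _ => ?_
      rw [Finset.mul_sum]
      refine Finset.sum_congr rfl fun t _ => ?_
      rw [conj_addExp, ← addExp_add, ← addExp_add, ← Finset.sum_neg_distrib,
        ← Finset.sum_add_distrib, ← Finset.sum_add_distrib]
      congr 1
      exact Finset.sum_congr rfl fun i _ => by ring
    rw [this, norm_mul, norm_mul, norm_addExp, one_mul, Complex.norm_conj, sum_piFinset_addExp,
      norm_prod, ← sq, Finset.prod_pow]
  have h3 : (0 : ℝ) ≤ ∑ s ∈ B, ∑ t ∈ B,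
      ‖∑ j ∈ S, addExp (∑ i, ((v₀ i : ℝ) + s i - t i) * θ j i)‖ ^ 2 :=
    Finset.sum_nonneg fun s _ => Finset.sum_nonneg fun t _ => by positivity
  rw [← Real.norm_of_nonneg h3, ← Complex.norm_real, h1]
  refine (norm_sum_le _ _).trans (Finset.sum_le_sum fun j' _ => ?_)
  refine (norm_sum_le _ _).trans (Finset.sum_le_sum fun j _ => (h2 j' j).le)

/-- A large sieve bound: if the frequencies `θ j`, `j ∈ S`, are `1 / R`-separated modulo `1`, then
at most `O(R ^ D / |S|)` integer points `v` of a cube of side `R` have all the phases `v · θ j`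
within `1 / 6` of an integer. -/
theorem card_mul_card_le {C : ℝ}
    (hC : ∀ s : Finset ℤ, ∑ l ∈ s, 1 / (1 + (l : ℝ) ^ 2) ≤ C) {ι : Type*} {D R : ℕ} (hR : 0 < R)
    (S : Finset ι) (θ : ι → Fin D → ℝ)
    (hθ : ∀ j ∈ S, ∀ j' ∈ S, j ≠ j' → 1 / (R : ℝ) ≤ distInt (fun i => θ j i - θ j' i))
    (v₀ : Fin D → ℤ) (V : Finset (Fin D → ℤ)) (hV : ∀ v ∈ V, ∀ i, v₀ i ≤ v i ∧ v i < v₀ i + R)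
    (hVS : ∀ v ∈ V, ∀ j ∈ S, ∃ z : ℤ, |∑ i, (v i : ℝ) * θ j i - z| ≤ 1 / 6) :
    (V.card : ℝ) * S.card ≤ 4 * (13 * C) ^ D * (R : ℝ) ^ D := by
  classical
  have hR' : (0 : ℝ) < R := by exact_mod_cast hR
  have hC0 : 0 ≤ C := by simpa using hC ∅
  rcases S.eq_empty_or_nonempty with rfl | hS
  · simp; positivity
  have hScard : (0 : ℝ) < S.card := by exact_mod_cast hS.card_pos
  set T : (Fin D → ℤ) → ℂ := fun v => ∑ j ∈ S, addExp (∑ i, (v i : ℝ) * θ j i) with hT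
  set B := Fintype.piFinset fun _ : Fin D => Finset.range (2 * R)
  set B' := Fintype.piFinset fun _ : Fin D => Finset.range R
  -- the phases lie within `1 / 6` of integers, so each summand has real part at least `1 / 2`
  have hlow : ∀ v ∈ V, (S.card : ℝ) / 2 ≤ ‖T v‖ := by
    intro v hv
    refine le_trans ?_ (Complex.re_le_norm _)
    rw [hT, Complex.re_sum, div_eq_mul_one_div, ← nsmul_eq_mul]
    refine Finset.card_nsmul_le_sum _ _ _ fun j hj => ?_
    obtain ⟨z, hz⟩ := hVS v hv j hj
    rw [← addExp_sub_int _ z, re_addExp, ← Real.cos_abs, ← Real.cos_pi_div_three]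
    have hpi := Real.pi_pos
    refine Real.cos_le_cos_of_nonneg_of_le_pi (abs_nonneg _) (by linarith) ?_
    rw [abs_mul, abs_of_pos (by positivity)]
    nlinarith
  -- every `v ∈ V` has at least `R ^ D` representations `v₀ + s - t` with `0 ≤ s, t < 2 R`
  have h1 : (V.card : ℝ) * (R : ℝ) ^ D * ((S.card : ℝ) / 2) ^ 2 ≤
      ∑ s ∈ B, ∑ t ∈ B, ‖∑ j ∈ S, addExp (∑ i, ((v₀ i : ℝ) + s i - t i) * θ j i)‖ ^ 2 := by
    rw [← Finset.sum_product']
    calc (V.card : ℝ) * (R : ℝ) ^ D * ((S.card : ℝ) / 2) ^ 2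
        = ∑ p ∈ V ×ˢ B', ((S.card : ℝ) / 2) ^ 2 := by
          rw [Finset.sum_const, Finset.card_product, nsmul_eq_mul]
          simp [B', Fintype.card_piFinset]
      _ ≤ ∑ p ∈ V ×ˢ B', ‖T p.1‖ ^ 2 := Finset.sum_le_sum fun p hp =>
          pow_le_pow_left₀ (by positivity) (hlow _ (Finset.mem_product.1 hp).1) 2
      _ = ∑ p ∈ (V ×ˢ B').image
            (fun p => ((fun i => (p.1 i - v₀ i + p.2 i).toNat : Fin D → ℕ), p.2)),
            ‖∑ j ∈ S, addExp (∑ i, ((v₀ i : ℝ) + p.1 i - p.2 i) * θ j i)‖ ^ 2 := by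
          rw [Finset.sum_image]
          · refine Finset.sum_congr rfl fun p hp => ?_
            simp only [hT]
            have : ∀ i, ((v₀ i : ℝ) + ((p.1 i - v₀ i + p.2 i).toNat : ℕ) - p.2 i) = p.1 i := by
              intro i
              have h := hV _ (Finset.mem_product.1 hp).1 i
              have h2 : (((p.1 i - v₀ i + p.2 i).toNat : ℕ) : ℤ) = p.1 i - v₀ i + p.2 i :=
                Int.toNat_of_nonneg (by omega)
              have h3 : (((p.1 i - v₀ i + p.2 i).toNat : ℕ) : ℝ) = p.1 i - v₀ i + p.2 i := by
                exact_mod_cast h2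
              rw [h3]; ring
            simp_rw [this]
          · intro p hp p' hp' h
            have h1 := hV _ (Finset.mem_product.1 hp).1
            have h2 := hV _ (Finset.mem_product.1 hp').1
            obtain ⟨h3, h4⟩ := Prod.mk.inj h
            refine Prod.ext (funext fun i => ?_) h4
            have h5 := congrFun h3 i
            have h6 := congrFun h4 i
            have h7 := h1 i
            have h8 := h2 i
            omega
      _ ≤ _ := by
          refine Finset.sum_le_sum_of_subset_of_nonneg ?_ fun p _ _ => by positivity
          intro p hp
          obtain ⟨p', hp', rfl⟩ := Finset.mem_image.1 hp
          obtain ⟨h1, h2⟩ := Finset.mem_product.1 hp'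
          have h2' := fun i => Finset.mem_range.1 (Fintype.mem_piFinset.1 h2 i)
          refine Finset.mem_product.2 ⟨Fintype.mem_piFinset.2 fun i => Finset.mem_range.2 ?_,
            Fintype.mem_piFinset.2 fun i => Finset.mem_range.2 ?_⟩
          · have := hV _ h1 i
            have := h2' i
            simp only
            omega
          · have := h2' i
            simp only
            omega
  have h2 : ∑ j' ∈ S, ∑ j ∈ S, ∏ i, ‖dirichletSum (2 * R) (θ j i - θ j' i)‖ ^ 2 ≤
      S.card * (13 * (R : ℝ) ^ 2 * C) ^ D := by
    rw [← nsmul_eq_mul]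
    refine Finset.sum_le_card_nsmul _ _ _ fun j' hj' => ?_
    refine sum_prod_sq_norm_dirichletSum_le hC hR S (fun j i => θ j i - θ j' i) ?_
    intro a ha b hb hab
    simpa using hθ a ha b hb hab
  have h3 := (h1.trans (sum_sum_sq_norm_le S θ v₀)).trans h2
  have h4 : (13 * (R : ℝ) ^ 2 * C) ^ D = (13 * C) ^ D * (R : ℝ) ^ D * (R : ℝ) ^ D := by
    rw [← mul_pow, ← mul_pow]; congr 1; ring
  rw [h4] at h3
  have h5 : (0 : ℝ) < (R : ℝ) ^ D * S.card := by positivity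
  refine le_of_mul_le_mul_right ?_ h5
  nlinarith

/-! ### Counting rational points near the affine subspace -/

theorem exists_pos_le_of_finset {α : Type*} (s : Finset α) (f : α → ℝ) (hf : ∀ x ∈ s, 0 < f x) :
    ∃ c : ℝ, 0 < c ∧ ∀ x ∈ s, c ≤ f x := by
  rcases s.eq_empty_or_nonempty with rfl | hs
  · exact ⟨1, one_pos, by simp⟩
  · obtain ⟨a, ha, h⟩ := s.exists_min_image f hs
    exact ⟨f a, hf a ha, h⟩

theorem one_le_norm_intCast {m : ℕ} {q : Fin m → ℤ} (hq : q ≠ 0) :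
    1 ≤ ‖fun j => (q j : ℝ)‖ := by
  obtain ⟨j, hj⟩ := Function.ne_iff.1 hq
  refine le_trans ?_ (norm_le_pi_norm (fun j => (q j : ℝ)) j)
  rw [Real.norm_eq_abs]
  exact_mod_cast Int.one_le_abs hj

theorem distInt_nat_mul_eq_zero {n : ℕ} {y : Fin n → ℝ} (h : distInt y = 0) (t : ℕ) :
    distInt (fun i => (t : ℝ) * y i) = 0 := by
  obtain ⟨k, hk⟩ := exists_int_of_distInt_le h.le
  refine le_antisymm (distInt_le_of_forall le_rfl (fun i => t * k i) fun i => ?_) (distInt_nonneg _)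
  have : y i = k i := by
    have := abs_nonpos_iff.1 (hk i)
    linarith
  simp [this]

/-- If `ω(A) < n` then `‖A qᵀ‖ ≫ |q|^(-w)` for all `q ≠ 0`, with some `w < n`: the finitely many
exceptional `q` only affect the constant, as `‖A qᵀ‖ = 0` for one `q ≠ 0` would force `ω(A) = ∞`. -/
theorem exists_le_distInt_of_exponent_lt {r m n : ℕ} (hn : 1 ≤ n) (A : Matrix (Fin r) (Fin m) ℝ)
    (hA : diophantineExponent A < (n : EReal)) :
    ∃ c w : ℝ, 0 < c ∧ 0 < w ∧ w < n ∧ ∀ q : Fin m → ℤ, q ≠ 0 →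
      c * ‖fun j => (q j : ℝ)‖ ^ (-w) ≤ distInt (A.mulVec fun j => (q j : ℝ)) := by
  have h0 : max (diophantineExponent A) 0 < (n : EReal) := by
    refine max_lt hA ?_
    exact_mod_cast hn
  obtain ⟨w, hw1, hw2⟩ := EReal.lt_iff_exists_real_btwn.1 h0
  have hw0 : 0 < w := by exact_mod_cast (le_max_right _ _).trans_lt hw1
  have hwn : w < n := by exact_mod_cast hw2
  have hfin : {q : Fin m → ℤ |
      distInt (A.mulVec fun j => (q j : ℝ)) < ‖fun j => (q j : ℝ)‖ ^ (-w)}.Finite := by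
    by_contra hinf
    have : (w : EReal) ≤ diophantineExponent A := le_sSup ⟨w, hinf, rfl⟩
    exact absurd ((le_max_left _ _).trans_lt hw1) (not_lt.2 this)
  have hpos : ∀ q : Fin m → ℤ, q ≠ 0 → 0 < distInt (A.mulVec fun j => (q j : ℝ)) := by
    intro q hq
    refine (distInt_nonneg _).lt_of_ne' fun h => ?_
    refine Set.infinite_of_injective_forall_mem (f := fun t : ℕ => fun j => ((t : ℤ) + 1) * q j)
      ?_ ?_ hfin
    · intro t t' htt
      obtain ⟨j, hj⟩ := Function.ne_iff.1 hq
      have := congrFun htt j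
      have := mul_right_cancel₀ hj this
      omega
    · intro t
      have hne : (fun j => ((t : ℤ) + 1) * q j) ≠ 0 := by
        obtain ⟨j, hj⟩ := Function.ne_iff.1 hq
        exact Function.ne_iff.2 ⟨j, mul_ne_zero (by omega) hj⟩
      have e : (A.mulVec fun j => ((((t : ℤ) + 1) * q j : ℤ) : ℝ)) =
          fun i => ((t + 1 : ℕ) : ℝ) * (A.mulVec fun j => (q j : ℝ)) i := by
        ext i
        simp only [Matrix.mulVec, dotProduct, Finset.mul_sum]
        refine Finset.sum_congr rfl fun j _ => ?_
        push_cast; ring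
      simp only [Set.mem_ofPred_eq]
      rw [e, distInt_nat_mul_eq_zero h]
      exact Real.rpow_pos_of_pos (one_pos.trans_le (one_le_norm_intCast hne)) _
  obtain ⟨c, hc, hcF⟩ := exists_pos_le_of_finset (hfin.toFinset.filter (· ≠ 0))
    (fun q => distInt (A.mulVec fun j => (q j : ℝ)) / ‖fun j => (q j : ℝ)‖ ^ (-w)) (by
      intro q hq
      have hq := (Finset.mem_filter.1 hq).2
      exact div_pos (hpos q hq)
        (Real.rpow_pos_of_pos (one_pos.trans_le (one_le_norm_intCast hq)) _))
  refine ⟨min c 1, w, by positivity, hw0, hwn, fun q hq => ?_⟩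
  have hN : 0 < ‖fun j => (q j : ℝ)‖ ^ (-w) :=
    Real.rpow_pos_of_pos (one_pos.trans_le (one_le_norm_intCast hq)) _
  by_cases hqF : q ∈ hfin.toFinset
  · have := hcF q (Finset.mem_filter.2 ⟨hqF, hq⟩)
    rw [le_div_iff₀ hN] at this
    exact le_trans (mul_le_mul_of_nonneg_right (min_le_left _ _) hN.le) this
  · have h : ‖fun j => (q j : ℝ)‖ ^ (-w) ≤ distInt (A.mulVec fun j => (q j : ℝ)) := by
      simpa using hqF
    refine le_trans (mul_le_mul_of_nonneg_right (min_le_right c 1) hN.le) (by simpa using h)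

/-- The number of integer points `v` of a cube of side `R` with `‖v A‖ ≤ δ` is `O(R ^ D δ ^ m)`,
as long as `δ` is not below `R ^ (-κ)`. -/
theorem exists_card_cube_le {D m : ℕ} (hm : 1 ≤ m) (A : Matrix (Fin D) (Fin m) ℝ) {c w κ : ℝ}
    (hc : 0 < c) (hw : 0 < w) (hκ : 0 < κ) (hκw : κ * w < 1)
    (hA : ∀ q : Fin m → ℤ, q ≠ 0 →
      c * ‖fun j => (q j : ℝ)‖ ^ (-w) ≤ distInt (A.mulVec fun j => (q j : ℝ))) :
    ∃ K : ℝ, 0 < K ∧ ∀ R : ℕ, 0 < R → ∀ δ : ℝ, (R : ℝ) ^ (-κ) ≤ δ → ∀ v₀ : Fin D → ℤ,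
      ∀ V : Finset (Fin D → ℤ), (∀ v ∈ V, ∀ i, v₀ i ≤ v i ∧ v i < v₀ i + R) →
      (∀ v ∈ V, distInt (Matrix.vecMul (fun i => (v i : ℝ)) A) ≤ δ) →
      (V.card : ℝ) ≤ K * (R : ℝ) ^ D * δ ^ m := by
  classical
  obtain ⟨C, hC0, hC⟩ := exists_sum_one_div_one_add_sq_le
  have hm' : (1 : ℝ) ≤ m := by exact_mod_cast hm
  have h1κ : 0 < 1 - κ * w := by linarith
  set X : ℝ := (1 / c) ^ (1 / (1 - κ * w)) with hX
  have hX0 : 0 < X := Real.rpow_pos_of_pos (by positivity) _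
  refine ⟨(6 * m) ^ m + 4 * (13 * C) ^ D * (12 * m) ^ m + (X ^ κ) ^ m, by positivity, ?_⟩
  intro R hR δ hδ v₀ V hV hVδ
  have hR1 : (1 : ℝ) ≤ R := by exact_mod_cast hR
  have hR0 : (0 : ℝ) < R := by linarith
  have hδ0 : 0 < δ := (Real.rpow_pos_of_pos hR0 _).trans_le hδ
  have htriv : (V.card : ℝ) ≤ (R : ℝ) ^ D := by
    have hsub : V ⊆ Fintype.piFinset fun i => Finset.Ico (v₀ i) (v₀ i + R) := fun v hv =>
      Fintype.mem_piFinset.2 fun i => Finset.mem_Ico.2 (hV v hv i)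
    have := Finset.card_le_card hsub
    rw [Fintype.card_piFinset] at this
    simp only [Int.card_Ico, add_sub_cancel_left, Int.toNat_natCast, Finset.prod_const,
      Finset.card_univ, Fintype.card_fin] at this
    exact_mod_cast this
  have hRD : (0 : ℝ) < (R : ℝ) ^ D := by positivity
  set a : ℝ := (6 * m) ^ m * δ ^ m
  set b : ℝ := 4 * (13 * C) ^ D * (12 * m) ^ m * δ ^ m
  set e : ℝ := (X ^ κ) ^ m * δ ^ m
  have ha : 0 ≤ a := by positivity
  have hb : 0 ≤ b := by positivity
  have he : 0 ≤ e := by positivity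
  suffices h : (V.card : ℝ) ≤ R ^ D * a ∨ (V.card : ℝ) ≤ R ^ D * b ∨ (V.card : ℝ) ≤ R ^ D * e by
    have e1 : ((6 * m) ^ m + 4 * (13 * C) ^ D * (12 * m) ^ m + (X ^ κ) ^ m) * (R : ℝ) ^ D * δ ^ m
      = R ^ D * a + R ^ D * b + R ^ D * e := by ring
    rw [e1]
    have := mul_nonneg hRD.le ha
    have := mul_nonneg hRD.le hb
    have := mul_nonneg hRD.le he
    rcases h with h | h | h <;> linarith
  have hle1 : ∀ t : ℝ, 1 ≤ t → (V.card : ℝ) ≤ R ^ D * t ^ m := fun t ht =>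
    htriv.trans (le_mul_of_one_le_right hRD.le (one_le_pow₀ ht))
  -- the trivial bound suffices if `δ` is large or `R` is bounded
  rcases lt_or_ge 1 (6 * m * δ) with hbig | hsmall
  · left
    rw [show a = (6 * m * δ) ^ m from (mul_pow _ _ _).symm]
    exact hle1 _ hbig.le
  right
  rcases lt_or_ge (R : ℝ) X with hRX | hRX
  · right
    rw [show e = (X ^ κ * δ) ^ m from (mul_pow _ _ _).symm]
    refine hle1 _ ?_
    have h1 : X ^ κ * X ^ (-κ) = 1 := by rw [← Real.rpow_add hX0]; simp
    rw [← h1]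
    refine mul_le_mul_of_nonneg_left (le_trans ?_ hδ) (Real.rpow_nonneg hX0.le _)
    exact Real.rpow_le_rpow_of_nonpos hR0 hRX.le (by linarith)
  left
  have h6 : (0 : ℝ) < 6 * m * δ := by positivity
  set J : ℕ := ⌊1 / (6 * m * δ)⌋₊ with hJ
  have hJle : (J : ℝ) ≤ 1 / (6 * m * δ) := Nat.floor_le (by positivity)
  have hJ1 : 1 ≤ J := Nat.le_floor (by rw [Nat.cast_one, le_div_iff₀ h6]; linarith)
  have hJ1' : (1 : ℝ) ≤ J := by exact_mod_cast hJ1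
  have hJlt : 1 / (6 * m * δ) < J + 1 := Nat.lt_floor_add_one _
  have hJR : (J : ℝ) ≤ (R : ℝ) ^ κ := by
    refine hJle.trans ?_
    rw [div_le_iff₀ h6]
    have h1 : (R : ℝ) ^ κ * (R : ℝ) ^ (-κ) = 1 := by rw [← Real.rpow_add hR0]; simp
    have h2 := mul_le_mul_of_nonneg_left hδ (Real.rpow_nonneg hR0.le κ)
    rw [h1] at h2
    have h3 : 0 ≤ (R : ℝ) ^ κ * δ := by positivity
    nlinarith
  -- the differences of the frequencies `A j` stay away from integer points
  have hsep : ∀ k : Fin m → ℤ, k ≠ 0 → (∀ j, |k j| ≤ J) →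
      1 / (R : ℝ) ≤ distInt (A.mulVec fun j => (k j : ℝ)) := by
    intro k hk hkJ
    refine le_trans ?_ (hA k hk)
    have hk1 := one_le_norm_intCast hk
    have hkJ' : ‖fun j => (k j : ℝ)‖ ≤ (R : ℝ) ^ κ :=
      le_trans ((pi_norm_le_iff_of_nonneg (by positivity)).2 fun j => by
        rw [Real.norm_eq_abs]; exact_mod_cast hkJ j) hJR
    have h2 : (R : ℝ) ^ (-(κ * w)) ≤ ‖fun j => (k j : ℝ)‖ ^ (-w) := by
      have := Real.rpow_le_rpow_of_nonpos (z := -w) (by linarith) hkJ' (by linarith)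
      rwa [← Real.rpow_mul hR0.le, mul_neg] at this
    refine le_trans ?_ (mul_le_mul_of_nonneg_left h2 hc.le)
    have h3 : 1 / c ≤ (R : ℝ) ^ (1 - κ * w) := by
      have := Real.rpow_le_rpow hX0.le hRX h1κ.le
      rwa [hX, ← Real.rpow_mul (by positivity), one_div_mul_cancel h1κ.ne', Real.rpow_one] at this
    rw [div_le_iff₀ hc] at h3
    rw [sub_eq_add_neg, Real.rpow_add hR0, Real.rpow_one] at h3
    rw [div_le_iff₀ hR0]
    linarith
  set S := Fintype.piFinset fun _ : Fin m => Finset.range J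
  have hScard : (S.card : ℝ) = (J : ℝ) ^ m := by simp [S, Fintype.card_piFinset]
  have hmain := card_mul_card_le hC hR S (fun j => A.mulVec fun l => (j l : ℝ)) (by
    intro j hj j' hj' hne
    have e1 : (fun i => A.mulVec (fun l => (j l : ℝ)) i - A.mulVec (fun l => (j' l : ℝ)) i) =
        A.mulVec (fun l => (((j l : ℤ) - (j' l : ℤ) : ℤ) : ℝ)) := by
      ext i
      simp only [Matrix.mulVec, dotProduct, ← Finset.sum_sub_distrib]
      refine Finset.sum_congr rfl fun l _ => ?_
      push_cast; ring
    rw [e1]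
    refine hsep _ ?_ ?_
    · obtain ⟨l, hl⟩ := Function.ne_iff.1 hne
      exact Function.ne_iff.2 ⟨l, by simp only [Pi.zero_apply]; omega⟩
    · intro l
      have h1 := Finset.mem_range.1 (Fintype.mem_piFinset.1 hj l)
      have h2 := Finset.mem_range.1 (Fintype.mem_piFinset.1 hj' l)
      rw [abs_le]; omega) v₀ V hV (by
    intro v hv j hj
    obtain ⟨k, hk⟩ := exists_int_of_distInt_le (hVδ v hv)
    refine ⟨∑ l, k l * (j l : ℤ), ?_⟩
    have e1 : ∑ i, (v i : ℝ) * A.mulVec (fun l => (j l : ℝ)) i =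
        ∑ l, Matrix.vecMul (fun i => (v i : ℝ)) A l * (j l : ℝ) :=
      Matrix.dotProduct_mulVec (fun i => (v i : ℝ)) A (fun l => (j l : ℝ))
    rw [e1]
    push_cast
    rw [← Finset.sum_sub_distrib]
    refine (Finset.abs_sum_le_sum_abs _ _).trans ?_
    have : ∀ l ∈ Finset.univ, |Matrix.vecMul (fun i => (v i : ℝ)) A l * (j l : ℝ) - k l * (j l : ℝ)|
        ≤ δ * (1 / (6 * m * δ)) := by
      intro l _
      rw [← sub_mul, abs_mul]
      refine mul_le_mul (hk l) (le_trans ?_ hJle) (abs_nonneg _) hδ0.le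
      rw [Nat.abs_cast]
      exact_mod_cast (Finset.mem_range.1 (Fintype.mem_piFinset.1 hj l)).le
    refine (Finset.sum_le_card_nsmul _ _ _ this).trans (le_of_eq ?_)
    simp only [Finset.card_univ, Fintype.card_fin, nsmul_eq_mul]
    field_simp)
  rw [hScard] at hmain
  have h12 : 1 ≤ (12 * m * δ) * J := by
    have h1 : 1 / (6 * m * δ) ≤ 2 * J := by linarith
    rw [div_le_iff₀ h6] at h1
    linarith
  calc (V.card : ℝ) ≤ V.card * ((12 * m * δ) * J) ^ m :=
        le_mul_of_one_le_right (Nat.cast_nonneg _) (one_le_pow₀ h12)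
    _ = (V.card * (J : ℝ) ^ m) * (12 * m * δ) ^ m := by rw [mul_pow]; ring
    _ ≤ (4 * (13 * C) ^ D * (R : ℝ) ^ D) * (12 * m * δ) ^ m :=
        mul_le_mul_of_nonneg_right hmain (by positivity)
    _ = R ^ D * b := by simp only [b]; rw [mul_pow]; ring

/-- The points counted by `exists_card_region_le`: integer vectors `v = (q, a)` with `0 ≤ q < P`,
`|a - q x₀| ≤ s P` and `‖v A‖ ≤ δ`, that is, rational points `a / q` of denominator at most `P` near
`x₀` that lift to rational points near the affine subspace. -/
def nearPoints {d m : ℕ} (A : Matrix (Fin (d + 1)) (Fin m) ℝ) (x₀ : Fin d → ℝ) (P : ℕ) (s δ : ℝ) :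
    Set (Fin (d + 1) → ℤ) :=
  {v | 0 ≤ v 0 ∧ v 0 < P ∧ (∀ i : Fin d, |(v i.succ : ℝ) - v 0 * x₀ i| ≤ s * P) ∧
    distInt (Matrix.vecMul (fun i => (v i : ℝ)) A) ≤ δ}

/-- The number of rational points near `L_A` in a ball of radius `s` about `x₀`: the region is covered
by `O(1 / s)` skewed cubes of side `s P`, to which `exists_card_cube_le` applies. The constant is
uniform for `x₀` in a bounded region. -/
theorem exists_card_region_le {d m : ℕ} (hm : 1 ≤ m) (A : Matrix (Fin (d + 1)) (Fin m) ℝ)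
    {c w κ : ℝ} (hc : 0 < c) (hw : 0 < w) (hκ : 0 < κ) (hκw : κ * w < 1)
    (hA : ∀ q : Fin m → ℤ, q ≠ 0 →
      c * ‖fun j => (q j : ℝ)‖ ^ (-w) ≤ distInt (A.mulVec fun j => (q j : ℝ))) (M : ℕ) :
    ∃ K : ℝ, 0 < K ∧ ∀ x₀ : Fin d → ℝ, (∀ i, |x₀ i| ≤ M) → ∀ (P : ℕ) (s δ : ℝ), 0 < s → s ≤ 1 →
      1 ≤ s * P → ∀ V : Finset (Fin (d + 1) → ℤ), (V : Set (Fin (d + 1) → ℤ)) ⊆ nearPoints A x₀ P s δ →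
      (V.card : ℝ) ≤ K * (P : ℝ) ^ (d + 1) * s ^ d * max δ ((s * P) ^ (-κ)) ^ m := by
  classical
  obtain ⟨K, hK, hcube⟩ := exists_card_cube_le hm A hc hw hκ hκw hA
  refine ⟨2 * (2 * M + 6) ^ d * K * 2 ^ (d + 1), by positivity, ?_⟩
  intro x₀ hx₀ P s δ hs hs1 hsP V hV
  set R : ℕ := ⌈s * P⌉₊ with hRdef
  have hRge : s * P ≤ R := Nat.le_ceil _
  have hRle : (R : ℝ) ≤ 2 * (s * P) := by
    have := Nat.ceil_lt_add_one (a := s * P) (by linarith)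
    change (R : ℝ) < _ at this
    linarith
  have hR1 : (1 : ℝ) ≤ R := hsP.trans hRge
  have hR : 0 < R := by exact_mod_cast one_pos.trans_le hR1
  have hRz : (0 : ℤ) < R := by exact_mod_cast hR
  have hP0 : (0 : ℝ) < P := by
    by_contra h
    have : s * P ≤ 0 := mul_nonpos_of_nonneg_of_nonpos hs.le (not_lt.1 h)
    linarith
  set base : ℤ → Fin d → ℤ := fun k i => ⌊(R : ℝ) * k * x₀ i⌋ with hbase
  -- the cube containing `v`: the block of `q = v 0`, and the position of `a` relative to the value
  -- of `q x₀` at the start of that block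
  set key : (Fin (d + 1) → ℤ) → ℤ × (Fin d → ℤ) := fun v =>
    (v 0 / R, fun i => (v i.succ - base (v 0 / R) i) / R) with hkey
  set keys : Finset (ℤ × (Fin d → ℤ)) :=
    Finset.Icc 0 (⌊1 / s⌋) ×ˢ Fintype.piFinset fun _ => Finset.Icc (-(M + 3 : ℤ)) (M + 2)
  have hmaps : ∀ v ∈ V, key v ∈ keys := by
    intro v hv
    obtain ⟨h0, hP, ha, -⟩ := hV hv
    have hdm := Int.mul_ediv_add_emod (v 0) R
    have hm0 := Int.emod_nonneg (v 0) hRz.ne'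
    have hm1 := Int.emod_lt_of_pos (v 0) hRz
    set k := v 0 / R
    set ρ := v 0 % R
    refine Finset.mem_product.2 ⟨Finset.mem_Icc.2 ⟨Int.ediv_nonneg h0 hRz.le, ?_⟩,
      Fintype.mem_piFinset.2 fun i => Finset.mem_Icc.2 ?_⟩
    · refine Int.le_floor.2 ?_
      change (k : ℝ) ≤ _
      rw [le_div_iff₀ hs]
      have h1 : (R : ℝ) * k ≤ P := by
        have : (R : ℤ) * k ≤ P := by linarith
        exact_mod_cast this
      by_contra hcon
      rcases le_or_gt k 0 with hk | hk
      · have : (k : ℝ) ≤ 0 := by exact_mod_cast hk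
        nlinarith
      · have hk' : (0 : ℝ) < k := by exact_mod_cast hk
        have : (k * s) * P ≤ 1 * P := by nlinarith
        have := le_of_mul_le_mul_right this hP0
        linarith
    · have hq : (v 0 : ℝ) = R * k + ρ := by exact_mod_cast hdm.symm
      have hρ0 : (0 : ℝ) ≤ ρ := by exact_mod_cast hm0
      have hρ1 : (ρ : ℝ) ≤ R := by exact_mod_cast hm1.le
      have hb1 := Int.floor_le ((R : ℝ) * k * x₀ i)
      have hb2 := Int.lt_floor_add_one ((R : ℝ) * k * x₀ i)
      have h1 : |(v i.succ : ℝ) - base k i| ≤ R * (M + 2) := by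
        have e1 : (v i.succ : ℝ) - base k i =
            (v i.succ - v 0 * x₀ i) + ρ * x₀ i + ((R : ℝ) * k * x₀ i - base k i) := by
          rw [hq]; ring
        have h2 : |(ρ : ℝ) * x₀ i| ≤ R * M := by
          rw [abs_mul, abs_of_nonneg hρ0]
          exact mul_le_mul hρ1 (hx₀ i) (abs_nonneg _) (by linarith)
        have h3 : |(R : ℝ) * k * x₀ i - base k i| ≤ R := by
          rw [abs_le]; constructor <;> linarith
        rw [e1]
        refine (abs_add_three _ _ _).trans ?_
        have := ha i
        linarith
      have h1' : |v i.succ - base k i| ≤ (R : ℤ) * (M + 2) := by exact_mod_cast h1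
      obtain ⟨h2, h3⟩ := abs_le.1 h1'
      constructor
      · refine (Int.le_ediv_iff_mul_le hRz).2 ?_
        nlinarith
      · refine Int.le_of_lt_add_one ((Int.ediv_lt_iff_lt_mul hRz).2 ?_)
        nlinarith
  have hfiber : ∀ p ∈ keys, ((V.filter fun v => key v = p).card : ℝ) ≤
      K * (R : ℝ) ^ (d + 1) * max δ ((s * P) ^ (-κ)) ^ m := by
    intro p _
    refine hcube R hR _ ?_ (Fin.cons (R * p.1) fun i => base p.1 i + R * p.2 i) _ ?_ ?_
    · exact le_trans (Real.rpow_le_rpow_of_nonpos (by linarith) hRge (by linarith))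
        (le_max_right _ _)
    · intro v hv i
      obtain ⟨-, hvp⟩ := Finset.mem_filter.1 hv
      subst hvp
      refine Fin.cases ?_ (fun i => ?_) i
      · simp only [hkey, Fin.cons_zero]
        have hdm := Int.mul_ediv_add_emod (v 0) R
        have hm0 := Int.emod_nonneg (v 0) hRz.ne'
        have hm1 := Int.emod_lt_of_pos (v 0) hRz
        constructor <;> linarith
      · simp only [hkey, Fin.cons_succ]
        have hdm := Int.mul_ediv_add_emod (v i.succ - base (v 0 / R) i) R
        have hm0 := Int.emod_nonneg (v i.succ - base (v 0 / R) i) hRz.ne'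
        have hm1 := Int.emod_lt_of_pos (v i.succ - base (v 0 / R) i) hRz
        constructor <;> linarith
    · intro v hv
      exact (hV (Finset.mem_filter.1 hv).1).2.2.2.trans (le_max_left _ _)
  have hcard : (V.card : ℝ) ≤ keys.card *
      (K * (R : ℝ) ^ (d + 1) * max δ ((s * P) ^ (-κ)) ^ m) := by
    rw [Finset.card_eq_sum_card_fiberwise (f := key) (t := keys) hmaps]
    push_cast
    rw [← nsmul_eq_mul]
    exact Finset.sum_le_card_nsmul _ _ _ hfiber
  have hkeys : (keys.card : ℝ) ≤ 2 / s * (2 * M + 6) ^ d := by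
    simp only [keys, Finset.card_product, Fintype.card_piFinset, Int.card_Icc, Finset.prod_const,
      Finset.card_univ, Fintype.card_fin, sub_zero]
    push_cast
    have e1 : ((((M : ℤ) + 2 + 1 - -((M : ℤ) + 3)).toNat : ℕ) : ℝ) = 2 * M + 6 := by
      have : ((((M : ℤ) + 2 + 1 - -((M : ℤ) + 3)).toNat : ℕ) : ℤ) = 2 * M + 6 := by omega
      exact_mod_cast this
    rw [e1]
    refine mul_le_mul_of_nonneg_right ?_ (by positivity)
    have h1 : (0 : ℤ) ≤ ⌊1 / s⌋ := Int.floor_nonneg.2 (by positivity)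
    have e2 : (((⌊1 / s⌋ + 1).toNat : ℕ) : ℝ) = ⌊1 / s⌋ + 1 := by
      have : (((⌊1 / s⌋ + 1).toNat : ℕ) : ℤ) = ⌊1 / s⌋ + 1 := by omega
      exact_mod_cast this
    rw [e2]
    have h2 := Int.floor_le (1 / s)
    have h3 : 1 ≤ 1 / s := by rw [le_div_iff₀ hs]; linarith
    have h4 : 2 / s = 1 / s + 1 / s := by ring
    linarith
  have hmax : 0 ≤ max δ ((s * P) ^ (-κ)) ^ m :=
    pow_nonneg (le_max_of_le_right (Real.rpow_nonneg (by linarith) _)) _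
  refine hcard.trans ?_
  calc (keys.card : ℝ) * (K * (R : ℝ) ^ (d + 1) * max δ ((s * P) ^ (-κ)) ^ m)
      ≤ (2 / s * (2 * M + 6) ^ d) * (K * (2 * (s * P)) ^ (d + 1) * max δ ((s * P) ^ (-κ)) ^ m) := by
        gcongr
    _ = _ := by
        rw [mul_pow, mul_pow, pow_succ s d]
        field_simp

/-! ### Reduction to sets of parameters -/

/-- The parametrisation `x ↦ (x, x̃ A)` of the affine subspace `L_A`, with values in `Fin (d + m) → ℝ`
(the space with the supremum norm). -/
noncomputable def graphMap {d m : ℕ} (A : Matrix (Fin (d + 1)) (Fin m) ℝ) (x : Fin d → ℝ) : Fin (d + m) → ℝ :=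
  Fin.append x (Matrix.vecMul (Matrix.vecCons 1 x) A)

/-- The set of parameters of the points of `L_A` that lie in `S_n(ψ)`. -/
def approxParam {d m : ℕ} (A : Matrix (Fin (d + 1)) (Fin m) ℝ) (ψ : ℕ+ → ℝ≥0) : Set (Fin d → ℝ) :=
  {x | {q : ℕ+ | distInt (fun i => ((q : ℕ) : ℝ) * graphMap A x i) < (ψ q : ℝ)}.Infinite}

/-- A constant bounding the variation of `x ↦ x̃ A`. -/
noncomputable def entrySum {r m : ℕ} (A : Matrix (Fin r) (Fin m) ℝ) : ℝ := 1 + ∑ i, ∑ j, |A i j|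

theorem one_le_entrySum {r m : ℕ} (A : Matrix (Fin r) (Fin m) ℝ) : 1 ≤ entrySum A := by
  have : 0 ≤ ∑ i, ∑ j, |A i j| := Finset.sum_nonneg fun i _ => Finset.sum_nonneg fun j _ => abs_nonneg _
  unfold entrySum; linarith

theorem abs_vecMul_le {r m : ℕ} (A : Matrix (Fin r) (Fin m) ℝ) {u : Fin r → ℝ} {t : ℝ} (ht : 0 ≤ t)
    (hu : ∀ i, |u i| ≤ t) (j : Fin m) : |Matrix.vecMul u A j| ≤ entrySum A * t := by
  calc |Matrix.vecMul u A j| = |∑ i, u i * A i j| := rfl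
    _ ≤ ∑ i, |u i * A i j| := Finset.abs_sum_le_sum_abs _ _
    _ ≤ ∑ i, t * ∑ j, |A i j| := Finset.sum_le_sum fun i _ => by
        rw [abs_mul]
        exact mul_le_mul (hu i) (Finset.single_le_sum (f := fun j => |A i j|)
          (fun j _ => abs_nonneg _) (Finset.mem_univ j)) (abs_nonneg _) ht
    _ ≤ entrySum A * t := by
        rw [← Finset.mul_sum, entrySum]; nlinarith

/-- If `u / u 0` is close to `x`, then `u A` is close to `u 0` times `x̃ A`. -/
theorem abs_vecMul_sub_le {d m : ℕ} (A : Matrix (Fin (d + 1)) (Fin m) ℝ) {u : Fin (d + 1) → ℝ}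
    {x : Fin d → ℝ} {t : ℝ} (ht : 0 ≤ t) (hu : ∀ i : Fin d, |u i.succ - u 0 * x i| ≤ t) (j : Fin m) :
    |Matrix.vecMul u A j - u 0 * Matrix.vecMul (Matrix.vecCons 1 x) A j| ≤ entrySum A * t := by
  have : Matrix.vecMul u A j - u 0 * Matrix.vecMul (Matrix.vecCons 1 x) A j =
      Matrix.vecMul (fun i => u i - u 0 * Matrix.vecCons 1 x i) A j := by
    simp only [Matrix.vecMul, dotProduct, Finset.mul_sum, ← Finset.sum_sub_distrib]
    exact Finset.sum_congr rfl fun i _ => by ring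
  rw [this]
  refine abs_vecMul_le A ht (fun i => ?_) j
  refine Fin.cases ?_ (fun i => ?_) i
  · simpa using ht
  · simpa using hu i

theorem lipschitzWith_graphMap {d m : ℕ} (A : Matrix (Fin (d + 1)) (Fin m) ℝ) :
    LipschitzWith (Real.toNNReal (entrySum A)) (graphMap A) := by
  refine LipschitzWith.of_dist_le_mul fun x y => ?_
  have h1 := one_le_entrySum A
  rw [Real.coe_toNNReal _ (by linarith), dist_eq_norm, dist_eq_norm,
    pi_norm_le_iff_of_nonneg (by positivity)]
  intro i
  refine Fin.addCases (fun i => ?_) (fun j => ?_) i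
  · simp only [graphMap, Pi.sub_apply, Fin.append_left]
    exact (norm_le_pi_norm (x - y) i).trans (le_mul_of_one_le_left (norm_nonneg _) h1)
  · simp only [graphMap, Pi.sub_apply, Fin.append_right, Real.norm_eq_abs]
    have := abs_vecMul_sub_le A (u := Matrix.vecCons 1 x) (x := y) (t := ‖x - y‖) (norm_nonneg _)
      (fun i => by simpa using norm_le_pi_norm (x - y) i) j
    simpa using this

theorem antilipschitzWith_graphMap {d m : ℕ} (A : Matrix (Fin (d + 1)) (Fin m) ℝ) :
    AntilipschitzWith 1 (graphMap A) := by
  refine AntilipschitzWith.of_le_mul_dist fun x y => ?_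
  rw [NNReal.coe_one, one_mul]
  refine (dist_pi_le_iff dist_nonneg).2 fun i => ?_
  have := dist_le_pi_dist (graphMap A x) (graphMap A y) (Fin.castAdd m i)
  simpa [graphMap] using this

/-- Null sets of `L_A` are the images of Lebesgue null sets of parameters. -/
theorem euclideanHausdorffMeasure_image_eq_zero_iff {d m : ℕ} (A : Matrix (Fin (d + 1)) (Fin m) ℝ)
    (S : Set (Fin d → ℝ)) :
    Measure.euclideanHausdorffMeasure d ((fun x => WithLp.toLp 2 (graphMap A x)) '' S :
      Set (EuclideanSpace ℝ (Fin (d + m)))) = 0 ↔ volume S = 0 := by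
  have hc : Measure.addHaarScalarFactor (volume : Measure (EuclideanSpace ℝ (Fin d)))
      (Measure.hausdorffMeasure d) ≠ 0 := by
    intro h
    have h1 := EuclideanSpace.euclideanHausdorffMeasure_eq_volume d
    rw [Measure.euclideanHausdorffMeasure_def, h, zero_smul] at h1
    exact (NeZero.ne (volume : Measure (EuclideanSpace ℝ (Fin d)))) h1.symm
  have hvol : (volume : Measure (Fin d → ℝ)) = Measure.hausdorffMeasure d := by
    rw [← hausdorffMeasure_pi_real, Fintype.card_fin]
  rw [Measure.euclideanHausdorffMeasure_def, Measure.smul_apply, smul_eq_zero, or_iff_right hc, hvol]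
  have hlip := (PiLp.lipschitzWith_toLp 2 (fun _ : Fin (d + m) => ℝ)).comp (lipschitzWith_graphMap A)
  have hanti := (PiLp.antilipschitzWith_toLp 2 (fun _ : Fin (d + m) => ℝ)).comp
    (antilipschitzWith_graphMap A)
  constructor
  · intro h
    have := hanti.le_hausdorffMeasure_image (d := d) (Nat.cast_nonneg d) S
    refine le_antisymm (this.trans (le_of_eq ?_)) zero_le
    rw [show (WithLp.toLp 2 ∘ graphMap A) '' S = _ from rfl]
    erw [h, mul_zero]
  · intro h
    have := hlip.hausdorffMeasure_image_le (d := d) (Nat.cast_nonneg d) S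
    rw [h, mul_zero] at this
    exact le_antisymm this zero_le

/-- Being of Khintchine type, in terms of Lebesgue measure on the space of parameters. -/
theorem isKhintchineType_iff {d m : ℕ} (A : Matrix (Fin (d + 1)) (Fin m) ℝ) :
    IsKhintchineType d (affineSubspaceOf A) ↔ ∀ ψ : ℕ+ → ℝ≥0, Antitone ψ →
      ((Summable fun q => ψ q ^ (d + m)) → volume (approxParam A ψ) = 0) ∧
      ((¬ Summable fun q => ψ q ^ (d + m)) → volume (approxParam A ψ)ᶜ = 0) := by
  have h1 : ∀ ψ : ℕ+ → ℝ≥0, approximable ψ ∩ affineSubspaceOf A =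
      (fun x => WithLp.toLp 2 (graphMap A x)) '' (approxParam A ψ) := by
    intro ψ
    ext y
    constructor
    · rintro ⟨hy, x, rfl⟩; exact ⟨x, hy, rfl⟩
    · rintro ⟨x, hx, rfl⟩; exact ⟨hx, x, rfl⟩
  have h2 : ∀ ψ : ℕ+ → ℝ≥0, affineSubspaceOf A \ approximable ψ =
      (fun x => WithLp.toLp 2 (graphMap A x)) '' (approxParam A ψ)ᶜ := by
    intro ψ
    ext y
    constructor
    · rintro ⟨⟨x, rfl⟩, hy⟩; exact ⟨x, hy, rfl⟩
    · rintro ⟨x, hx, rfl⟩; exact ⟨⟨x, rfl⟩, hx⟩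
  simp only [IsKhintchineType, h1, h2, euclideanHausdorffMeasure_image_eq_zero_iff]

/-- Cauchy condensation for series indexed by the positive integers. -/
theorem summable_pow_iff_condensed {ψ : ℕ+ → ℝ≥0} (hψ : Antitone ψ) (n : ℕ) :
    (Summable fun q => ψ q ^ n) ↔ Summable fun k : ℕ => (2 : ℝ) ^ k * (ψ (2 ^ k) : ℝ) ^ n := by
  have h1 := NNReal.summable_condensed_iff (f := fun q : ℕ => ψ q.toPNat' ^ n) (by
    intro a b ha hab
    refine pow_le_pow_left₀ zero_le (hψ ?_) n
    rw [← PNat.coe_le_coe, PNat.toPNat'_coe ha, PNat.toPNat'_coe (ha.trans_le hab)]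
    exact hab)
  have h2 : (Summable fun q : ℕ => ψ q.toPNat' ^ n) ↔ Summable fun q : ℕ+ => ψ q ^ n := by
    rw [← NNReal.summable_nat_add_iff 1,
      ← summable_pnat_iff_summable_succ (f := fun q : ℕ => ψ q.toPNat' ^ n)]
    simp
  rw [← h2, ← h1, ← NNReal.summable_coe]
  have h3 : ∀ k : ℕ, (2 ^ k).toPNat' = (2 : ℕ+) ^ k := by
    intro k
    apply PNat.coe_injective
    rw [PNat.toPNat'_coe (by positivity), PNat.pow_coe]; rfl
  simp [h3]

/-! ### The convergence case -/

theorem finite_nearPoints {d m : ℕ} (A : Matrix (Fin (d + 1)) (Fin m) ℝ) (x₀ : Fin d → ℝ) (P : ℕ)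
    (s δ : ℝ) : (nearPoints A x₀ P s δ).Finite := by
  refine (Set.Finite.pi' (t := fun i : Fin (d + 1) => Set.Icc
    (Fin.cons (α := fun _ => ℤ) 0 (fun i => ⌊-(s * P + P * |x₀ i|)⌋) i)
    (Fin.cons (α := fun _ => ℤ) P (fun i => ⌈s * P + P * |x₀ i|⌉) i)) fun i =>
      Set.finite_Icc _ _).subset ?_
  rintro v ⟨h0, hP, ha, -⟩ i
  refine Fin.cases ?_ (fun i => ?_) i
  · exact ⟨h0, hP.le⟩
  · simp only [Fin.cons_succ, Set.mem_Icc]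
    have h1 : |(v 0 : ℝ) * x₀ i| ≤ P * |x₀ i| := by
      rw [abs_mul, abs_of_nonneg (by exact_mod_cast h0)]
      exact mul_le_mul_of_nonneg_right (by exact_mod_cast hP.le) (abs_nonneg _)
    have h2 := ha i
    have h3 : |(v i.succ : ℝ)| ≤ s * P + P * |x₀ i| := by
      have := abs_add_le ((v i.succ : ℝ) - v 0 * x₀ i) (v 0 * x₀ i)
      rw [sub_add_cancel] at this
      linarith
    obtain ⟨h4, h5⟩ := abs_le.1 h3
    constructor
    · have := (Int.floor_le (-(s * P + P * |x₀ i|))).trans h4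
      exact_mod_cast this
    · have := h5.trans (Int.le_ceil (s * P + P * |x₀ i|))
      exact_mod_cast this

/-- The rational point `a / q` attached to the integer vector `(q, a)`. -/
noncomputable def ratPoint {d : ℕ} (v : Fin (d + 1) → ℤ) : Fin d → ℝ := fun i => v i.succ / v 0

theorem volume_biUnion_closedBall_le {d : ℕ} {ι : Type*} (V : Finset ι) (z : ι → Fin d → ℝ) {r : ℝ}
    (hr : 0 ≤ r) :
    volume (⋃ v ∈ V, Metric.closedBall (z v) r) ≤ ENNReal.ofReal (V.card * (2 * r) ^ d) := by
  refine (measure_biUnion_finset_le _ _).trans (le_of_eq ?_)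
  simp only [Real.volume_pi_closedBall _ hr, Fintype.card_fin, Finset.sum_const, nsmul_eq_mul]
  rw [ENNReal.ofReal_mul (Nat.cast_nonneg _), ENNReal.ofReal_natCast]

/-- A rational point of denominator `q` near the point of `L_A` with parameter `x` comes from an
integer vector `v = (q, a)` with `a / q` near `x` and `‖v A‖` small. -/
theorem exists_int_vector_of_distInt_lt {d m : ℕ} {A : Matrix (Fin (d + 1)) (Fin m) ℝ} {x : Fin d → ℝ}
    {q : ℕ} {t : ℝ} (h : distInt (fun i => (q : ℝ) * graphMap A x i) < t) :
    ∃ v : Fin (d + 1) → ℤ, v 0 = q ∧ (∀ i : Fin d, |(v i.succ : ℝ) - q * x i| ≤ t) ∧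
      distInt (Matrix.vecMul (fun i => (v i : ℝ)) A) ≤ (entrySum A + 1) * t := by
  have ht : 0 < t := (distInt_nonneg _).trans_lt h
  have hL := one_le_entrySum A
  obtain ⟨k, hk⟩ := exists_int_of_distInt_lt h
  have h1 : ∀ i : Fin d, |(k (Fin.castAdd m i) : ℝ) - q * x i| ≤ t := by
    intro i
    have := (hk (Fin.castAdd m i)).le
    rw [graphMap, Fin.append_left, abs_sub_comm] at this
    exact this
  refine ⟨Fin.cons q fun i => k (Fin.castAdd m i), rfl, by simpa using h1, ?_⟩
  refine distInt_le_of_forall (by nlinarith) (fun j => k (Fin.natAdd d j)) fun j => ?_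
  have h2 := (hk (Fin.natAdd d j)).le
  rw [graphMap, Fin.append_right] at h2
  have h3 := abs_vecMul_sub_le A
    (u := fun i => ((Fin.cons (q : ℤ) fun i => k (Fin.castAdd m i) : Fin (d + 1) → ℤ) i : ℝ))
    (x := x) ht.le (by simpa using h1) j
  simp only [Fin.cons_zero, Int.cast_natCast] at h3
  refine (abs_sub_le _ ((q : ℝ) * Matrix.vecMul (Matrix.vecCons 1 x) A j) _).trans ?_
  linarith

/-- The convergence case of Khintchine's theorem on `L_A`, for `ψ` not below `q ^ (-κ)`:
the Borel–Cantelli lemma over dyadic blocks of denominators. -/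
theorem volume_approxParam_eq_zero_of_le {d m : ℕ} (hm : 1 ≤ m)
    (A : Matrix (Fin (d + 1)) (Fin m) ℝ) {c w κ : ℝ}
    (hc : 0 < c) (hw : 0 < w) (hκ : 0 < κ) (hκw : κ * w < 1)
    (hA : ∀ q : Fin m → ℤ, q ≠ 0 →
      c * ‖fun j => (q j : ℝ)‖ ^ (-w) ≤ distInt (A.mulVec fun j => (q j : ℝ)))
    {ψ : ℕ+ → ℝ≥0} (hψ : Antitone ψ) (hlow : ∀ q : ℕ+, ((q : ℕ) : ℝ) ^ (-κ) ≤ ψ q)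
    (hsum : Summable fun q => ψ q ^ (d + m)) : volume (approxParam A ψ) = 0 := by
  classical
  have hL := one_le_entrySum A
  set L := entrySum A
  rw [summable_pow_iff_condensed hψ] at hsum
  -- it suffices to treat a cube of side one about each integer point
  suffices hloc : ∀ x₀ : Fin d → ℤ,
      volume (approxParam A ψ ∩ Metric.closedBall (fun i => (x₀ i : ℝ)) (1 / 2)) = 0 by
    refine measure_mono_null ?_ (measure_iUnion_null hloc)
    intro x hx
    refine Set.mem_iUnion.2 ⟨fun i => round (x i), hx, ?_⟩
    rw [Metric.mem_closedBall, dist_pi_le_iff (by norm_num)]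
    intro i
    rw [Real.dist_eq]
    exact abs_sub_round (x i)
  intro x₀
  obtain ⟨M, hM⟩ : ∃ M : ℕ, ∀ i, |(x₀ i : ℝ)| ≤ M := by
    obtain ⟨M, hM⟩ := exists_nat_ge ‖fun i => (x₀ i : ℝ)‖
    exact ⟨M, fun i => (norm_le_pi_norm (fun i => (x₀ i : ℝ)) i).trans hM⟩
  obtain ⟨K, hK, hcount⟩ := exists_card_region_le hm A hc hw hκ hκw hA M
  set ψ' : ℕ → ℝ := fun k => ψ (2 ^ k)
  have hψ'0 : ∀ k, 0 ≤ ψ' k := fun k => NNReal.coe_nonneg _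
  set V : ℕ → Finset (Fin (d + 1) → ℤ) := fun k =>
    ((finite_nearPoints A (fun i => (x₀ i : ℝ)) (2 ^ (k + 1)) 1 ((L + 1) * ψ' k)).toFinset)
  set F : ℕ → Set (Fin d → ℝ) := fun k => ⋃ v ∈ V k, Metric.closedBall (ratPoint v) (ψ' k / 2 ^ k)
  set K' := K * 2 ^ (d + 1) * (L + 1) ^ m * 2 ^ d
  have hF : ∀ k, volume (F k) ≤ ENNReal.ofReal (K' * (2 ^ k * ψ' k ^ (d + m))) := by
    intro k
    refine (volume_biUnion_closedBall_le (V k) ratPoint (by positivity)).trans ?_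
    refine ENNReal.ofReal_le_ofReal ?_
    have h1 := hcount _ hM (2 ^ (k + 1)) 1 ((L + 1) * ψ' k) one_pos le_rfl (by
      rw [one_mul]; exact_mod_cast Nat.one_le_two_pow) (V k) (by simp [V])
    have h2 : max ((L + 1) * ψ' k) ((1 * ((2 ^ (k + 1) : ℕ) : ℝ)) ^ (-κ)) ≤ (L + 1) * ψ' k := by
      refine max_le le_rfl ?_
      have h3 : ((2 : ℝ) ^ k) ^ (-κ) ≤ ψ' k := by simpa using hlow (2 ^ k)
      have h4 : (1 * ((2 ^ (k + 1) : ℕ) : ℝ)) ^ (-κ) ≤ ((2 : ℝ) ^ k) ^ (-κ) := by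
        refine Real.rpow_le_rpow_of_nonpos (by positivity) ?_ (by linarith)
        push_cast
        rw [one_mul]
        exact pow_le_pow_right₀ (by norm_num) (Nat.le_succ k)
      nlinarith [hψ'0 k]
    have h5 : max ((L + 1) * ψ' k) ((1 * ((2 ^ (k + 1) : ℕ) : ℝ)) ^ (-κ)) ^ m ≤
        ((L + 1) * ψ' k) ^ m :=
      pow_le_pow_left₀ (le_max_of_le_right (by positivity)) h2 m
    calc ((V k).card : ℝ) * (2 * (ψ' k / 2 ^ k)) ^ d
        ≤ (K * ((2 ^ (k + 1) : ℕ) : ℝ) ^ (d + 1) * 1 ^ d * ((L + 1) * ψ' k) ^ m) *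
            (2 * (ψ' k / 2 ^ k)) ^ d := by
          refine mul_le_mul_of_nonneg_right (h1.trans ?_) (by positivity)
          exact mul_le_mul_of_nonneg_left h5 (by positivity)
      _ = K' * (2 ^ k * ψ' k ^ (d + m)) := by
          simp only [K']
          push_cast
          rw [mul_pow, mul_pow, div_pow, pow_succ (2 : ℝ) k, mul_pow, pow_succ ((2 : ℝ) ^ k) d,
            pow_add (ψ' k), one_pow]
          field_simp
  have hBC : volume {x | ∃ᶠ k in atTop, x ∈ F k} = 0 := by
    refine measure_setOfPred_frequently_eq_zero ?_
    refine ne_top_of_le_ne_top ?_ (ENNReal.tsum_le_tsum hF)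
    rw [← ENNReal.ofReal_tsum_of_nonneg (fun k => by positivity) (hsum.mul_left K')]
    exact ENNReal.ofReal_ne_top
  refine measure_mono_null ?_ hBC
  rintro x ⟨hx, hxb⟩
  obtain ⟨k₁, hk₁⟩ := pow_unbounded_of_one_lt (ψ 1 : ℝ) (one_lt_two)
  refine frequently_atTop.2 fun N => ?_
  obtain ⟨q, hq, hqN⟩ := Set.Infinite.exists_gt hx (2 ^ max N k₁)
  have hqN' : 2 ^ max N k₁ < (q : ℕ) := by
    have := PNat.coe_lt_coe _ _ |>.2 hqN
    simpa using this
  set k := Nat.log 2 q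
  have hk1 : 2 ^ k ≤ (q : ℕ) := Nat.pow_log_le_self 2 q.ne_zero
  have hk2 : (q : ℕ) < 2 ^ (k + 1) := Nat.lt_pow_succ_log_self (by norm_num) _
  have hkN : max N k₁ ≤ k := by
    refine Nat.le_log_of_pow_le (by norm_num) hqN'.le
  have hψq : (ψ q : ℝ) ≤ ψ' k := by
    refine NNReal.coe_le_coe.2 (hψ ?_)
    rw [← PNat.coe_le_coe]; simpa using hk1
  have hψk : ψ' k ≤ 2 ^ k := by
    have h1 : ψ' k ≤ ψ 1 := NNReal.coe_le_coe.2 (hψ (one_le))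
    have h2 : (2 : ℝ) ^ k₁ ≤ 2 ^ k :=
      pow_le_pow_right₀ (by norm_num) ((le_max_right _ _).trans hkN)
    linarith
  refine ⟨k, (le_max_left _ _).trans hkN, ?_⟩
  obtain ⟨v, hv0, hva, hvA⟩ := exists_int_vector_of_distInt_lt (lt_of_lt_of_le hq hψq)
  have hq2 : (q : ℝ) < 2 ^ (k + 1) := by exact_mod_cast hk2
  have hq0 : (0 : ℝ) < q := by exact_mod_cast q.pos
  refine Set.mem_iUnion₂.2 ⟨v, ?_, ?_⟩
  · refine (Set.Finite.mem_toFinset _).2 ⟨by rw [hv0]; positivity, by rw [hv0]; exact_mod_cast hk2,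
      fun i => ?_, hvA⟩
    have h1 : |x i - x₀ i| ≤ 1 / 2 := by
      have := (dist_pi_le_iff (by norm_num)).1 (Metric.mem_closedBall.1 hxb) i
      simpa [Real.dist_eq] using this
    have h2 : (v i.succ : ℝ) - v 0 * x₀ i = (v i.succ - (q : ℕ) * x i) + (q : ℕ) * (x i - x₀ i) := by
      rw [hv0]; push_cast; ring
    rw [h2]
    refine (abs_add_le _ _).trans ?_
    rw [abs_mul, abs_of_pos hq0]
    have h3 := hva i
    have h4 := mul_le_mul_of_nonneg_left h1 hq0.le
    push_cast
    rw [pow_succ] at hq2 ⊢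
    linarith
  · rw [Metric.mem_closedBall, dist_pi_le_iff (by positivity)]
    intro i
    have h3 := hva i
    have hvq : (v 0 : ℝ) = (q : ℕ) := by rw [hv0]; simp
    rw [ratPoint, Real.dist_eq, hvq, abs_sub_comm, div_sub' hq0.ne', abs_div, abs_of_pos hq0,
      div_le_div_iff₀ hq0 (by positivity)]
    have h4 : (2 : ℝ) ^ k ≤ q := by exact_mod_cast hk1
    exact mul_le_mul h3 h4 (by positivity) (hψ'0 k)

theorem approxParam_max {d m : ℕ} (A : Matrix (Fin (d + 1)) (Fin m) ℝ) (ψ φ : ℕ+ → ℝ≥0) :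
    approxParam A (fun q => max (ψ q) (φ q)) = approxParam A ψ ∪ approxParam A φ := by
  ext x
  simp only [approxParam, Set.mem_union, Set.mem_ofPred_eq, ← Set.infinite_union]
  apply iff_of_eq
  congr 1
  ext q
  simp

/-- The approximation function `q ↦ q ^ (-κ)`. -/
noncomputable def powFun (κ : ℝ) : ℕ+ → ℝ≥0 := fun q => ((q : ℕ) : ℝ≥0) ^ (-κ)

theorem coe_powFun (κ : ℝ) (q : ℕ+) : (powFun κ q : ℝ) = ((q : ℕ) : ℝ) ^ (-κ) := by
  simp [powFun]

theorem antitone_powFun {κ : ℝ} (hκ : 0 < κ) : Antitone (powFun κ) := by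
  intro a b hab
  rw [← NNReal.coe_le_coe, coe_powFun, coe_powFun]
  refine Real.rpow_le_rpow_of_nonpos (by exact_mod_cast a.pos) ?_ (by linarith)
  exact_mod_cast PNat.coe_le_coe _ _ |>.2 hab

theorem summable_powFun {κ : ℝ} {n : ℕ} (hκ : 1 < κ * n) : Summable fun q => powFun κ q ^ n := by
  rw [← NNReal.summable_coe]
  have h : ∀ q : ℕ+, ((powFun κ q ^ n : ℝ≥0) : ℝ) = (fun k : ℕ => (k : ℝ) ^ (-(κ * n))) q := by
    intro q
    rw [NNReal.coe_pow, coe_powFun, ← Real.rpow_natCast, ← Real.rpow_mul (Nat.cast_nonneg _), neg_mul]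
  simp_rw [h]
  exact (Real.summable_nat_rpow.2 (by linarith)).comp_injective PNat.coe_injective

/-- The convergence case of Khintchine's theorem on `L_A`. -/
theorem volume_approxParam_eq_zero {d m : ℕ} (hm : 1 ≤ m)
    (A : Matrix (Fin (d + 1)) (Fin m) ℝ) {c w κ : ℝ}
    (hc : 0 < c) (hw : 0 < w) (hκ : 0 < κ) (hκw : κ * w < 1) (hκn : 1 < κ * (d + m : ℕ))
    (hA : ∀ q : Fin m → ℤ, q ≠ 0 →
      c * ‖fun j => (q j : ℝ)‖ ^ (-w) ≤ distInt (A.mulVec fun j => (q j : ℝ)))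
    {ψ : ℕ+ → ℝ≥0} (hψ : Antitone ψ)
    (hsum : Summable fun q => ψ q ^ (d + m)) : volume (approxParam A ψ) = 0 := by
  have h := volume_approxParam_eq_zero_of_le hm A hc hw hκ hκw hA
    (ψ := fun q => max (ψ q) (powFun κ q))
    (fun a b hab => max_le_max (hψ hab) (antitone_powFun hκ hab))
    (fun q => by rw [← coe_powFun]; exact NNReal.coe_le_coe.2 (le_max_right _ _)) (by
      refine NNReal.summable_of_le (fun q => ?_) (hsum.add (summable_powFun hκn))
      rcases max_cases (ψ q) (powFun κ q) with h | h
      · rw [h.1]; exact le_self_add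
      · rw [h.1]; exact le_add_self)
  rw [approxParam_max] at h
  exact measure_mono_null Set.subset_union_left h

/-- For `d = 0` the condition `ω(A) < n` is void (Dirichlet): the zero vector alone exceeds the
bound for the number of integer points near the point `L_A`. -/
theorem dim_pos {d m : ℕ} (hm : 1 ≤ m)
    (A : Matrix (Fin (d + 1)) (Fin m) ℝ) {c w κ : ℝ}
    (hc : 0 < c) (hw : 0 < w) (hκ : 0 < κ) (hκw : κ * w < 1) (hκn : 1 < κ * (d + m : ℕ))
    (hA : ∀ q : Fin m → ℤ, q ≠ 0 →
      c * ‖fun j => (q j : ℝ)‖ ^ (-w) ≤ distInt (A.mulVec fun j => (q j : ℝ))) : 1 ≤ d := by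
  by_contra hd
  obtain rfl : d = 0 := by omega
  rw [zero_add] at hκn
  obtain ⟨K, hK, hcube⟩ := exists_card_cube_le hm A hc hw hκ hκw hA
  have hlim : Tendsto (fun R : ℕ => K * (R : ℝ) ^ (-(κ * m - 1))) atTop (𝓝 (K * 0)) :=
    ((tendsto_rpow_neg_atTop (by linarith)).comp tendsto_natCast_atTop_atTop).const_mul K
  rw [mul_zero] at hlim
  obtain ⟨R, hR, hR0⟩ := ((hlim.eventually (gt_mem_nhds one_pos)).and (eventually_gt_atTop 0)).exists
  have hR' : (0 : ℝ) < R := by exact_mod_cast hR0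
  have h := hcube R hR0 _ le_rfl 0 {0} (by simpa using hR0) (by
    intro v hv
    rw [Finset.mem_singleton.1 hv]
    refine distInt_le_of_forall (Real.rpow_nonneg hR'.le _) 0 fun j => ?_
    simp [Matrix.vecMul, dotProduct]
    exact Real.rpow_nonneg hR'.le _)
  rw [Finset.card_singleton, ← Real.rpow_natCast (_ ^ (-κ)), ← Real.rpow_mul hR'.le, mul_assoc,
    zero_add, pow_one, ← Real.rpow_one_add' hR'.le (by linarith)] at h
  rw [show -(κ * m - 1) = 1 + -κ * (m : ℝ) by ring] at hR
  push_cast at h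
  linarith

/-! ### Transference: the case of large exponent -/

/-- A pigeonhole form of Khintchine's transference principle: one good approximation of the linear
form with coefficients `y` yields a good simultaneous approximation of `y`. Points `t y` are
sorted by the boxes of side `1 / S` containing the coordinates other than `i₀`, and by the residue
modulo `u i₀` that decides whether the remaining coordinate can be rounded. -/
theorem exists_distInt_le_of_linearForm {n : ℕ} (y : Fin n → ℝ) (i₀ : Fin n) (u : Fin n → ℤ)
    (p₀ : ℤ) {B E : ℝ} (hB : 1 ≤ B) (hE : 0 ≤ E) {H : ℕ} (hH : 0 < H) (hu₀ : (u i₀).natAbs = H)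
    (hu : ∀ i, |(u i : ℝ)| ≤ B * H) (hE' : |∑ i, (u i : ℝ) * y i - p₀| ≤ E) {S : ℕ} (hS : 0 < S) :
    ∃ t : ℕ, 0 < t ∧ t ≤ S ^ (n - 1) * H ∧
      distInt (fun i => (t : ℝ) * y i) ≤ (S : ℝ) ^ (n - 1) * E + n * B / S := by
  classical
  have : NeZero H := ⟨hH.ne'⟩
  have hS' : (0 : ℝ) < S := by exact_mod_cast hS
  have hH' : (0 : ℝ) < H := by exact_mod_cast hH
  have hn : (1 : ℝ) ≤ n := by exact_mod_cast i₀.pos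
  set N : ℕ := S ^ (n - 1) * H
  have hlt : ∀ a : ℝ, ⌊(S : ℝ) * Int.fract a⌋₊ < S := fun a => by
    rw [Nat.floor_lt (mul_nonneg hS'.le (Int.fract_nonneg _))]
    nlinarith [Int.fract_lt_one a]
  set f : Fin (N + 1) → ({i : Fin n // i ≠ i₀} → Fin S) × ZMod H := fun t =>
    (fun i => ⟨⌊(S : ℝ) * Int.fract ((t : ℕ) * y i)⌋₊, hlt _⟩,
      (((t : ℕ) * p₀ - ∑ i ∈ Finset.univ.erase i₀, u i * ⌊((t : ℕ) : ℝ) * y i⌋ : ℤ) : ZMod H))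
  obtain ⟨a, b, hab, hf⟩ := Fintype.exists_ne_map_eq_of_card_lt f (by
    simp [Fintype.card_subtype_compl, ZMod.card, N])
  wlog hlt' : a < b generalizing a b
  · exact this b a hab.symm hf.symm (lt_of_le_of_ne (not_lt.1 hlt') hab.symm)
  obtain ⟨hf1, hf2⟩ := Prod.mk.inj hf
  have hab' : (a : ℕ) < b := hlt'
  set t : ℕ := (b : ℕ) - a
  have ht : (t : ℝ) = (b : ℕ) - (a : ℕ) := by simp [t, Nat.cast_sub hab'.le]
  have htz : (t : ℤ) = (b : ℕ) - (a : ℕ) := by simp [t, Nat.cast_sub hab'.le]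
  have htN : t ≤ N := (Nat.sub_le _ _).trans (Nat.lt_succ_iff.1 b.2)
  set p : Fin n → ℤ := fun i => ⌊((b : ℕ) : ℝ) * y i⌋ - ⌊((a : ℕ) : ℝ) * y i⌋
  have hp : ∀ i, i ≠ i₀ → |(t : ℝ) * y i - p i| ≤ 1 / S := by
    intro i hi
    have h1 := congrArg Fin.val (congrFun hf1 ⟨i, hi⟩)
    simp only at h1
    have e1 : (t : ℝ) * y i - p i = Int.fract ((b : ℕ) * y i) - Int.fract ((a : ℕ) * y i) := by
      simp only [p, Int.fract, ht]; push_cast; ring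
    rw [e1, le_div_iff₀ hS']
    nth_rewrite 1 [← abs_of_pos hS']
    rw [← abs_mul]
    have a1 := Nat.floor_le (mul_nonneg hS'.le (Int.fract_nonneg (((a : ℕ) : ℝ) * y i)))
    have a2 := Nat.lt_floor_add_one ((S : ℝ) * Int.fract (((a : ℕ) : ℝ) * y i))
    have b1 := Nat.floor_le (mul_nonneg hS'.le (Int.fract_nonneg (((b : ℕ) : ℝ) * y i)))
    have b2 := Nat.lt_floor_add_one ((S : ℝ) * Int.fract (((b : ℕ) : ℝ) * y i))
    rw [h1] at a1 a2
    rw [abs_le]; constructor <;> linarith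
  obtain ⟨z, hz⟩ : (u i₀) ∣ t * p₀ - ∑ i ∈ Finset.univ.erase i₀, u i * p i := by
    rw [← Int.natAbs_dvd, hu₀]
    have h1 := (ZMod.intCast_eq_intCast_iff_dvd_sub _ _ _).1 hf2
    convert h1 using 1
    simp only [p, mul_sub, Finset.sum_sub_distrib, htz]
    ring
  have hz' : (t : ℝ) * p₀ - ∑ i ∈ Finset.univ.erase i₀, (u i : ℝ) * p i = u i₀ * z := by
    exact_mod_cast hz
  have hu₀' : |(u i₀ : ℝ)| = H := by
    rw [← hu₀, ← Int.cast_abs, Int.abs_eq_natAbs]; simp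
  have hrest : |(t : ℝ) * y i₀ - z| ≤ (S : ℝ) ^ (n - 1) * E + n * B / S := by
    have e1 : (u i₀ : ℝ) * (t * y i₀ - z) = t * (∑ i, (u i : ℝ) * y i - p₀) -
        ∑ i ∈ Finset.univ.erase i₀, (u i : ℝ) * (t * y i - p i) := by
      rw [mul_sub, ← hz', ← Finset.add_sum_erase _ _ (Finset.mem_univ i₀)]
      simp only [mul_sub, Finset.sum_sub_distrib, mul_add, Finset.mul_sum]
      have : ∑ i ∈ Finset.univ.erase i₀, (u i : ℝ) * (t * y i) =
          ∑ i ∈ Finset.univ.erase i₀, (t : ℝ) * (u i * y i) :=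
        Finset.sum_congr rfl fun i _ => by ring
      rw [this]; ring
    have h1 : |∑ i ∈ Finset.univ.erase i₀, (u i : ℝ) * (t * y i - p i)| ≤ n * (B * H * (1 / S)) := by
      refine (Finset.abs_sum_le_sum_abs _ _).trans ?_
      refine (Finset.sum_le_card_nsmul _ _ (B * H * (1 / S)) fun i hi => ?_).trans ?_
      · rw [abs_mul]
        exact mul_le_mul (hu i) (hp i (Finset.ne_of_mem_erase hi)) (abs_nonneg _) (by positivity)
      · rw [nsmul_eq_mul]
        refine mul_le_mul_of_nonneg_right ?_ (by positivity)
        have := (Finset.card_erase_le (s := (Finset.univ : Finset (Fin n))) (a := i₀))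
        rw [Finset.card_univ, Fintype.card_fin] at this
        exact_mod_cast this
    have h2 : |(t : ℝ) * (∑ i, (u i : ℝ) * y i - p₀)| ≤ (S : ℝ) ^ (n - 1) * H * E := by
      rw [abs_mul, Nat.abs_cast]
      refine mul_le_mul ?_ hE' (abs_nonneg _) (by positivity)
      exact_mod_cast htN
    have h3 := (abs_sub _ _).trans (add_le_add h2 h1)
    rw [← e1, abs_mul, hu₀'] at h3
    refine le_of_mul_le_mul_left (h3.trans (le_of_eq ?_)) hH'
    field_simp
  refine ⟨t, Nat.sub_pos_of_lt hab', htN, ?_⟩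
  refine distInt_le_of_forall (by positivity) (fun i => if i = i₀ then z else p i) fun i => ?_
  by_cases hi : i = i₀
  · subst hi; simpa using hrest
  · simp only [hi, if_false]
    refine (hp i hi).trans ?_
    have h1 : 1 / (S : ℝ) ≤ n * B / S := by
      gcongr; nlinarith
    have h2 : 0 ≤ (S : ℝ) ^ (n - 1) * E := by positivity
    linarith

/-- Khintchine's transference principle: a point `y` that is approximable to order `w > n` in the
sense of linear forms is simultaneously approximable to some order `κ > 1 / n`. -/
theorem infinite_of_linearForms {n : ℕ} (y : Fin n → ℝ) {B C w κ : ℝ} (hB : 1 ≤ B) (hC : 0 < C)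
    (hw : n < w) (hκ : 0 < κ) (hκw : κ * (n - 1 + n / w) < 1)
    (h : ∀ X : ℕ, ∃ (i₀ : Fin n) (u : Fin n → ℤ) (p₀ : ℤ), X ≤ (u i₀).natAbs ∧
      (∀ i, |(u i : ℝ)| ≤ B * (u i₀).natAbs) ∧
      |∑ i, (u i : ℝ) * y i - p₀| ≤ C * ((u i₀).natAbs : ℝ) ^ (-w)) :
    {q : ℕ+ | distInt (fun i => ((q : ℕ) : ℝ) * y i) < (powFun κ q : ℝ)}.Infinite := by
  have hnpos : 0 < n := by
    obtain ⟨i₀, -⟩ := h 0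
    exact i₀.pos
  have hn1 : (1 : ℝ) ≤ n := by exact_mod_cast hnpos
  have hw0 : 0 < w := by linarith
  set β := 1 - κ * (n - 1 + n / w)
  have hβ : 0 < β := by simp only [β]; linarith
  set C' := C + n * B
  have hC' : 0 < C' := by positivity
  -- take `S = ⌊H ^ (w / n)⌋`, which balances the two terms `S ^ (n - 1) H ^ (-w)` and `1 / S`
  have claim : ∀ ε : ℝ, 0 < ε → ∃ t : ℕ, 0 < t ∧ distInt (fun i => (t : ℝ) * y i) < ε ∧
      distInt (fun i => (t : ℝ) * y i) < (t : ℝ) ^ (-κ) := by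
    intro ε hε
    have hlim1 : ∀ᶠ S : ℝ in atTop, C' * 2 ^ κ < S ^ β :=
      (tendsto_rpow_atTop hβ).eventually_gt_atTop _
    have hlim2 : ∀ᶠ S : ℝ in atTop, C' / ε < S := eventually_gt_atTop _
    obtain ⟨S₀, hS₀⟩ := eventually_atTop.1 (hlim1.and hlim2)
    obtain ⟨X, hX⟩ := exists_nat_ge (max 1 (2 * S₀))
    obtain ⟨i₀, u, p₀, hHX, hu, hE⟩ := h X
    set H := (u i₀).natAbs with hHdef
    have hHX' : (X : ℝ) ≤ H := by exact_mod_cast hHX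
    have hH1 : (1 : ℝ) ≤ H := (le_max_left _ _).trans (hX.trans hHX')
    have hH2 : 2 * S₀ ≤ H := (le_max_right _ _).trans (hX.trans hHX')
    have hH0 : (0 : ℝ) < H := by linarith
    have hwn : 1 ≤ w / n := by rw [le_div_iff₀ (by linarith)]; linarith
    have hpow : (H : ℝ) ≤ (H : ℝ) ^ (w / n) := by
      simpa using Real.rpow_le_rpow_of_exponent_le hH1 hwn
    set S := ⌊(H : ℝ) ^ (w / n)⌋₊
    have hS1 : (S : ℝ) ≤ (H : ℝ) ^ (w / n) := Nat.floor_le (by positivity)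
    have hS2 : (H : ℝ) ^ (w / n) < S + 1 := Nat.lt_floor_add_one _
    have hSpos : 0 < S := Nat.floor_pos.2 (hH1.trans hpow)
    have hSr : (1 : ℝ) ≤ S := by exact_mod_cast hSpos
    have hS3 : (H : ℝ) ^ (w / n) ≤ 2 * S := by linarith
    obtain ⟨hA1, hA2⟩ := hS₀ S (by linarith)
    obtain ⟨t, ht0, htN, htd⟩ := exists_distInt_le_of_linearForm y i₀ u p₀ hB (by positivity)
      (by exact_mod_cast hH0) hHdef.symm hu hE hSpos
    have ht0' : (0 : ℝ) < t := by exact_mod_cast ht0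
    have htd' : distInt (fun i => (t : ℝ) * y i) ≤ C' / S := by
      refine htd.trans ?_
      have h1 : (S : ℝ) ^ n ≤ (H : ℝ) ^ w := by
        have := pow_le_pow_left₀ (by positivity) hS1 n
        rwa [← Real.rpow_natCast (_ ^ (w / n)), ← Real.rpow_mul hH0.le,
          div_mul_cancel₀ _ (by linarith)] at this
      have h2 : (S : ℝ) ^ (n - 1) * (H : ℝ) ^ (-w) ≤ 1 / S := by
        rw [le_div_iff₀ (by linarith), Real.rpow_neg hH0.le, mul_right_comm, ← pow_succ,
          Nat.sub_add_cancel hnpos, ← div_eq_mul_inv, div_le_one (by positivity)]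
        exact h1
      calc (S : ℝ) ^ (n - 1) * (C * (H : ℝ) ^ (-w)) + n * B / S
          = C * ((S : ℝ) ^ (n - 1) * (H : ℝ) ^ (-w)) + n * B / S := by ring
        _ ≤ C * (1 / S) + n * B / S := by gcongr
        _ = C' / S := by simp only [C']; ring
    refine ⟨t, ht0, htd'.trans_lt ?_, htd'.trans_lt ?_⟩
    · rw [div_lt_iff₀ (by linarith)]
      rw [div_lt_iff₀ hε] at hA2
      linarith
    · have hHS : (H : ℝ) ≤ 2 * (S : ℝ) ^ ((n : ℝ) / w) := by
        have h1 := Real.rpow_le_rpow (by positivity) hS3 (z := (n : ℝ) / w) (by positivity)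
        rw [← Real.rpow_mul hH0.le, div_mul_div_cancel₀ (by linarith), div_self hw0.ne',
          Real.rpow_one, Real.mul_rpow (by norm_num) (by positivity)] at h1
        refine h1.trans (mul_le_mul_of_nonneg_right ?_ (by positivity))
        have : (2 : ℝ) ^ ((n : ℝ) / w) ≤ 2 ^ (1 : ℝ) :=
          Real.rpow_le_rpow_of_exponent_le (by norm_num) (by rw [div_le_one hw0]; linarith)
        simpa using this
      have htS : (t : ℝ) ≤ 2 * (S : ℝ) ^ ((n : ℝ) - 1 + n / w) := by
        have h1 : (t : ℝ) ≤ (S : ℝ) ^ (n - 1) * H := by exact_mod_cast htN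
        refine h1.trans ?_
        rw [Real.rpow_add (by linarith), ← Nat.cast_pred hnpos, Real.rpow_natCast]
        calc (S : ℝ) ^ (n - 1) * H ≤ (S : ℝ) ^ (n - 1) * (2 * (S : ℝ) ^ ((n : ℝ) / w)) := by gcongr
          _ = _ := by ring
      have h2 : (2 * (S : ℝ) ^ ((n : ℝ) - 1 + n / w)) ^ (-κ) ≤ (t : ℝ) ^ (-κ) :=
        Real.rpow_le_rpow_of_nonpos ht0' htS (by linarith)
      refine lt_of_lt_of_le ?_ h2
      rw [Real.mul_rpow (by norm_num) (by positivity), ← Real.rpow_mul (by positivity),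
        Real.rpow_neg (by norm_num), div_lt_iff₀ (by linarith)]
      have h3 : (S : ℝ) ^ (((n : ℝ) - 1 + n / w) * -κ) * S = (S : ℝ) ^ β := by
        nth_rewrite 2 [← Real.rpow_one (S : ℝ)]
        rw [← Real.rpow_add (by linarith)]
        congr 1; simp only [β]; ring
      rw [mul_assoc, h3, ← div_eq_inv_mul, lt_div_iff₀ (by positivity)]
      exact hA1
  intro hfin
  -- if `‖t y‖ = 0` for some `t`, the multiples of `t` serve; otherwise `claim` produces new `t`
  by_cases hz : ∃ t : ℕ, 0 < t ∧ distInt (fun i => (t : ℝ) * y i) = 0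
  · obtain ⟨t, ht0, ht⟩ := hz
    lift t to ℕ+ using ht0
    refine Set.infinite_of_injective_forall_mem (f := fun k : ℕ+ => k * t)
      (fun a b hab => mul_right_cancel hab) (fun k => ?_) hfin
    have h0 := distInt_nat_mul_eq_zero ht k
    simp only [← mul_assoc] at h0
    rw [Set.mem_ofPred_eq, coe_powFun, PNat.mul_coe, Nat.cast_mul, h0]
    have h1 : (0 : ℝ) < (t : ℕ) := by exact_mod_cast t.pos
    have h2 : (0 : ℝ) < (k : ℕ) := by exact_mod_cast k.pos
    positivity
  · push Not at hz
    obtain ⟨ε, hε, hmin⟩ := exists_pos_le_of_finset hfin.toFinset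
      (fun q : ℕ+ => distInt (fun i => ((q : ℕ) : ℝ) * y i))
      (fun q _ => (distInt_nonneg _).lt_of_ne' (hz q q.pos))
    obtain ⟨t, ht0, ht1, ht2⟩ := claim ε hε
    lift t to ℕ+ using ht0
    refine absurd ht1 (not_lt.2 (hmin t ?_))
    rw [Set.Finite.mem_toFinset]
    simpa [coe_powFun] using ht2

/-- If `ω(A) > n` then all points of `L_A` are very well approximable, uniformly in the exponent. -/
theorem exists_approxParam_eq_univ {d m : ℕ} (hm : 1 ≤ m) (A : Matrix (Fin (d + 1)) (Fin m) ℝ)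
    (hA : ((d + m : ℕ) : EReal) < diophantineExponent A) :
    ∃ κ : ℝ, 0 < κ ∧ 1 < κ * (d + m : ℕ) ∧ approxParam A (powFun κ) = Set.univ := by
  obtain ⟨_, ⟨w, hinf, rfl⟩, hw⟩ := lt_sSup_iff.1 hA
  have hw : ((d + m : ℕ) : ℝ) < w := EReal.coe_lt_coe_iff.1 hw
  set n := d + m
  have hn : (1 : ℝ) ≤ n := by
    have : 1 ≤ n := by omega
    exact_mod_cast this
  have hw0 : 0 < w := by linarith
  have hnw : (n : ℝ) / w < 1 := by rw [div_lt_one hw0]; exact hw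
  have hnw0 : 0 < (n : ℝ) / w := by positivity
  obtain ⟨κ, hκ1, hκ2⟩ := exists_between (show 1 / (n : ℝ) < 1 / (n - 1 + n / w) from
    one_div_lt_one_div_of_lt (by linarith) (by linarith))
  have hκ0 : 0 < κ := lt_trans (by positivity) hκ1
  refine ⟨κ, hκ0, by rwa [div_lt_iff₀ (by linarith)] at hκ1, Set.eq_univ_of_forall fun x => ?_⟩
  have hL := one_le_entrySum A.transpose
  refine infinite_of_linearForms (graphMap A x) (B := entrySum A.transpose + 1)
    (C := 1 + ∑ i, |x i|) (w := w) (by linarith)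
    (by have := Finset.sum_nonneg fun i (_ : i ∈ Finset.univ) => abs_nonneg (x i); linarith) hw hκ0
    (by rwa [lt_div_iff₀ (by linarith)] at hκ2) fun X => ?_
  have hbdd : {q : Fin m → ℤ | ∀ j, q j ∈ Set.Icc (-(X + 1 : ℤ)) (X + 1)}.Finite :=
    Set.Finite.pi' fun _ => Set.finite_Icc _ _
  obtain ⟨q, hq, hqX⟩ := hinf.exists_notMem_finite hbdd
  simp only [Set.mem_ofPred_eq, not_forall, Set.mem_Icc, ← abs_le, not_le] at hqX
  have hne : Nonempty (Fin m) := ⟨⟨0, hm⟩⟩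
  obtain ⟨j₀, hj₀⟩ := Finite.exists_max fun j => |q j|
  have hjX : (X : ℤ) + 1 < |q j₀| := by
    obtain ⟨j, hj⟩ := hqX
    exact hj.trans_le (hj₀ j)
  have hnorm : ‖fun j => (q j : ℝ)‖ = (q j₀).natAbs := by
    have e : (((q j₀).natAbs : ℕ) : ℝ) = |(q j₀ : ℝ)| := by
      rw [← Int.cast_abs, Int.abs_eq_natAbs]; simp
    rw [e]
    refine le_antisymm ((pi_norm_le_iff_of_nonneg (abs_nonneg _)).2 fun j => ?_)
      (norm_le_pi_norm (fun j => (q j : ℝ)) j₀)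
    rw [Real.norm_eq_abs]
    exact_mod_cast hj₀ j
  set H : ℕ := (q j₀).natAbs
  have hHX : X + 1 < H := by
    have : (X : ℤ) + 1 < (H : ℤ) := by rw [Int.natCast_natAbs]; exact hjX
    exact_mod_cast this
  have hH1 : (1 : ℝ) ≤ H := by exact_mod_cast (by omega : 1 ≤ H)
  obtain ⟨k, hk⟩ := exists_int_of_distInt_lt hq
  rw [hnorm] at hk
  set u : Fin n → ℤ := Fin.append (fun i : Fin d => -k i.succ) q
  have hu₀ : u (Fin.natAdd d j₀) = q j₀ := by simp [u]
  refine ⟨Fin.natAdd d j₀, u, k 0, ?_, ?_, ?_⟩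
  · rw [hu₀]; omega
  · rw [hu₀]
    intro i
    refine Fin.addCases (fun i => ?_) (fun j => ?_) i
    · simp only [u, Fin.append_left]
      have h1 : |A.mulVec (fun j => (q j : ℝ)) i.succ| ≤ entrySum A.transpose * H := by
        rw [← Matrix.vecMul_transpose, ← hnorm]
        exact abs_vecMul_le _ (norm_nonneg _) (fun j => norm_le_pi_norm (fun j => (q j : ℝ)) j) _
      have h2 : (H : ℝ) ^ (-w) ≤ 1 := Real.rpow_le_one_of_one_le_of_nonpos hH1 (by linarith)
      have h3 := hk i.succ
      have h4 := abs_sub_abs_le_abs_sub (k i.succ : ℝ) (A.mulVec (fun j => (q j : ℝ)) i.succ)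
      rw [abs_sub_comm] at h4
      push_cast
      rw [abs_neg]
      linarith
    · simp only [u, Fin.append_right]
      have h1 : |(q j : ℝ)| ≤ H := by
        rw [← hnorm]; exact norm_le_pi_norm (fun j => (q j : ℝ)) j
      nlinarith
  · rw [hu₀]
    have e1 : ∑ i, (u i : ℝ) * graphMap A x i - k 0 =
        ∑ i, Matrix.vecCons 1 x i * (A.mulVec (fun j => (q j : ℝ)) i - k i) := by
      have h1 : ∑ i, (u i : ℝ) * graphMap A x i = -∑ i : Fin d, x i * k i.succ +
          ∑ j, Matrix.vecMul (Matrix.vecCons 1 x) A j * (q j : ℝ) := by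
        rw [Fin.sum_univ_add]
        simp only [u, graphMap, Fin.append_left, Fin.append_right]
        rw [← Finset.sum_neg_distrib]
        congr 1
        · exact Finset.sum_congr rfl fun i _ => by push_cast; ring
        · exact Finset.sum_congr rfl fun i _ => by ring
      have h2 : ∑ j, Matrix.vecMul (Matrix.vecCons 1 x) A j * (q j : ℝ) =
          ∑ i, Matrix.vecCons 1 x i * A.mulVec (fun j => (q j : ℝ)) i :=
        (Matrix.dotProduct_mulVec _ A _).symm
      rw [h1, h2]
      simp only [mul_sub, Finset.sum_sub_distrib]
      rw [Fin.sum_univ_succ (fun i => Matrix.vecCons 1 x i * (k i : ℝ))]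
      simp only [Matrix.cons_val_zero, Matrix.cons_val_succ]
      ring
    rw [e1, Fin.sum_univ_succ]
    simp only [Matrix.cons_val_zero, Matrix.cons_val_succ, one_mul]
    refine (abs_add_le _ _).trans ?_
    rw [add_mul, one_mul, Finset.sum_mul]
    refine add_le_add (hk 0).le ((Finset.abs_sum_le_sum_abs _ _).trans
      (Finset.sum_le_sum fun i _ => ?_))
    rw [abs_mul]
    exact mul_le_mul_of_nonneg_left (hk i.succ).le (abs_nonneg _)

/-! ### Ubiquity and the divergence part of the Borel–Cantelli lemma -/

/-- The Chung–Erdős inequality: Cauchy–Schwarz for the counting function `∑ k, 1_{A k}`. -/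
theorem sq_sum_measureReal_le {X : Type*} [MeasurableSpace X] (μ : Measure X) {ι : Type*}
    (s : Finset ι) (A : ι → Set X) (hA : ∀ k, MeasurableSet (A k)) (hfin : ∀ k, μ (A k) ≠ ⊤) :
    (∑ k ∈ s, μ.real (A k)) ^ 2 ≤
      μ.real (⋃ k ∈ s, A k) * ∑ k ∈ s, ∑ l ∈ s, μ.real (A k ∩ A l) := by
  set U := ⋃ k ∈ s, A k
  have hU : MeasurableSet U := s.measurableSet_biUnion fun k _ => hA k
  have hUfin : μ U ≠ ⊤ :=
    ((measure_biUnion_finset_le s A).trans_lt (ENNReal.sum_lt_top.2 fun k _ => (hfin k).lt_top)).ne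
  have hint : ∀ B : Set X, MeasurableSet B → μ B ≠ ⊤ → Integrable (B.indicator (fun _ => (1 : ℝ))) μ :=
    fun B hB hBf => (integrable_indicator_iff hB).2 (integrableOn_const hBf)
  have hval : ∀ B : Set X, MeasurableSet B → ∫ x, B.indicator (fun _ => (1 : ℝ)) x ∂μ = μ.real B :=
    fun B hB => by rw [integral_indicator hB]; simp
  have hI : ∀ k l, μ (A k ∩ A l) ≠ ⊤ := fun k l => measure_ne_top_of_subset Set.inter_subset_left (hfin k)
  set a := ∑ k ∈ s, μ.real (A k)
  set b := ∑ k ∈ s, ∑ l ∈ s, μ.real (A k ∩ A l)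
  -- `∫ (∑ k, 1_{A k} - t 1_U) ^ 2 ≥ 0`, as a quadratic polynomial in `t`
  have key : ∀ t : ℝ, 0 ≤ b - 2 * t * a + t ^ 2 * μ.real U := by
    intro t
    have h1 : ∀ x, (∑ k ∈ s, (A k).indicator (fun _ => (1 : ℝ)) x - t * U.indicator (fun _ => 1) x) ^ 2
        = ((∑ k ∈ s, ∑ l ∈ s, (A k ∩ A l).indicator (fun _ => (1 : ℝ)) x) -
          2 * t * (∑ k ∈ s, (A k).indicator (fun _ => (1 : ℝ)) x)) +
          t ^ 2 * U.indicator (fun _ => (1 : ℝ)) x := by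
      intro x
      have e1 : ∑ k ∈ s, ∑ l ∈ s, (A k ∩ A l).indicator (fun _ => (1 : ℝ)) x =
          (∑ k ∈ s, (A k).indicator (fun _ => (1 : ℝ)) x) ^ 2 := by
        rw [sq, Finset.sum_mul_sum]
        refine Finset.sum_congr rfl fun k _ => Finset.sum_congr rfl fun l _ => ?_
        by_cases hk : x ∈ A k <;> by_cases hl : x ∈ A l <;> simp [hk, hl]
      have e2 : (∑ k ∈ s, (A k).indicator (fun _ => (1 : ℝ)) x) * U.indicator (fun _ => 1) x =
          ∑ k ∈ s, (A k).indicator (fun _ => (1 : ℝ)) x := by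
        rw [Finset.sum_mul]
        refine Finset.sum_congr rfl fun k hk => ?_
        by_cases hx : x ∈ A k
        · have : x ∈ U := Set.mem_biUnion hk hx
          simp [hx, this]
        · simp [hx]
      have e3 : U.indicator (fun _ => (1 : ℝ)) x ^ 2 = U.indicator (fun _ => (1 : ℝ)) x := by
        by_cases hx : x ∈ U <;> simp [hx]
      rw [e1]
      linear_combination (-2 * t) * e2 + t ^ 2 * e3
    have i1 : Integrable (fun x => ∑ k ∈ s, ∑ l ∈ s, (A k ∩ A l).indicator (fun _ => (1 : ℝ)) x) μ :=
      integrable_finsetSum _ fun k _ => integrable_finsetSum _ fun l _ =>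
        hint _ ((hA k).inter (hA l)) (hI k l)
    have i2 : Integrable (fun x => ∑ k ∈ s, (A k).indicator (fun _ => (1 : ℝ)) x) μ :=
      integrable_finsetSum _ fun k _ => hint _ (hA k) (hfin k)
    have i3 := hint U hU hUfin
    have h2 : 0 ≤ ∫ x, (∑ k ∈ s, (A k).indicator (fun _ => (1 : ℝ)) x -
        t * U.indicator (fun _ => 1) x) ^ 2 ∂μ := integral_nonneg fun x => sq_nonneg _
    simp_rw [h1] at h2
    have i4 : Integrable (fun x => (∑ k ∈ s, ∑ l ∈ s, (A k ∩ A l).indicator (fun _ => (1 : ℝ)) x) -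
        2 * t * (∑ k ∈ s, (A k).indicator (fun _ => (1 : ℝ)) x)) μ := i1.sub (i2.const_mul _)
    rw [integral_add i4 (i3.const_mul _), integral_sub i1 (i2.const_mul _),
      integral_const_mul, integral_const_mul, hval U hU,
      integral_finsetSum _ (fun k _ => hint _ (hA k) (hfin k)),
      integral_finsetSum _ (fun k _ => integrable_finsetSum _ fun l _ =>
        hint _ ((hA k).inter (hA l)) (hI k l))] at h2
    simp_rw [fun k => hval _ (hA k)] at h2
    have h3 : ∀ k, ∫ x, ∑ l ∈ s, (A k ∩ A l).indicator (fun _ => (1 : ℝ)) x ∂μ =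
        ∑ l ∈ s, μ.real (A k ∩ A l) := by
      intro k
      rw [integral_finsetSum _ (fun l _ => hint _ ((hA k).inter (hA l)) (hI k l))]
      exact Finset.sum_congr rfl fun l _ => hval _ ((hA k).inter (hA l))
    simp_rw [h3] at h2
    exact h2
  have hu0 : 0 ≤ μ.real U := measureReal_nonneg
  rcases hu0.eq_or_lt with hu | hu
  · have ha : a = 0 := Finset.sum_eq_zero fun k hk => by
      refine le_antisymm ?_ measureReal_nonneg
      rw [hu]
      exact measureReal_mono (Set.subset_biUnion_of_mem (u := fun k => A k) hk) hUfin
    rw [ha, ← hu]; simp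
  · have := key (a / μ.real U)
    have e : b - 2 * (a / μ.real U) * a + (a / μ.real U) ^ 2 * μ.real U =
        (μ.real U * b - a ^ 2) / μ.real U := by field_simp; ring
    rw [e] at this
    have := (div_nonneg_iff.1 this).resolve_right (by rintro ⟨-, h⟩; linarith)
    linarith [this.1]

/-- A divergence Borel–Cantelli lemma for events that are quasi-independent up to a term decaying
geometrically in the distance of the indices. -/
theorem le_measure_frequently {X : Type*} [MeasurableSpace X] (μ : Measure X) (A : ℕ → Set X)
    (hA : ∀ k, MeasurableSet (A k)) {W : Set X} (hW : μ W ≠ ⊤) (hAW : ∀ k, A k ⊆ W) {f : ℕ → ℝ}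
    (hf : ∀ k, 0 ≤ f k) (hsum : ¬ Summable f) {α β : ℝ} (hα : 0 < α) (hβ : 0 < β)
    (hlow : ∀ k, α * f k ≤ μ.real (A k))
    (hup : ∀ k l, k ≤ l →
      μ.real (A k ∩ A l) ≤ β * (f k * f l + f k * (1 / 2) ^ (l - k))) :
    ENNReal.ofReal (α ^ 2 / (5 * β)) ≤ μ {x | ∃ᶠ k in atTop, x ∈ A k} := by
  have hfin : ∀ k, μ (A k) ≠ ⊤ := fun k => measure_ne_top_of_subset (hAW k) hW
  have hgeo : ∀ (k : ℕ) (s : Finset ℕ), ∑ l ∈ s, (if k ≤ l then (1 / 2 : ℝ) ^ (l - k) else 0) ≤ 2 := by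
    intro k s
    rw [← Finset.sum_filter]
    have hinj : Set.InjOn (fun l => l - k) (s.filter fun l => k ≤ l : Finset ℕ) := by
      intro a ha b hb h
      have ha := (Finset.mem_filter.1 ha).2
      have hb := (Finset.mem_filter.1 hb).2
      simp only at h
      omega
    rw [← Finset.sum_image (f := fun j => (1 / 2 : ℝ) ^ j) hinj]
    refine (summable_geometric_two.sum_le_tsum _ fun j _ => by positivity).trans ?_
    rw [tsum_geometric_two]
  set e : ℕ → ℕ → ℝ := fun k l => if k ≤ l then f k * (1 / 2) ^ (l - k) else 0
  have he0 : ∀ k l, 0 ≤ e k l := fun k l => by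
    have := hf k
    simp only [e]; split_ifs <;> positivity
  have hpair : ∀ k l, μ.real (A k ∩ A l) ≤ β * (f k * f l + e k l + e l k) := by
    intro k l
    rcases le_total k l with h | h
    · refine (hup k l h).trans (mul_le_mul_of_nonneg_left ?_ hβ.le)
      have h1 : e k l = f k * (1 / 2) ^ (l - k) := if_pos h
      linarith [he0 l k]
    · rw [Set.inter_comm]
      refine (hup l k h).trans (mul_le_mul_of_nonneg_left ?_ hβ.le)
      have h1 : e l k = f l * (1 / 2) ^ (k - l) := if_pos h
      linarith [he0 k l]
  have hesum : ∀ s : Finset ℕ, ∑ k ∈ s, ∑ l ∈ s, e k l ≤ 2 * ∑ k ∈ s, f k := by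
    intro s
    rw [Finset.mul_sum]
    refine Finset.sum_le_sum fun k _ => ?_
    have : ∑ l ∈ s, e k l = f k * ∑ l ∈ s, (if k ≤ l then (1 / 2 : ℝ) ^ (l - k) else 0) := by
      rw [Finset.mul_sum]
      refine Finset.sum_congr rfl fun l _ => ?_
      simp only [e]; split_ifs <;> simp
    rw [this]
    nlinarith [hgeo k s, hf k]
  have htail : ∀ N, ENNReal.ofReal (α ^ 2 / (5 * β)) ≤ μ (⋃ k ≥ N, A k) := by
    intro N
    have hdiv : ¬ Summable fun k => f (k + N) := fun h => hsum ((summable_nat_add_iff _).1 h)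
    have htend := (not_summable_iff_tendsto_nat_atTop_of_nonneg (fun k => hf _)).1 hdiv
    obtain ⟨K, hK⟩ := (htend.eventually_ge_atTop 1).exists
    set s : Finset ℕ := (Finset.range K).map (addRightEmbedding (N))
    have hs : ∀ k ∈ s, N ≤ k := by
      intro k hk
      obtain ⟨j, -, rfl⟩ := Finset.mem_map.1 hk
      simp [addRightEmbedding]
    set F := ∑ k ∈ s, f k
    have hF : 1 ≤ F := by
      simp only [F, s, Finset.sum_map]
      exact hK
    have h1 := sq_sum_measureReal_le μ s A hA hfin
    have h2 : α * F ≤ ∑ k ∈ s, μ.real (A k) := by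
      rw [Finset.mul_sum]
      exact Finset.sum_le_sum fun k _ => hlow k
    have h3 : ∑ k ∈ s, ∑ l ∈ s, μ.real (A k ∩ A l) ≤ β * (5 * F ^ 2) := by
      have h4 : ∑ k ∈ s, ∑ l ∈ s, μ.real (A k ∩ A l) ≤
          ∑ k ∈ s, ∑ l ∈ s, β * (f k * f l + e k l + e l k) :=
        Finset.sum_le_sum fun k _ => Finset.sum_le_sum fun l _ => hpair k l
      refine h4.trans ?_
      simp_rw [← Finset.mul_sum]
      refine mul_le_mul_of_nonneg_left ?_ hβ.le
      simp_rw [Finset.sum_add_distrib]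
      rw [Finset.sum_comm (f := fun k l => e l k), ← Finset.sum_mul_sum]
      have := hesum s
      change F * F + _ + _ ≤ _
      change _ ≤ 2 * F at this
      nlinarith
    have hUfin : μ (⋃ k ∈ s, A k) ≠ ⊤ :=
      measure_ne_top_of_subset (Set.iUnion₂_subset fun k _ => hAW k) hW
    have h5 : α ^ 2 / (5 * β) ≤ μ.real (⋃ k ∈ s, A k) := by
      have h6 : (α * F) ^ 2 ≤ (∑ k ∈ s, μ.real (A k)) ^ 2 := pow_le_pow_left₀ (by positivity) h2 2
      have h7 := mul_le_mul_of_nonneg_left h3 (measureReal_nonneg (μ := μ) (s := ⋃ k ∈ s, A k))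
      rw [div_le_iff₀ (by positivity)]
      refine le_of_mul_le_mul_right ?_ (by positivity : 0 < F ^ 2)
      nlinarith
    rw [ENNReal.ofReal_le_iff_le_toReal (measure_ne_top_of_subset
      (Set.iUnion₂_subset fun k _ => hAW k) hW)]
    refine h5.trans (measureReal_mono ?_ (measure_ne_top_of_subset
      (Set.iUnion₂_subset fun k _ => hAW k) hW))
    exact Set.iUnion₂_subset fun k hk =>
      Set.subset_iUnion₂_of_subset k (hs k hk) le_rfl
  have hset : {x | ∃ᶠ k in atTop, x ∈ A k} = ⋂ N, ⋃ k ≥ N, A k := by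
    ext x
    simp [frequently_atTop]
  rw [hset]
  refine ge_of_tendsto (tendsto_measure_iInter_atTop (s := fun N => ⋃ k ≥ N, A k)
    (fun N => (MeasurableSet.iUnion fun k => MeasurableSet.iUnion fun _ => hA k).nullMeasurableSet)
    (fun M N hMN => Set.iUnion₂_subset fun k hk =>
      Set.subset_iUnion₂_of_subset k (hMN.trans hk) le_rfl)
    ⟨0, measure_ne_top_of_subset (Set.iUnion₂_subset fun k _ => hAW k) hW⟩)
    (Eventually.of_forall htail)

theorem volumeReal_ball {d : ℕ} (z : Fin d → ℝ) {r : ℝ} (hr : 0 < r) :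
    volume.real (Metric.ball z r) = (2 * r) ^ d := by
  rw [Measure.real, Real.volume_pi_ball _ hr, Fintype.card_fin, ENNReal.toReal_ofReal (by positivity)]

theorem volumeReal_biUnion_ball {d : ℕ} (G : Finset (Fin d → ℝ)) {r ρ : ℝ} (hr : 0 < r)
    (hrρ : r ≤ ρ) (hG : ∀ z ∈ G, ∀ z' ∈ G, z ≠ z' → 2 * ρ ≤ dist z z') :
    volume.real (⋃ z ∈ G, Metric.ball z r) = G.card * (2 * r) ^ d := by
  rw [measureReal_biUnion_finset]
  · simp_rw [volumeReal_ball _ hr, Finset.sum_const, nsmul_eq_mul]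
  · intro z hz z' hz' hne
    exact Metric.ball_disjoint_ball (by linarith [hG z hz z' hz' hne])
  · exact fun z _ => Metric.isOpen_ball.measurableSet

/-- The volume bound for the number of separated points in a ball. -/
theorem card_mul_pow_le {d : ℕ} (G : Finset (Fin d → ℝ)) {ρ R : ℝ} (hρ : 0 < ρ) (hR : 0 ≤ R)
    (hG : ∀ z ∈ G, ∀ z' ∈ G, z ≠ z' → 2 * ρ ≤ dist z z') (x₀ : Fin d → ℝ)
    (hGx : ∀ z ∈ G, dist z x₀ ≤ R) : (G.card : ℝ) * ρ ^ d ≤ (R + ρ) ^ d := by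
  have h1 := volumeReal_biUnion_ball G hρ le_rfl hG
  have h2 : volume.real (⋃ z ∈ G, Metric.ball z ρ) ≤ volume.real (Metric.ball x₀ (R + ρ)) := by
    refine measureReal_mono (Set.iUnion₂_subset fun z hz => Metric.ball_subset_ball' ?_)
      Metric.isBounded_ball.measure_lt_top.ne
    linarith [hGx z hz]
  rw [h1, volumeReal_ball _ (by linarith), mul_pow, mul_pow] at h2
  have : (0 : ℝ) < 2 ^ d := by positivity
  nlinarith

/-- The ubiquity principle: if for every `k` the separated points `G k` are dense in a ball at the
scale `ρ k`, then the limsup set of the balls of radius `r k ≤ ρ k` about these points fills a fixed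
proportion of the ball, provided that `∑ (r k / ρ k) ^ d` diverges. -/
theorem le_volume_frequently_of_ubiquity {d : ℕ} (hd : 1 ≤ d) (x₀ : Fin d → ℝ) {r₀ c : ℝ} (hr₀ : 0 < r₀)
    (hc : 0 < c) (r ρ : ℕ → ℝ) (G : ℕ → Finset (Fin d → ℝ)) (hr : ∀ k, 0 < r k)
    (hρ : ∀ k, r k ≤ ρ k) (hr2 : ∀ k, r (k + 1) ≤ r k / 2) (hρr₀ : ∀ k, ρ k ≤ r₀)
    (hG : ∀ k, ∀ z ∈ G k, ∀ z' ∈ G k, z ≠ z' → 2 * ρ k ≤ dist z z')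
    (hGx : ∀ k, ∀ z ∈ G k, dist z x₀ ≤ 2 * r₀)
    (hGc : ∀ k, c * r₀ ^ d ≤ (G k).card * ρ k ^ d)
    (hsum : ¬ Summable fun k => (r k / ρ k) ^ d) :
    ENNReal.ofReal (c ^ 2 / (5 * 6 ^ d) * r₀ ^ d) ≤
      volume ({x | ∃ᶠ k in atTop, ∃ z ∈ G k, dist x z < r k} ∩ Metric.closedBall x₀ (3 * r₀)) := by
  classical
  set A : ℕ → Set (Fin d → ℝ) := fun k => ⋃ z ∈ G k, Metric.ball z (r k) with hAdef
  set f : ℕ → ℝ := fun k => (r k / ρ k) ^ d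
  have hρ0 : ∀ k, 0 < ρ k := fun k => (hr k).trans_le (hρ k)
  have hf : ∀ k, 0 ≤ f k := fun k => by have := hr k; have := hρ0 k; positivity
  have hfin : ∀ k, volume (A k) ≠ ⊤ := fun k =>
    ((measure_biUnion_finset_le _ _).trans_lt (ENNReal.sum_lt_top.2 fun z _ =>
      Metric.isBounded_ball.measure_lt_top)).ne
  have hAW : ∀ k, A k ⊆ Metric.closedBall x₀ (3 * r₀) := by
    intro k
    refine Set.iUnion₂_subset fun z hz => Metric.ball_subset_closedBall.trans
      (Metric.closedBall_subset_closedBall' ?_)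
    linarith [hGx k z hz, hρ k, hρr₀ k]
  have hvol : ∀ k, volume.real (A k) = ((G k).card * ρ k ^ d) * (2 ^ d * f k) := by
    intro k
    have h0 := (hρ0 k).ne'
    rw [volumeReal_biUnion_ball (G k) (hr k) (hρ k) (hG k)]
    simp only [f]
    rw [div_pow, mul_pow]
    field_simp
  have hcard : ∀ k, ((G k).card : ℝ) * ρ k ^ d ≤ 3 ^ d * r₀ ^ d := by
    intro k
    refine (card_mul_pow_le (G k) (hρ0 k) (by linarith) (hG k) x₀ (hGx k)).trans ?_
    rw [← mul_pow]
    refine pow_le_pow_left₀ (by linarith [hρ0 k]) (by linarith [hρr₀ k]) d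
  have hrgeo : ∀ k j, r (k + j) ≤ r k * (1 / 2) ^ j := by
    intro k j
    induction j with
    | zero => simp
    | succ j ih =>
      have := hr2 (k + j)
      rw [← add_assoc, pow_succ]
      linarith
  have hrle : ∀ k l, k ≤ l → r l ≤ r k := by
    intro k l hkl
    obtain ⟨j, rfl⟩ := Nat.exists_eq_add_of_le hkl
    refine (hrgeo k j).trans (mul_le_of_le_one_right (hr k).le (pow_le_one₀ (by norm_num) (by norm_num)))
  have hup : ∀ k l, k ≤ l → volume.real (A k ∩ A l) ≤
      (24 ^ d * r₀ ^ d) * (f k * f l + f k * (1 / 2) ^ (l - k)) := by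
    intro k l hkl
    have hrk := hr k
    have hrl := hr l
    have hpk := hρ0 k
    have hpl := hρ0 l
    -- each ball of level `k` meets few balls of level `l`
    have hball : ∀ z ∈ G k, volume.real (Metric.ball z (r k) ∩ A l) ≤
        8 ^ d * (r k ^ d * f l + r l ^ d) := by
      intro z _
      set G' := (G l).filter fun z' => dist z' z ≤ r k + r l
      have hsub : Metric.ball z (r k) ∩ A l ⊆ ⋃ z' ∈ G', Metric.ball z' (r l) := by
        rintro x ⟨hx1, hx2⟩
        obtain ⟨z', hz', hx3⟩ := Set.mem_iUnion₂.1 hx2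
        refine Set.mem_iUnion₂.2 ⟨z', Finset.mem_filter.2 ⟨hz', ?_⟩, hx3⟩
        have := dist_triangle_left z' z x
        have h1 := Metric.mem_ball.1 hx1
        have h3 := Metric.mem_ball.1 hx3
        linarith
      have hG'sep : ∀ z ∈ G', ∀ z' ∈ G', z ≠ z' → 2 * ρ l ≤ dist z z' := fun z hz z' hz' =>
        hG l z (Finset.mem_filter.1 hz).1 z' (Finset.mem_filter.1 hz').1
      have hG'card := card_mul_pow_le G' hpl (by linarith) hG'sep z fun z' hz' =>
        (Finset.mem_filter.1 hz').2
      have h1 : (r k + r l + ρ l) ^ d ≤ 4 ^ d * (r k ^ d + ρ l ^ d) := by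
        have hrl' := hρ l
        rcases le_total (r k) (ρ l) with h | h
        · calc (r k + r l + ρ l) ^ d ≤ (4 * ρ l) ^ d :=
                pow_le_pow_left₀ (by linarith) (by linarith) d
            _ = 4 ^ d * ρ l ^ d := mul_pow _ _ _
            _ ≤ _ := by
              have : 0 ≤ r k ^ d := by positivity
              gcongr; linarith
        · calc (r k + r l + ρ l) ^ d ≤ (4 * r k) ^ d :=
                pow_le_pow_left₀ (by linarith) (by linarith) d
            _ = 4 ^ d * r k ^ d := mul_pow _ _ _
            _ ≤ _ := by
              have : 0 ≤ ρ l ^ d := by positivity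
              gcongr; linarith
      calc volume.real (Metric.ball z (r k) ∩ A l)
          ≤ volume.real (⋃ z' ∈ G', Metric.ball z' (r l)) :=
            measureReal_mono hsub ((measure_biUnion_finset_le _ _).trans_lt
              (ENNReal.sum_lt_top.2 fun z _ => Metric.isBounded_ball.measure_lt_top)).ne
        _ = (G'.card * ρ l ^ d) * (2 ^ d * f l) := by
            rw [volumeReal_biUnion_ball G' hrl (hρ l) hG'sep]
            simp only [f]
            rw [div_pow, mul_pow]
            field_simp
        _ ≤ (4 ^ d * (r k ^ d + ρ l ^ d)) * (2 ^ d * f l) :=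
            mul_le_mul_of_nonneg_right (hG'card.trans h1) (by have := hf l; positivity)
        _ = 8 ^ d * (r k ^ d * f l + r l ^ d) := by
            have e1 : (8 : ℝ) ^ d = 4 ^ d * 2 ^ d := by rw [← mul_pow]; norm_num
            have e2 : ρ l ^ d * f l = r l ^ d := by
              simp only [f]; rw [div_pow]; field_simp
            rw [e1, ← e2]; ring
    have hdec : r l ^ d ≤ r k ^ d * (1 / 2) ^ (l - k) := by
      obtain ⟨j, rfl⟩ := Nat.exists_eq_add_of_le hkl
      have h1 := pow_le_pow_left₀ hrl.le (hrgeo k j) d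
      refine h1.trans ?_
      rw [mul_pow, Nat.add_sub_cancel_left]
      refine mul_le_mul_of_nonneg_left ?_ (by positivity)
      exact pow_le_of_le_one (by positivity) (pow_le_one₀ (by norm_num) (by norm_num)) (by omega)
    have hsplit : A k ∩ A l = ⋃ z ∈ G k, (Metric.ball z (r k) ∩ A l) := by
      rw [hAdef]; simp only [Set.iUnion_inter]
    have e3 : r k ^ d = ρ k ^ d * f k := by
      simp only [f]; rw [div_pow]; field_simp
    calc volume.real (A k ∩ A l) ≤ ∑ z ∈ G k, volume.real (Metric.ball z (r k) ∩ A l) := by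
          rw [hsplit]; exact measureReal_biUnion_finset_le _ _
      _ ≤ ∑ _z ∈ G k, 8 ^ d * (r k ^ d * f l + r l ^ d) := Finset.sum_le_sum hball
      _ = (G k).card * (8 ^ d * (r k ^ d * f l + r l ^ d)) := by
          rw [Finset.sum_const, nsmul_eq_mul]
      _ ≤ (G k).card * (8 ^ d * (r k ^ d * f l + r k ^ d * (1 / 2) ^ (l - k))) := by gcongr
      _ = ((G k).card * ρ k ^ d) * (8 ^ d * (f k * f l + f k * (1 / 2) ^ (l - k))) := by
          rw [e3]; ring
      _ ≤ (3 ^ d * r₀ ^ d) * (8 ^ d * (f k * f l + f k * (1 / 2) ^ (l - k))) := by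
          have := hf k; have := hf l
          exact mul_le_mul_of_nonneg_right (hcard k) (by positivity)
      _ = _ := by
          rw [show (24 : ℝ) ^ d = 3 ^ d * 8 ^ d by rw [← mul_pow]; norm_num]; ring
  have hmain := le_measure_frequently volume A
    (fun k => (isOpen_biUnion fun z _ => Metric.isOpen_ball).measurableSet)
    (W := Metric.closedBall x₀ (3 * r₀)) Metric.isBounded_closedBall.measure_lt_top.ne hAW hf hsum
    (α := 2 ^ d * c * r₀ ^ d) (β := 24 ^ d * r₀ ^ d) (by positivity) (by positivity)
    (fun k => by
      rw [hvol]
      have := mul_le_mul_of_nonneg_right (hGc k) (by have := hf k; positivity : 0 ≤ 2 ^ d * f k)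
      linarith) hup
  have hconst : (2 ^ d * c * r₀ ^ d) ^ 2 / (5 * (24 ^ d * r₀ ^ d)) = c ^ 2 / (5 * 6 ^ d) * r₀ ^ d := by
    rw [show (24 : ℝ) ^ d = 2 ^ d * 2 ^ d * 6 ^ d by rw [← mul_pow, ← mul_pow]; norm_num]
    field_simp
  rw [hconst] at hmain
  refine hmain.trans (measure_mono fun x hx => ⟨?_, ?_⟩)
  · refine Frequently.mono hx fun k hk => ?_
    obtain ⟨z, hz, hxz⟩ := Set.mem_iUnion₂.1 hk
    exact ⟨z, hz, hxz⟩
  · obtain ⟨k, hk⟩ := hx.exists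
    exact hAW k hk

/-- A set that fills a fixed proportion of every small ball about every point of a bounded region
has full measure there, by Lebesgue's density theorem. -/
theorem volume_inter_compl_eq_zero {d : ℕ} (E : Set (Fin d → ℝ)) (hE : MeasurableSet E) {M c r₁ : ℝ}
    (hc : 0 < c) (hr₁ : 0 < r₁) (h : ∀ x₀ : Fin d → ℝ, ‖x₀‖ ≤ M → ∀ r₀, 0 < r₀ → r₀ ≤ r₁ →
      ENNReal.ofReal (c * r₀ ^ d) ≤ volume (E ∩ Metric.closedBall x₀ r₀)) :
    volume (Eᶜ ∩ Metric.closedBall 0 M) = 0 := by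
  have hae := Besicovitch.ae_tendsto_measure_inter_div_of_measurableSet
    (volume : Measure (Fin d → ℝ)) hE
  refine measure_mono_null ?_ (ae_iff.1 hae)
  rintro x ⟨hxE, hxM⟩ htend
  have hxM : ‖x‖ ≤ M := by simpa using hxM
  rw [Set.indicator_of_notMem hxE] at htend
  have hev : ∀ᶠ r in 𝓝[>] (0 : ℝ), ENNReal.ofReal (c / 2 ^ d) ≤
      volume (E ∩ Metric.closedBall x r) / volume (Metric.closedBall x r) := by
    have h1 : ∀ᶠ r in 𝓝[>] (0 : ℝ), r ∈ Set.Ioc 0 r₁ := Ioc_mem_nhdsGT hr₁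
    filter_upwards [h1] with r hr
    rw [Real.volume_pi_closedBall _ hr.1.le, Fintype.card_fin]
    have hr0 := hr.1
    rw [ENNReal.le_div_iff_mul_le (Or.inl (by simp; positivity)) (Or.inl ENNReal.ofReal_ne_top),
      ← ENNReal.ofReal_mul (by positivity)]
    refine le_trans (le_of_eq ?_) (h x hxM r hr.1 hr.2)
    congr 1
    rw [mul_pow]; field_simp
  have := ge_of_tendsto htend hev
  have h2 : 0 < ENNReal.ofReal (c / 2 ^ d) := ENNReal.ofReal_pos.2 (by positivity)
  exact absurd this (not_le.2 h2)

/-! ### Dirichlet approximation with large denominators -/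

/-- Dirichlet's theorem for rational points near `L_A`, by the pigeonhole principle: every `x` has a
rational approximation `a / q` for which `(q, a) A` is also close to an integer point. -/
theorem exists_dirichlet {d m : ℕ} (A : Matrix (Fin (d + 1)) (Fin m) ℝ) (x : Fin d → ℝ)
    {S J N : ℕ} (hS : 0 < S) (hJ : 0 < J) (hN : S ^ d * J ^ m ≤ N) :
    ∃ v : Fin (d + 1) → ℤ, 0 < v 0 ∧ v 0 ≤ N ∧ (∀ i : Fin d, |(v i.succ : ℝ) - v 0 * x i| ≤ 1 / S) ∧
      distInt (Matrix.vecMul (fun i => (v i : ℝ)) A) ≤ 1 / J := by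
  classical
  have hlt : ∀ (T : ℕ) (_ : 0 < T) (a : ℝ), ⌊(T : ℝ) * Int.fract a⌋₊ < T := fun T hT a => by
    have hT' : (0 : ℝ) < T := by exact_mod_cast hT
    rw [Nat.floor_lt (mul_nonneg hT'.le (Int.fract_nonneg _))]
    nlinarith [Int.fract_lt_one a]
  have hclose : ∀ (T : ℕ) (_ : 0 < T) (a b : ℝ),
      ⌊(T : ℝ) * Int.fract a⌋₊ = ⌊(T : ℝ) * Int.fract b⌋₊ →
      |(b - a) - ((⌊b⌋ - ⌊a⌋ : ℤ) : ℝ)| ≤ 1 / T := by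
    intro T hT a b h
    have hT' : (0 : ℝ) < T := by exact_mod_cast hT
    have e1 : (b - a) - ((⌊b⌋ - ⌊a⌋ : ℤ) : ℝ) = Int.fract b - Int.fract a := by
      simp only [Int.fract]; push_cast; ring
    have a1 := Nat.floor_le (mul_nonneg hT'.le (Int.fract_nonneg a))
    have a2 := Nat.lt_floor_add_one ((T : ℝ) * Int.fract a)
    have b1 := Nat.floor_le (mul_nonneg hT'.le (Int.fract_nonneg b))
    have b2 := Nat.lt_floor_add_one ((T : ℝ) * Int.fract b)
    rw [h] at a1 a2
    rw [e1, abs_le, neg_le, le_div_iff₀ hT', le_div_iff₀ hT']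
    constructor <;> linarith
  set u : ℕ → Fin (d + 1) → ℤ := fun q => Fin.cons (q : ℤ) fun i => ⌊(q : ℝ) * x i⌋
  set g : ℕ → Fin m → ℝ := fun q => Matrix.vecMul (fun i => (u q i : ℝ)) A
  set f : Fin (N + 1) → (Fin d → Fin S) × (Fin m → Fin J) := fun q =>
    (fun i => ⟨⌊(S : ℝ) * Int.fract ((q : ℕ) * x i)⌋₊, hlt S hS _⟩,
      fun j => ⟨⌊(J : ℝ) * Int.fract (g q j)⌋₊, hlt J hJ _⟩)
  obtain ⟨a, b, hab, hf⟩ := Fintype.exists_ne_map_eq_of_card_lt f (by simp; omega)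
  wlog hlt' : a < b generalizing a b
  · exact this b a hab.symm hf.symm (lt_of_le_of_ne (not_lt.1 hlt') hab.symm)
  obtain ⟨hf1, hf2⟩ := Prod.mk.inj hf
  have hab' : (a : ℕ) < b := hlt'
  have hbN : (b : ℕ) ≤ N := Nat.lt_succ_iff.1 b.2
  refine ⟨fun i => u b i - u a i, ?_, ?_, fun i => ?_, ?_⟩
  · simp only [u, Fin.cons_zero]; omega
  · simp only [u, Fin.cons_zero]; omega
  · have h1 := hclose S hS _ _ (congrArg Fin.val (congrFun hf1 i))
    rw [abs_sub_comm] at h1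
    convert h1 using 2
    simp only [u, Fin.cons_zero, Fin.cons_succ]
    push_cast; ring
  · refine distInt_le_of_forall (by positivity) (fun j => ⌊g b j⌋ - ⌊g a j⌋) fun j => ?_
    have h1 := hclose J hJ _ _ (congrArg Fin.val (congrFun hf2 j))
    convert h1 using 2
    congr 1
    simp only [g, Matrix.vecMul, dotProduct, ← Finset.sum_sub_distrib]
    exact Finset.sum_congr rfl fun i _ => by push_cast; ring

theorem volume_biUnion_closedBall_le' {d : ℕ} {ι : Type*} (V : Finset ι) (z : ι → Fin d → ℝ) {r X : ℝ}
    (hr : 0 ≤ r) (hX : (V.card : ℝ) * (2 * r) ^ d ≤ X) :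
    volume (⋃ v ∈ V, Metric.closedBall (z v) r) ≤ ENNReal.ofReal X :=
  (volume_biUnion_closedBall_le V z hr).trans (ENNReal.ofReal_le_ofReal hX)

theorem mem_closedBall_ratPoint {d : ℕ} {x : Fin d → ℝ} {v : Fin (d + 1) → ℤ} {t Q : ℝ} (ht : 0 ≤ t)
    (hQ : 0 < Q) (hv : Q ≤ v 0) (hx : ∀ i : Fin d, |(v i.succ : ℝ) - v 0 * x i| ≤ t) :
    x ∈ Metric.closedBall (ratPoint v) (t / Q) := by
  have hv0 : (0 : ℝ) < v 0 := hQ.trans_le hv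
  rw [Metric.mem_closedBall, dist_pi_le_iff (by positivity)]
  intro i
  rw [ratPoint, Real.dist_eq, abs_sub_comm, div_sub' hv0.ne', abs_div, abs_of_pos hv0,
    div_le_div_iff₀ hv0 hQ]
  exact mul_le_mul (hx i) hv hQ.le ht

/-- The points `x` of a ball of radius `r₀` that have a Dirichlet approximation of denominator less
than `2 ^ N` fill a small proportion of it. The blocks of denominators `[2 ^ i, 2 ^ (i + 1))` with
`i₀ ≤ i` are estimated by `exists_card_region_le` in the ball, the smaller denominators crudely. -/
theorem volume_smallDenominators_le {d m : ℕ} (A : Matrix (Fin (d + 1)) (Fin m) ℝ)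
    {K κ : ℝ} (hK : 0 < K) (hκ : 0 < κ) (hκm : κ * m < 1) (x₀ : Fin d → ℝ)
    (hcount : ∀ (P : ℕ) (s δ : ℝ), 0 < s → s ≤ 1 →
      1 ≤ s * P → ∀ V : Finset (Fin (d + 1) → ℤ), (V : Set (Fin (d + 1) → ℤ)) ⊆ nearPoints A x₀ P s δ →
      (V.card : ℝ) ≤ K * (P : ℝ) ^ (d + 1) * s ^ d * max δ ((s * P) ^ (-κ)) ^ m)
    {r₀ : ℝ} (hr₀ : 0 < r₀) (hr₀' : 2 * r₀ ≤ 1) {i₀ : ℕ} (hi₀ : 1 ≤ 2 * r₀ * 2 ^ i₀) {t δ : ℝ}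
    (ht : 0 < t) (htr : t ≤ r₀) (hδ : 0 < δ) (hδ1 : δ ≤ 1) (N : ℕ) :
    volume {x | x ∈ Metric.closedBall x₀ r₀ ∧ ∃ v : Fin (d + 1) → ℤ, 0 < v 0 ∧ v 0 < 2 ^ N ∧
        (∀ i : Fin d, |(v i.succ : ℝ) - v 0 * x i| ≤ t) ∧
        distInt (Matrix.vecMul (fun i => (v i : ℝ)) A) ≤ δ} ≤
      ENNReal.ofReal (K * (2 * t) ^ d * (2 ^ i₀) ^ (d + 1) +
        K * (2 * r₀) ^ d * (2 * t) ^ d * 2 ^ (d + 1) * (2 ^ N * δ ^ m +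
          (2 * r₀) ^ (-(κ * m)) * ((2 ^ (1 - κ * m)) ^ N / (2 ^ (1 - κ * m) - 1)))) := by
  classical
  set s := 2 * r₀ with hs
  have hs0 : 0 < s := by positivity
  set γ := 1 - κ * m with hγ
  have hγ0 : 0 < γ := by simp only [γ]; linarith
  set g : ℝ := 2 ^ γ with hg
  have hg1 : 1 < g := Real.one_lt_rpow (by norm_num) hγ0
  set W : ℕ → Finset (Fin (d + 1) → ℤ) := fun P => (finite_nearPoints A x₀ P s δ).toFinset
  have hW : ∀ P, (W P : Set (Fin (d + 1) → ℤ)) ⊆ nearPoints A x₀ P s δ := fun P => by simp [W]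
  set F₀ : Set (Fin d → ℝ) := ⋃ v ∈ W (2 ^ i₀), Metric.closedBall (ratPoint v) t
  set F : ℕ → Set (Fin d → ℝ) := fun i =>
    ⋃ v ∈ W (2 ^ (i + 1)), Metric.closedBall (ratPoint v) (t / 2 ^ i)
  set X : ℕ → ℝ := fun i => K * s ^ d * (2 * t) ^ d * 2 ^ (d + 1) *
    (2 ^ i * δ ^ m + s ^ (-(κ * m)) * g ^ i)
  have hX0 : ∀ i, 0 ≤ X i := fun i => by positivity
  have hF₀ : volume F₀ ≤ ENNReal.ofReal (K * (2 * t) ^ d * (2 ^ i₀) ^ (d + 1)) := by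
    refine volume_biUnion_closedBall_le' _ _ ht.le ?_
    have h1 := hcount (2 ^ i₀) s δ hs0 hr₀' (by exact_mod_cast hi₀) (W (2 ^ i₀)) (hW _)
    have h2 : max δ ((s * ((2 ^ i₀ : ℕ) : ℝ)) ^ (-κ)) ^ m ≤ 1 := by
      refine pow_le_one₀ (le_max_of_le_left hδ.le) (max_le hδ1 ?_)
      exact Real.rpow_le_one_of_one_le_of_nonpos (by exact_mod_cast hi₀) (by linarith)
    have h3 : s ^ d ≤ 1 := pow_le_one₀ hs0.le hr₀'
    have h4 : ((W (2 ^ i₀)).card : ℝ) ≤ K * (2 ^ i₀) ^ (d + 1) := by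
      refine h1.trans ?_
      push_cast at h2 ⊢
      have h5 : (0 : ℝ) ≤ max δ ((s * 2 ^ i₀) ^ (-κ)) ^ m := pow_nonneg (le_max_of_le_left hδ.le) _
      calc K * (2 ^ i₀) ^ (d + 1) * s ^ d * max δ ((s * 2 ^ i₀) ^ (-κ)) ^ m
          ≤ K * (2 ^ i₀) ^ (d + 1) * 1 * 1 := by gcongr
        _ = _ := by ring
    calc _ ≤ K * (2 ^ i₀) ^ (d + 1) * (2 * t) ^ d := by gcongr
      _ = _ := by ring
  have hF : ∀ i, i₀ ≤ i → volume (F i) ≤ ENNReal.ofReal (X i) := by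
    intro i hi
    refine volume_biUnion_closedBall_le' _ _ (by positivity) ?_
    have hsP : 1 ≤ s * ((2 ^ (i + 1) : ℕ) : ℝ) := by
      push_cast
      refine hi₀.trans (mul_le_mul_of_nonneg_left ?_ hs0.le)
      exact pow_le_pow_right₀ (by norm_num) (by omega)
    have h1 := hcount (2 ^ (i + 1)) s δ hs0 hr₀' hsP (W (2 ^ (i + 1))) (hW _)
    have h2 : max δ ((s * ((2 ^ (i + 1) : ℕ) : ℝ)) ^ (-κ)) ^ m ≤
        δ ^ m + s ^ (-(κ * m)) * ((2 : ℝ) ^ i) ^ (-(κ * m)) := by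
      have h3 : ((s * ((2 ^ (i + 1) : ℕ) : ℝ)) ^ (-κ)) ^ m ≤
          s ^ (-(κ * m)) * ((2 : ℝ) ^ i) ^ (-(κ * m)) := by
        rw [← Real.rpow_natCast, ← Real.rpow_mul (by positivity), ← Real.mul_rpow hs0.le (by positivity),
          neg_mul]
        refine Real.rpow_le_rpow_of_nonpos (by positivity) ?_ (by
          have : 0 ≤ κ * m := by positivity
          linarith)
        push_cast
        exact mul_le_mul_of_nonneg_left (pow_le_pow_right₀ (by norm_num) (by omega)) hs0.le
      rcases max_cases δ ((s * ((2 ^ (i + 1) : ℕ) : ℝ)) ^ (-κ)) with h | h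
      · rw [h.1]
        have : 0 ≤ s ^ (-(κ * m)) * ((2 : ℝ) ^ i) ^ (-(κ * m)) := by positivity
        linarith
      · rw [h.1]
        have : 0 ≤ δ ^ m := by positivity
        linarith
    have h4 : (2 : ℝ) ^ i * ((2 : ℝ) ^ i) ^ (-(κ * m)) = g ^ i := by
      rw [hg, ← Real.rpow_natCast (2 ^ γ), ← Real.rpow_mul (by norm_num), mul_comm γ, Real.rpow_mul (by norm_num),
        Real.rpow_natCast, ← Real.rpow_one_add' (by positivity) (by rw [← sub_eq_add_neg]; exact hγ0.ne'),
        ← sub_eq_add_neg]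
    calc ((W (2 ^ (i + 1))).card : ℝ) * (2 * (t / 2 ^ i)) ^ d
        ≤ (K * ((2 ^ (i + 1) : ℕ) : ℝ) ^ (d + 1) * s ^ d *
          (δ ^ m + s ^ (-(κ * m)) * ((2 : ℝ) ^ i) ^ (-(κ * m)))) * (2 * (t / 2 ^ i)) ^ d := by
          refine mul_le_mul_of_nonneg_right (h1.trans ?_) (by positivity)
          exact mul_le_mul_of_nonneg_left h2 (by positivity)
      _ = X i := by
          simp only [X]
          rw [← h4]
          push_cast
          rw [pow_succ (2 : ℝ) i, mul_pow, mul_pow 2 (t / 2 ^ i), div_pow, mul_pow 2 t,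
            pow_succ ((2 : ℝ) ^ i) d]
          field_simp
  have hcover : {x | x ∈ Metric.closedBall x₀ r₀ ∧ ∃ v : Fin (d + 1) → ℤ, 0 < v 0 ∧ v 0 < 2 ^ N ∧
        (∀ i : Fin d, |(v i.succ : ℝ) - v 0 * x i| ≤ t) ∧
        distInt (Matrix.vecMul (fun i => (v i : ℝ)) A) ≤ δ} ⊆
      F₀ ∪ ⋃ i ∈ (Finset.range N).filter (i₀ ≤ ·), F i := by
    rintro x ⟨hx, v, hv0, hvN, hva, hvA⟩
    have hv0' : (1 : ℝ) ≤ v 0 := by exact_mod_cast hv0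
    have hnear : ∀ P : ℕ, v 0 < P → v ∈ W P := by
      intro P hP
      refine (Set.Finite.mem_toFinset _).2 ⟨hv0.le, hP, fun i => ?_, hvA⟩
      have h1 : |x i - x₀ i| ≤ r₀ := by
        have := (dist_pi_le_iff hr₀.le).1 (Metric.mem_closedBall.1 hx) i
        simpa [Real.dist_eq] using this
      have h2 : (v i.succ : ℝ) - v 0 * x₀ i = (v i.succ - v 0 * x i) + v 0 * (x i - x₀ i) := by ring
      rw [h2]
      refine (abs_add_le _ _).trans ?_
      rw [abs_mul, abs_of_pos (by linarith : (0 : ℝ) < v 0)]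
      have h3 : (v 0 : ℝ) ≤ P := by exact_mod_cast hP.le
      have h4 := hva i
      have h5 := mul_le_mul h3 h1 (abs_nonneg _) (by positivity)
      have h6 : r₀ ≤ P * r₀ := le_mul_of_one_le_left hr₀.le (hv0'.trans h3)
      linarith
    obtain ⟨q, hq⟩ := Int.eq_ofNat_of_zero_le hv0.le
    have hq0 : 0 < q := by omega
    set i := Nat.log 2 q
    have hi1 : 2 ^ i ≤ q := Nat.pow_log_le_self 2 hq0.ne'
    have hi2 : q < 2 ^ (i + 1) := Nat.lt_pow_succ_log_self (by norm_num) _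
    have hvq : (v 0 : ℝ) = q := by rw [hq]; simp
    rcases lt_or_ge q (2 ^ i₀) with h | h
    · left
      refine Set.mem_iUnion₂.2 ⟨v, hnear _ (by rw [hq]; exact_mod_cast h), ?_⟩
      have := mem_closedBall_ratPoint ht.le one_pos hv0' hva
      rwa [div_one] at this
    · right
      refine Set.mem_iUnion₂.2 ⟨i, Finset.mem_filter.2 ⟨Finset.mem_range.2 ?_, ?_⟩, ?_⟩
      · have h1 : 2 ^ i < 2 ^ N := by
          have : q < 2 ^ N := by rw [hq] at hvN; exact_mod_cast hvN
          omega
        exact (Nat.pow_lt_pow_iff_right (by norm_num)).1 h1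
      · exact Nat.le_log_of_pow_le (by norm_num) h
      · refine Set.mem_iUnion₂.2 ⟨v, hnear _ (by rw [hq]; exact_mod_cast hi2), ?_⟩
        exact mem_closedBall_ratPoint ht.le (by positivity) (by rw [hvq]; exact_mod_cast hi1) hva
  have hXsum : ∑ i ∈ (Finset.range N).filter (i₀ ≤ ·), X i ≤
      K * s ^ d * (2 * t) ^ d * 2 ^ (d + 1) * (2 ^ N * δ ^ m + s ^ (-(κ * m)) * (g ^ N / (g - 1))) := by
    refine (Finset.sum_le_sum_of_subset_of_nonneg (Finset.filter_subset _ _) fun i _ _ => hX0 i).trans ?_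
    simp only [X]
    rw [← Finset.mul_sum, Finset.sum_add_distrib, ← Finset.sum_mul, ← Finset.mul_sum]
    refine mul_le_mul_of_nonneg_left (add_le_add ?_ ?_) (by positivity)
    · refine mul_le_mul_of_nonneg_right ?_ (by positivity)
      rw [geom_sum_eq (by norm_num)]
      norm_num
    · refine mul_le_mul_of_nonneg_left ?_ (by positivity)
      rw [geom_sum_eq hg1.ne']
      have : 0 < g - 1 := by linarith
      gcongr
      linarith
  calc _ ≤ volume (F₀ ∪ ⋃ i ∈ (Finset.range N).filter (i₀ ≤ ·), F i) := measure_mono hcover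
    _ ≤ volume F₀ + ∑ i ∈ (Finset.range N).filter (i₀ ≤ ·), volume (F i) :=
        (measure_union_le _ _).trans (add_le_add le_rfl (measure_biUnion_finset_le _ _))
    _ ≤ ENNReal.ofReal (K * (2 * t) ^ d * (2 ^ i₀) ^ (d + 1)) +
        ∑ i ∈ (Finset.range N).filter (i₀ ≤ ·), ENNReal.ofReal (X i) :=
        add_le_add hF₀ (Finset.sum_le_sum fun i hi => hF i (Finset.mem_filter.1 hi).2)
    _ = ENNReal.ofReal (K * (2 * t) ^ d * (2 ^ i₀) ^ (d + 1) +
          ∑ i ∈ (Finset.range N).filter (i₀ ≤ ·), X i) := by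
        rw [← ENNReal.ofReal_sum_of_nonneg fun i _ => hX0 i, ENNReal.ofReal_add (by positivity)
          (Finset.sum_nonneg fun i _ => hX0 i)]
    _ ≤ _ := ENNReal.ofReal_le_ofReal (by linarith)

/-- Every finite set of points contains a maximal separated subset. -/
theorem exists_separated_subset {X : Type*} [PseudoMetricSpace X] (Z : Finset X) {ε : ℝ} (hε : 0 < ε) :
    ∃ G ⊆ Z, (∀ z ∈ G, ∀ z' ∈ G, z ≠ z' → ε ≤ dist z z') ∧ ∀ z ∈ Z, ∃ z' ∈ G, dist z z' < ε := by
  classical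
  induction Z using Finset.induction_on with
  | empty => exact ⟨∅, by simp⟩
  | insert a Z _ ih =>
    obtain ⟨G, hGZ, hsep, hmax⟩ := ih
    by_cases h : ∃ z' ∈ G, dist a z' < ε
    · refine ⟨G, hGZ.trans (Finset.subset_insert _ _), hsep, fun z hz => ?_⟩
      rcases Finset.mem_insert.1 hz with rfl | hz
      · exact h
      · exact hmax z hz
    · push Not at h
      refine ⟨insert a G, Finset.insert_subset_insert _ hGZ, ?_, fun z hz => ?_⟩
      · intro z hz z' hz' hne
        rcases Finset.mem_insert.1 hz with h1 | h1 <;> rcases Finset.mem_insert.1 hz' with h2 | h2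
        · exact absurd (h1.trans h2.symm) hne
        · rw [h1]; exact h z' h2
        · rw [h2, dist_comm]; exact h z h1
        · exact hsep z h1 z' h2 hne
      · rcases Finset.mem_insert.1 hz with rfl | hz
        · exact ⟨z, Finset.mem_insert_self _ _, by simpa using hε⟩
        · obtain ⟨z', hz', h'⟩ := hmax z hz
          exact ⟨z', Finset.mem_insert_of_mem hz', h'⟩

/-- `exists_dirichlet` with real parameters `σ`, `δ` in place of `1 / S`, `1 / J`. -/
theorem exists_dirichlet_of_real {d m : ℕ} (A : Matrix (Fin (d + 1)) (Fin m) ℝ) (x : Fin d → ℝ)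
    {σ δ : ℝ} (hσ0 : 0 < σ) (hσ1 : σ ≤ 1) (hδ0 : 0 < δ) (hδ1 : δ ≤ 1) {N : ℕ}
    (hN : (1 / σ) ^ d * (2 / δ) ^ m ≤ N) :
    ∃ v : Fin (d + 1) → ℤ, 0 < v 0 ∧ v 0 ≤ N ∧
      (∀ i : Fin d, |(v i.succ : ℝ) - v 0 * x i| ≤ 2 * σ) ∧
      distInt (Matrix.vecMul (fun i => (v i : ℝ)) A) ≤ δ := by
  set S := ⌊1 / σ⌋₊
  set J := ⌈1 / δ⌉₊
  have hS1 : 1 ≤ S := Nat.le_floor (by rw [Nat.cast_one, le_div_iff₀ hσ0]; linarith)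
  have hS1' : (1 : ℝ) ≤ S := by exact_mod_cast hS1
  have hSle : (S : ℝ) ≤ 1 / σ := Nat.floor_le (by positivity)
  have hSlt : 1 / σ < S + 1 := Nat.lt_floor_add_one _
  have hJge : 1 / δ ≤ J := Nat.le_ceil _
  have hJ0 : 0 < J := Nat.ceil_pos.2 (by positivity)
  have hδinv : 1 ≤ 1 / δ := by rw [le_div_iff₀ hδ0]; linarith
  have hJle : (J : ℝ) ≤ 2 / δ := by
    have : (J : ℝ) < 1 / δ + 1 := Nat.ceil_lt_add_one (by positivity)
    have e : 2 / δ = 1 / δ + 1 / δ := by ring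
    linarith
  have hprod : S ^ d * J ^ m ≤ N := by
    have b1 : (S : ℝ) ^ d * (J : ℝ) ^ m ≤ (1 / σ) ^ d * (2 / δ) ^ m := by gcongr
    exact_mod_cast b1.trans hN
  obtain ⟨v, hv0, hvk, hva, hvA⟩ := exists_dirichlet A x hS1 hJ0 hprod
  refine ⟨v, hv0, hvk, fun i => (hva i).trans ?_, hvA.trans ?_⟩
  · rw [div_le_iff₀ (by linarith)]
    rw [div_lt_iff₀ hσ0] at hSlt
    nlinarith
  · rw [div_le_iff₀ (by exact_mod_cast hJ0)]
    rwa [div_le_iff₀ hδ0, mul_comm] at hJge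

/-- A finite union of small balls that covers a ball up to a set of small measure has many members. -/
theorem card_mul_pow_ge_of_cover {d : ℕ} (hd : 1 ≤ d) {x₀ : Fin d → ℝ} {r₀ ρ : ℝ} (hr₀ : 0 < r₀)
    (hρ : 0 < ρ) {B : Set (Fin d → ℝ)} (hB : volume B ≤ ENNReal.ofReal (3 / 4 * r₀ ^ d))
    (G : Finset (Fin d → ℝ))
    (hcover : Metric.closedBall x₀ r₀ ⊆ B ∪ ⋃ z ∈ G, Metric.closedBall z (3 * ρ)) :
    1 / 6 ^ d * r₀ ^ d ≤ G.card * ρ ^ d := by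
  have b0 : volume (⋃ z ∈ G, Metric.closedBall z (3 * ρ)) ≤
      ENNReal.ofReal (G.card * (2 * (3 * ρ)) ^ d) :=
    volume_biUnion_closedBall_le G (fun z => z) (by positivity)
  have b1 : ENNReal.ofReal ((2 * r₀) ^ d) ≤
      ENNReal.ofReal (3 / 4 * r₀ ^ d + G.card * (2 * (3 * ρ)) ^ d) := by
    have e : volume (Metric.closedBall x₀ r₀) = ENNReal.ofReal ((2 * r₀) ^ d) := by
      rw [Real.volume_pi_closedBall _ hr₀.le, Fintype.card_fin]
    rw [ENNReal.ofReal_add (by positivity) (by positivity), ← e]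
    exact (measure_mono hcover).trans ((measure_union_le _ _).trans (add_le_add hB b0))
  rw [ENNReal.ofReal_le_ofReal_iff (by positivity), mul_pow,
    show 2 * (3 * ρ) = 6 * ρ by ring, mul_pow] at b1
  have b2 : (2 : ℝ) ≤ 2 ^ d := le_self_pow₀ (by norm_num) (by omega)
  have b3 : 0 < r₀ ^ d := by positivity
  have b4 : r₀ ^ d ≤ G.card * (6 ^ d * ρ ^ d) := by nlinarith
  rw [one_div, inv_mul_le_iff₀ (by positivity)]
  linarith

set_option maxHeartbeats 400000 in
/-- Rational points `a / q` with `q` in a fixed number of dyadic blocks below `2 ^ k` and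
`‖(q, a) A‖ ≤ φ k` form a ubiquitous system: a separated subset of them is dense in any ball at the
scale `ρ = 2 ^ (m + 1 + h) τ / 2 ^ k`, where `τ ^ d = 1 / (2 ^ k φ k ^ m)`. -/
theorem eventually_exists_separated {d m : ℕ} (hd : 1 ≤ d) (A : Matrix (Fin (d + 1)) (Fin m) ℝ)
    {K κ : ℝ} (hK : 0 < K) (hκ : 0 < κ) (hκm : κ * m < 1) (x₀ : Fin d → ℝ)
    (hcount : ∀ (P : ℕ) (s δ : ℝ), 0 < s → s ≤ 1 →
      1 ≤ s * P → ∀ V : Finset (Fin (d + 1) → ℤ), (V : Set (Fin (d + 1) → ℤ)) ⊆ nearPoints A x₀ P s δ →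
      (V.card : ℝ) ≤ K * (P : ℝ) ^ (d + 1) * s ^ d * max δ ((s * P) ^ (-κ)) ^ m)
    {h : ℕ} (hh : K * 2 ^ ((m + 4) * d + 3) ≤ 2 ^ h)
    {φ : ℕ → ℝ} (hφ0 : ∀ k, 0 < φ k) (hφ1 : ∀ k, φ k ≤ 1)
    (hlim : Tendsto (fun k => ((2 : ℝ) ^ (1 - κ * m)) ^ k * (1 / (2 ^ k * φ k ^ m))) atTop (𝓝 0))
    {r₀ : ℝ} (hr₀ : 0 < r₀) (hr₀' : 2 * r₀ ≤ 1) :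
    ∀ᶠ k in atTop, ∃ (ρ : ℝ) (G : Finset (Fin d → ℝ)), 0 < ρ ∧ ρ ≤ r₀ ∧
      ρ ^ d = (2 ^ (m + 1 + h) / 2 ^ k) ^ d * (1 / (2 ^ k * φ k ^ m)) ∧
      (∀ z ∈ G, ∀ z' ∈ G, z ≠ z' → 2 * ρ ≤ dist z z') ∧ (∀ z ∈ G, dist z x₀ ≤ 2 * r₀) ∧
      1 / 6 ^ d * r₀ ^ d ≤ G.card * ρ ^ d ∧
      ∀ z ∈ G, ∃ v : Fin (d + 1) → ℤ, 0 < v 0 ∧ 2 ^ k ≤ v 0 * 2 ^ h ∧ v 0 ≤ 2 ^ k ∧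
        z = ratPoint v ∧ distInt (Matrix.vecMul (fun i => (v i : ℝ)) A) ≤ φ k := by
  classical
  have hd0 : d ≠ 0 := by omega
  have hd' : (0 : ℝ) < d := by exact_mod_cast hd
  set T : ℕ → ℝ := fun k => 1 / (2 ^ k * φ k ^ m) with hT
  have hT0 : ∀ k, 0 < T k := fun k => by have := hφ0 k; positivity
  set τ : ℕ → ℝ := fun k => T k ^ ((1 : ℝ) / d)
  have hτ0 : ∀ k, 0 < τ k := fun k => Real.rpow_pos_of_pos (hT0 k) _
  have hτd : ∀ k, τ k ^ d = T k := fun k => by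
    simp only [τ]; rw [one_div, Real.rpow_inv_natCast_pow (hT0 k).le hd0]
  set g : ℝ := 2 ^ (1 - κ * m)
  have hg1 : 1 < g := Real.one_lt_rpow (by norm_num) (by linarith)
  have hTlim : Tendsto T atTop (𝓝 0) := by
    refine squeeze_zero (fun k => (hT0 k).le) (fun k => ?_) hlim
    exact le_mul_of_one_le_left (hT0 k).le (one_le_pow₀ hg1.le)
  have hτlim : Tendsto τ atTop (𝓝 0) := by
    have := hTlim.rpow_const (p := (1 : ℝ) / d) (Or.inr (by positivity))
    rwa [Real.zero_rpow (by positivity)] at this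
  obtain ⟨i₀, hi₀⟩ := pow_unbounded_of_one_lt (1 / (2 * r₀)) (one_lt_two)
  have hi₀' : 1 ≤ 2 * r₀ * 2 ^ i₀ := by
    rw [div_lt_iff₀ (by positivity)] at hi₀
    linarith
  have hpos : 0 < r₀ ^ d / 4 := by positivity
  have ev1 : ∀ᶠ k in atTop, 2 ^ (m + 1 + h) * τ k < r₀ := by
    have := hτlim.const_mul (2 ^ (m + 1 + h))
    rw [mul_zero] at this
    exact this.eventually (gt_mem_nhds hr₀)
  have ev2 : ∀ᶠ k in atTop, (K * (2 ^ i₀) ^ (d + 1) * 2 ^ ((m + 2) * d)) * T k < r₀ ^ d / 4 := by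
    have := hTlim.const_mul (K * (2 ^ i₀) ^ (d + 1) * 2 ^ ((m + 2) * d))
    rw [mul_zero] at this
    exact this.eventually (gt_mem_nhds hpos)
  set C₃ : ℝ := K * (2 * r₀) ^ d * 2 ^ ((m + 2) * d) * 2 ^ (d + 1) *
    ((2 * r₀) ^ (-(κ * m)) / (g - 1))
  have hg1' : 0 < g - 1 := by linarith
  have hC₃ : 0 < C₃ := by positivity
  have ev3 : ∀ᶠ k in atTop, C₃ * (g ^ k * T k) < r₀ ^ d / 4 := by
    have := hlim.const_mul C₃
    rw [mul_zero] at this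
    exact this.eventually (gt_mem_nhds hpos)
  filter_upwards [ev1, ev2, ev3, eventually_ge_atTop h] with k h1 h2 h3 hkh
  have hτk := hτ0 k
  have hTk := hT0 k
  have hφk := hφ0 k
  have hQ : (0 : ℝ) < 2 ^ k := by positivity
  have hQ1 : (1 : ℝ) ≤ 2 ^ k := one_le_pow₀ (by norm_num)
  have hh1 : (1 : ℝ) ≤ 2 ^ h := one_le_pow₀ (by norm_num)
  set N := k - h
  have hNk : (2 : ℝ) ^ N * 2 ^ h = 2 ^ k := by
    rw [← pow_add, Nat.sub_add_cancel hkh]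
  set t := 2 ^ (m + 1) * τ k with ht
  have ht0 : 0 < t := by positivity
  set ρ := 2 ^ (m + 1 + h) * τ k / 2 ^ k with hρ
  have hρt : ρ = t / 2 ^ N := by
    rw [hρ, ht, ← hNk, pow_add 2 (m + 1) h]; field_simp
  have hρ0 : 0 < ρ := by positivity
  have hρr : ρ ≤ r₀ := by
    rw [hρ, div_le_iff₀ hQ]
    nlinarith
  have htr : t ≤ r₀ := by
    have : t * 1 ≤ t * 2 ^ h := mul_le_mul_of_nonneg_left hh1 ht0.le
    have e : t * 2 ^ h = 2 ^ (m + 1 + h) * τ k := by rw [ht, pow_add 2 (m + 1) h]; ring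
    linarith
  have htd : (2 * t) ^ d = 2 ^ ((m + 2) * d) * T k := by
    rw [ht, ← hτd, pow_mul, ← mul_pow]; congr 1; ring
  have hbad := volume_smallDenominators_le A hK hκ hκm x₀ hcount hr₀ hr₀' hi₀' ht0 htr hφk (hφ1 k) N
  set Bad := {x | x ∈ Metric.closedBall x₀ r₀ ∧ ∃ v : Fin (d + 1) → ℤ, 0 < v 0 ∧ v 0 < 2 ^ N ∧
        (∀ i : Fin d, |(v i.succ : ℝ) - v 0 * x i| ≤ t) ∧
        distInt (Matrix.vecMul (fun i => (v i : ℝ)) A) ≤ φ k}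
  have hbad' : volume Bad ≤ ENNReal.ofReal (3 / 4 * r₀ ^ d) := by
    refine hbad.trans (ENNReal.ofReal_le_ofReal ?_)
    change K * (2 * t) ^ d * (2 ^ i₀) ^ (d + 1) + K * (2 * r₀) ^ d * (2 * t) ^ d * 2 ^ (d + 1) *
      (2 ^ N * φ k ^ m + (2 * r₀) ^ (-(κ * m)) * (g ^ N / (g - 1))) ≤ _
    rw [htd]
    have a1 : K * (2 ^ ((m + 2) * d) * T k) * (2 ^ i₀) ^ (d + 1) =
        (K * (2 ^ i₀) ^ (d + 1) * 2 ^ ((m + 2) * d)) * T k := by ring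
    have a2 : K * (2 * r₀) ^ d * (2 ^ ((m + 2) * d) * T k) * 2 ^ (d + 1) * (2 ^ N * φ k ^ m) ≤
        r₀ ^ d / 4 := by
      have b1 : T k * (2 ^ N * φ k ^ m) = 1 / 2 ^ h := by
        simp only [hT]; rw [← hNk]; field_simp
      have b2 : K * (2 * r₀) ^ d * (2 ^ ((m + 2) * d) * T k) * 2 ^ (d + 1) * (2 ^ N * φ k ^ m) =
          (K * 2 ^ ((m + 4) * d + 3)) * (1 / 2 ^ h) * (r₀ ^ d / 4) := by
        rw [← b1, mul_pow, show (m + 4) * d + 3 = d + (m + 2) * d + (d + 1) + 2 by ring,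
          pow_add 2 (d + (m + 2) * d + (d + 1)) 2, pow_add 2 (d + (m + 2) * d) (d + 1), pow_add 2 d]
        ring
      rw [b2]
      refine mul_le_of_le_one_left hpos.le ?_
      rw [mul_one_div, div_le_one (by positivity)]
      exact hh
    have a3 : K * (2 * r₀) ^ d * (2 ^ ((m + 2) * d) * T k) * 2 ^ (d + 1) *
        ((2 * r₀) ^ (-(κ * m)) * (g ^ N / (g - 1))) ≤ C₃ * (g ^ k * T k) := by
      have b1 : g ^ N ≤ g ^ k := pow_le_pow_right₀ hg1.le (Nat.sub_le _ _)
      have b2 : K * (2 * r₀) ^ d * (2 ^ ((m + 2) * d) * T k) * 2 ^ (d + 1) *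
        ((2 * r₀) ^ (-(κ * m)) * (g ^ N / (g - 1))) = C₃ * (g ^ N * T k) := by
        simp only [C₃]; ring
      rw [b2]
      gcongr
    rw [mul_add, a1]
    linarith
  -- Dirichlet approximations with numerators controlled at the scale `t`
  have hdir : ∀ x : Fin d → ℝ, ∃ v : Fin (d + 1) → ℤ, 0 < v 0 ∧ v 0 ≤ 2 ^ k ∧
      (∀ i : Fin d, |(v i.succ : ℝ) - v 0 * x i| ≤ t) ∧
      distInt (Matrix.vecMul (fun i => (v i : ℝ)) A) ≤ φ k := by
    intro x
    have hσt : t = 2 * (2 ^ m * τ k) := by rw [ht, pow_succ]; ring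
    obtain ⟨v, hv0, hvk, hva, hvA⟩ := exists_dirichlet_of_real A x (σ := 2 ^ m * τ k) (by positivity)
      (by linarith) hφk (hφ1 k) (N := 2 ^ k) (by
        have e : (2 ^ m * τ k) ^ d = (2 ^ m) ^ d * T k := by rw [mul_pow, hτd]
        have b2 : (1 / (2 ^ m * τ k)) ^ d * (2 / φ k) ^ m = 2 ^ m / (2 ^ m) ^ d * 2 ^ k := by
          rw [div_pow, e, div_pow, one_pow]
          simp only [hT]
          field_simp
        have b3 : (2 : ℝ) ^ m / (2 ^ m) ^ d ≤ 1 := by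
          rw [div_le_one (by positivity)]
          exact le_self_pow₀ (one_le_pow₀ (by norm_num)) hd0
        rw [b2]
        push_cast
        exact mul_le_of_le_one_left hQ.le b3)
    exact ⟨v, hv0, by exact_mod_cast hvk, by rwa [hσt], hvA⟩
  -- the rational points of large denominator near the ball, and a maximal separated subset
  set V : Finset (Fin (d + 1) → ℤ) :=
    ((finite_nearPoints A x₀ (2 ^ k + 1) 1 (φ k)).toFinset).filter fun v =>
      0 < v 0 ∧ 2 ^ N ≤ v 0 ∧ dist (ratPoint v) x₀ ≤ 2 * r₀
  obtain ⟨G, hGZ, hsep, hmax⟩ := exists_separated_subset (V.image ratPoint) (ε := 2 * ρ) (by positivity)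
  have hcover : Metric.closedBall x₀ r₀ ⊆ Bad ∪ ⋃ z ∈ G, Metric.closedBall z (3 * ρ) := by
    intro x hx
    obtain ⟨v, hv0, hvk, hva, hvA⟩ := hdir x
    by_cases hvN : v 0 < 2 ^ N
    · exact Or.inl ⟨hx, v, hv0, hvN, hva, hvA⟩
    right
    rw [not_lt] at hvN
    have hvN' : (2 : ℝ) ^ N ≤ v 0 := by exact_mod_cast hvN
    have hxv : dist x (ratPoint v) ≤ ρ := by
      rw [hρt]; exact mem_closedBall_ratPoint ht0.le (by positivity) hvN' hva
    have hx' : dist x x₀ ≤ r₀ := hx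
    have hv0' : (0 : ℝ) < v 0 := by exact_mod_cast hv0
    have hvx : dist (ratPoint v) x₀ ≤ 2 * r₀ := by
      have := dist_triangle_left (ratPoint v) x₀ x
      linarith
    have hvV : v ∈ V := by
      refine Finset.mem_filter.2 ⟨(Set.Finite.mem_toFinset _).2 ⟨hv0.le, ?_, fun i => ?_, hvA⟩,
        hv0, hvN, hvx⟩
      · push_cast; omega
      · have e : (v i.succ : ℝ) - v 0 * x₀ i = v 0 * (ratPoint v i - x₀ i) := by
          rw [ratPoint]; field_simp
        have b1 : |ratPoint v i - x₀ i| ≤ 2 * r₀ := by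
          rw [← Real.dist_eq]; exact (dist_le_pi_dist _ _ i).trans hvx
        have b2 : (v 0 : ℝ) ≤ ((2 ^ k + 1 : ℕ) : ℝ) := by
          push_cast
          have : (v 0 : ℝ) ≤ 2 ^ k := by exact_mod_cast hvk
          linarith
        rw [e, abs_mul, abs_of_pos hv0', mul_comm]
        exact mul_le_mul (b1.trans hr₀') b2 hv0'.le zero_le_one
    obtain ⟨z, hz, hvz⟩ := hmax _ (Finset.mem_image_of_mem ratPoint hvV)
    refine Set.mem_iUnion₂.2 ⟨z, hz, ?_⟩
    have := dist_triangle x (ratPoint v) z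
    rw [Metric.mem_closedBall]
    linarith
  have hmass := card_mul_pow_ge_of_cover hd hr₀ hρ0 hbad' G hcover
  refine ⟨ρ, G, hρ0, hρr, ?_, hsep, fun z hz => ?_, hmass, fun z hz => ?_⟩
  · change ρ ^ d = (2 ^ (m + 1 + h) / 2 ^ k) ^ d * T k
    rw [← hτd k, ← mul_pow, hρ]; congr 1; ring
  · obtain ⟨v, hv, rfl⟩ := Finset.mem_image.1 (hGZ hz)
    exact (Finset.mem_filter.1 hv).2.2.2
  · obtain ⟨v, hv, rfl⟩ := Finset.mem_image.1 (hGZ hz)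
    obtain ⟨hv1, hv2, hv3, -⟩ := Finset.mem_filter.1 hv
    obtain ⟨-, hP, -, hvA⟩ := (Set.Finite.mem_toFinset _).1 hv1
    refine ⟨v, hv2, ?_, ?_, rfl, hvA⟩
    · have : (2 : ℤ) ^ N * 2 ^ h = 2 ^ k := by rw [← pow_add, Nat.sub_add_cancel hkh]
      rw [← this]
      exact mul_le_mul_of_nonneg_right hv3 (by positivity)
    · push_cast at hP; omega

theorem measurableSet_approxParam {d m : ℕ} (A : Matrix (Fin (d + 1)) (Fin m) ℝ) (ψ : ℕ+ → ℝ≥0) :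
    MeasurableSet (approxParam A ψ) := by
  have hdist : Measurable (distInt : (Fin (d + m) → ℝ) → ℝ) := by
    refine Measurable.iInf fun k => ?_
    fun_prop
  have hq : ∀ q : ℕ+, MeasurableSet
      {x | distInt (fun i => ((q : ℕ) : ℝ) * graphMap A x i) < (ψ q : ℝ)} := by
    intro q
    refine measurableSet_lt (hdist.comp ?_) measurable_const
    have := (lipschitzWith_graphMap A).continuous.measurable
    fun_prop
  have hset : approxParam A ψ = ⋂ F : Finset ℕ+, ⋃ q : ℕ+, ⋃ _ : q ∉ F,
      {x | distInt (fun i => ((q : ℕ) : ℝ) * graphMap A x i) < (ψ q : ℝ)} := by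
    ext x
    simp only [approxParam, Set.mem_ofPred_eq, Set.mem_iInter, Set.mem_iUnion, exists_prop]
    constructor
    · intro hx F
      obtain ⟨q, hq, hqF⟩ := hx.exists_notMem_finset F
      exact ⟨q, hqF, hq⟩
    · intro hx hfin
      obtain ⟨q, hqF, hq⟩ := hx hfin.toFinset
      exact hqF ((Set.Finite.mem_toFinset _).2 hq)
  rw [hset]
  exact MeasurableSet.iInter fun F => MeasurableSet.iUnion fun q => MeasurableSet.iUnion fun _ => hq q

/-! ### The divergence case -/

theorem not_summable_min_one {f : ℕ → ℝ} (hf : ¬ Summable f) :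
    ¬ Summable fun k => min (f k) 1 := by
  intro h
  have hev : ∀ᶠ k in atTop, min (f k) 1 < 1 := h.tendsto_atTop_zero.eventually (gt_mem_nhds one_pos)
  refine hf (h.congr_atTop ?_)
  filter_upwards [hev] with k hk
  exact min_eq_left (le_of_lt (by simpa using hk))

/-- A point near a rational point with small `‖(q, a) A‖` lifts to an approximable point of `L_A`. -/
theorem distInt_graphMap_lt {d m : ℕ} {A : Matrix (Fin (d + 1)) (Fin m) ℝ} {x : Fin d → ℝ}
    {v : Fin (d + 1) → ℤ} {q k : ℕ} {t η : ℝ} (hq0 : 0 < q) (hvq : v 0 = q) (hqk : q ≤ 2 ^ k)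
    (ht : 0 < t) (hx : dist x (ratPoint v) < t / 2 ^ k)
    (hvA : distInt (Matrix.vecMul (fun i => (v i : ℝ)) A) ≤ t) (hη : 2 * entrySum A * t < η) :
    distInt (fun i => (q : ℝ) * graphMap A x i) < η := by
  have hL := one_le_entrySum A
  have hq0' : (0 : ℝ) < q := by exact_mod_cast hq0
  have hvq' : (v 0 : ℝ) = q := by rw [hvq]; simp
  have hqk' : (q : ℝ) ≤ 2 ^ k := by exact_mod_cast hqk
  have h1 : ∀ i : Fin d, |(v i.succ : ℝ) - v 0 * x i| ≤ t := by
    intro i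
    have e : (v i.succ : ℝ) - v 0 * x i = v 0 * (ratPoint v i - x i) := by
      have : (v 0 : ℝ) ≠ 0 := by rw [hvq']; exact hq0'.ne'
      rw [ratPoint]; field_simp
    have h2 : |ratPoint v i - x i| ≤ t / 2 ^ k := by
      rw [← Real.dist_eq, dist_comm]; exact (dist_le_pi_dist _ _ i).trans hx.le
    rw [e, abs_mul, hvq', abs_of_pos hq0']
    calc (q : ℝ) * |ratPoint v i - x i| ≤ 2 ^ k * (t / 2 ^ k) := by gcongr
      _ = t := by field_simp
  obtain ⟨b, hb⟩ := exists_int_of_distInt_le hvA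
  refine distInt_lt_of_forall (by nlinarith) (Fin.append (fun i => v i.succ) b) fun i => ?_
  refine Fin.addCases (fun i => ?_) (fun j => ?_) i
  · simp only [graphMap, Fin.append_left]
    have := h1 i
    rw [abs_sub_comm, hvq'] at this
    nlinarith
  · simp only [graphMap, Fin.append_right]
    have h2 := abs_vecMul_sub_le A (u := fun i => (v i : ℝ)) (x := x) ht.le h1 j
    rw [abs_sub_comm, hvq'] at h2
    have h3 := abs_sub_le ((q : ℝ) * Matrix.vecMul (Matrix.vecCons 1 x) A j)
      (Matrix.vecMul (fun i => (v i : ℝ)) A j) (b j)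
    have h4 := hb j
    nlinarith

/-- The divergence case of Khintchine's theorem on `L_A`. The approximation function is raised to at
least `q ^ (-κ')`, which only adds a null set by the convergence case, and then truncated at
`q ^ (-1 / n)` along powers of two, which does not affect the divergence of the series. -/
theorem volume_compl_approxParam_eq_zero {d m : ℕ} (hd : 1 ≤ d) (hm : 1 ≤ m)
    (A : Matrix (Fin (d + 1)) (Fin m) ℝ) {c w κ κ' : ℝ}
    (hc : 0 < c) (hw : 0 < w) (hκ' : 0 < κ') (hκκ' : κ' < κ) (hκw : κ * w < 1) (hκm : κ * m < 1)
    (hκn : 1 < κ' * (d + m : ℕ))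
    (hA : ∀ q : Fin m → ℤ, q ≠ 0 →
      c * ‖fun j => (q j : ℝ)‖ ^ (-w) ≤ distInt (A.mulVec fun j => (q j : ℝ)))
    {ψ : ℕ+ → ℝ≥0} (hψ : Antitone ψ)
    (hsum : ¬ Summable fun q => ψ q ^ (d + m)) : volume (approxParam A ψ)ᶜ = 0 := by
  classical
  have hκ : 0 < κ := hκ'.trans hκκ'
  have hL := one_le_entrySum A
  set L := entrySum A
  set n := d + m
  have hn : 1 ≤ n := by omega
  have hn' : (0 : ℝ) < n := by exact_mod_cast hn
  set ψ' : ℕ+ → ℝ≥0 := fun q => max (ψ q) (powFun κ' q)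
  have hψ' : Antitone ψ' := fun a b hab => max_le_max (hψ hab) (antitone_powFun hκ' hab)
  suffices hmain : volume (approxParam A ψ')ᶜ = 0 by
    have h0 : volume (approxParam A (powFun κ')) = 0 :=
      volume_approxParam_eq_zero hm A hc hw hκ'
        (lt_of_le_of_lt (mul_le_mul_of_nonneg_right hκκ'.le hw.le) hκw) hκn hA (antitone_powFun hκ')
        (summable_powFun hκn)
    refine measure_mono_null ?_ (measure_union_null hmain h0)
    intro x hx
    by_cases h : x ∈ approxParam A (powFun κ')
    · exact Or.inr h
    · refine Or.inl fun hx' => ?_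
      rw [approxParam_max] at hx'
      exact hx'.elim hx h
  have hsum' : ¬ Summable fun k : ℕ => (2 : ℝ) ^ k * (ψ' (2 ^ k) : ℝ) ^ n := by
    rw [← summable_pow_iff_condensed hψ']
    exact fun h => hsum (NNReal.summable_of_le
      (fun q => pow_le_pow_left₀ zero_le (le_max_left _ _) n) h)
  -- the scaled and truncated approximation function along powers of two
  set Φ : ℕ → ℝ := fun k => min (ψ' (2 ^ k) : ℝ) (((2 : ℝ) ^ k) ^ (-(1 / (n : ℝ))))
  have hpow : ∀ k : ℕ, (0 : ℝ) < 2 ^ k := fun k => by positivity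
  have hpow1 : ∀ k : ℕ, (1 : ℝ) ≤ 2 ^ k := fun k => one_le_pow₀ (by norm_num)
  have hΦlow : ∀ k, ((2 : ℝ) ^ k) ^ (-κ') ≤ Φ k := by
    intro k
    refine le_min ?_ ?_
    · have : ((2 : ℝ) ^ k) ^ (-κ') = (powFun κ' (2 ^ k) : ℝ) := by rw [coe_powFun]; simp
      rw [this]
      exact NNReal.coe_le_coe.2 (le_max_right _ _)
    · refine Real.rpow_le_rpow_of_exponent_le (hpow1 k) (neg_le_neg ?_)
      rw [div_le_iff₀ hn']; exact hκn.le
  have hΦ0 : ∀ k, 0 < Φ k := fun k => (Real.rpow_pos_of_pos (hpow k) _).trans_le (hΦlow k)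
  have hΦ1 : ∀ k, Φ k ≤ 1 := fun k => (min_le_right _ _).trans
    (Real.rpow_le_one_of_one_le_of_nonpos (hpow1 k) (by
      have : 0 ≤ 1 / (n : ℝ) := by positivity
      linarith))
  have hrpown : ∀ k : ℕ, (((2 : ℝ) ^ k) ^ (-(1 / (n : ℝ)))) ^ n = 1 / 2 ^ k := by
    intro k
    rw [← Real.rpow_natCast, ← Real.rpow_mul (hpow k).le, neg_mul, one_div_mul_cancel hn'.ne',
      Real.rpow_neg_one, one_div]
  have hΦn : ∀ k, 2 ^ k * Φ k ^ n = min ((2 : ℝ) ^ k * (ψ' (2 ^ k) : ℝ) ^ n) 1 := by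
    intro k
    have h1 : Φ k ^ n = min ((ψ' (2 ^ k) : ℝ) ^ n) (1 / 2 ^ k) := by
      rw [← hrpown k]
      have ha : (0 : ℝ) ≤ ψ' (2 ^ k) := NNReal.coe_nonneg _
      have hb : 0 ≤ ((2 : ℝ) ^ k) ^ (-(1 / (n : ℝ))) := Real.rpow_nonneg (hpow k).le _
      simp only [Φ]
      rcases le_total (ψ' (2 ^ k) : ℝ) (((2 : ℝ) ^ k) ^ (-(1 / (n : ℝ)))) with hab | hab
      · rw [min_eq_left hab, min_eq_left (pow_le_pow_left₀ ha hab n)]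
      · rw [min_eq_right hab, min_eq_right (pow_le_pow_left₀ hb hab n)]
    rw [h1, mul_min_of_nonneg _ _ (hpow k).le, mul_one_div_cancel (hpow k).ne']
  have hΦanti : ∀ k, Φ (k + 1) ≤ Φ k := by
    intro k
    refine min_le_min (NNReal.coe_le_coe.2 (hψ' ?_)) ?_
    · exact pow_le_pow_right' (one_le) (Nat.le_succ k)
    · exact Real.rpow_le_rpow_of_nonpos (hpow k)
        (pow_le_pow_right₀ (by norm_num) (Nat.le_succ k)) (by
          have : 0 ≤ 1 / (n : ℝ) := by positivity
          linarith)
  set φ : ℕ → ℝ := fun k => Φ k / (4 * L)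
  have h4L : 1 ≤ 4 * L := by linarith
  have h4L0 : 0 < 4 * L := by linarith
  have hφ0 : ∀ k, 0 < φ k := fun k => div_pos (hΦ0 k) h4L0
  have hφ1 : ∀ k, φ k ≤ 1 := fun k => (div_le_self (hΦ0 k).le h4L).trans (hΦ1 k)
  have hlim : Tendsto (fun k => ((2 : ℝ) ^ (1 - κ * m)) ^ k * (1 / (2 ^ k * φ k ^ m))) atTop (𝓝 0) := by
    set b : ℝ := 2 ^ (-((κ - κ') * m))
    have hm' : (0 : ℝ) < m := by exact_mod_cast hm
    have hb1 : b < 1 := Real.rpow_lt_one_of_one_lt_of_neg (by norm_num) (by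
      have : 0 < (κ - κ') * m := mul_pos (by linarith) hm'
      linarith)
    have hb0 : 0 ≤ b := Real.rpow_nonneg (by norm_num) _
    have h1 := (tendsto_pow_atTop_nhds_zero_of_lt_one hb0 hb1).const_mul ((4 * L) ^ m)
    rw [mul_zero] at h1
    refine squeeze_zero (fun k => ?_) (fun k => ?_) h1
    · have := hφ0 k; positivity
    · have h2 : (((2 : ℝ) ^ k) ^ (-κ')) ^ m ≤ (4 * L) ^ m * φ k ^ m := by
        rw [← mul_pow]
        refine pow_le_pow_left₀ (by positivity) ?_ m
        simp only [φ]
        rw [mul_div_cancel₀ _ h4L0.ne']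
        exact hΦlow k
      have h3 : ((2 : ℝ) ^ (1 - κ * m)) ^ k = (2 : ℝ) ^ k * b ^ k * (((2 : ℝ) ^ k) ^ (-κ')) ^ m := by
        simp only [b]
        rw [← Real.rpow_natCast, ← Real.rpow_natCast, ← Real.rpow_natCast, ← Real.rpow_natCast,
          ← Real.rpow_mul (by norm_num), ← Real.rpow_mul (by norm_num), ← Real.rpow_mul (by norm_num),
          ← Real.rpow_mul (by norm_num), ← Real.rpow_add (by norm_num), ← Real.rpow_add (by norm_num)]
        congr 1; ring
      have h4 := hφ0 k
      rw [h3, mul_one_div, div_le_iff₀ (by positivity)]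
      have h5 : 0 ≤ (2 : ℝ) ^ k * b ^ k := by positivity
      calc (2 : ℝ) ^ k * b ^ k * (((2 : ℝ) ^ k) ^ (-κ')) ^ m
          ≤ (2 : ℝ) ^ k * b ^ k * ((4 * L) ^ m * φ k ^ m) := mul_le_mul_of_nonneg_left h2 h5
        _ = _ := by ring
  -- it suffices to work in balls about the origin, where the constants are uniform
  suffices hloc : ∀ M : ℕ, volume ((approxParam A ψ')ᶜ ∩ Metric.closedBall 0 (M : ℝ)) = 0 by
    refine measure_mono_null ?_ (measure_iUnion_null hloc)
    intro x hx
    obtain ⟨M, hM⟩ := exists_nat_ge ‖x‖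
    exact Set.mem_iUnion.2 ⟨M, hx, by simpa using hM⟩
  intro M
  obtain ⟨K, hK, hcount⟩ := exists_card_region_le hm A hc hw hκ hκw hA M
  obtain ⟨h, hh⟩ := pow_unbounded_of_one_lt (K * 2 ^ ((m + 4) * d + 3)) (one_lt_two)
  refine volume_inter_compl_eq_zero (r₁ := 1) (c := (1 / 6 ^ d) ^ 2 / (5 * 6 ^ d) / 3 ^ d) _
    (measurableSet_approxParam A ψ') (by positivity) one_pos fun x₀ hx₀ R hR hR1 => ?_
  set r₀ := R / 3
  have hr₀ : 0 < r₀ := by positivity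
  have hx₀' : ∀ i, |x₀ i| ≤ M := fun i => (norm_le_pi_norm x₀ i).trans hx₀
  obtain ⟨k₀, hk₀⟩ := eventually_atTop.1 (eventually_exists_separated hd A hK hκ hκm x₀
    (hcount x₀ hx₀') hh.le hφ0 hφ1 hlim hr₀ (by simp only [r₀]; linarith))
  choose ρ G hρ0 hρr hρd hsep hGx hGc hGv using fun k => hk₀ (k + k₀) (Nat.le_add_left _ _)
  set r : ℕ → ℝ := fun k => φ (k + k₀) / 2 ^ (k + k₀)
  have hr0 : ∀ k, 0 < r k := fun k => div_pos (hφ0 _) (hpow _)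
  have hratio : ∀ k, (r k / ρ k) ^ d =
      1 / ((2 ^ (m + 1 + h)) ^ d * (4 * L) ^ n) * (2 ^ (k + k₀) * Φ (k + k₀) ^ n) := by
    intro k
    have h1 := hφ0 (k + k₀)
    have h2 : Φ (k + k₀) = 4 * L * φ (k + k₀) := by simp only [φ]; field_simp
    rw [div_pow, hρd, h2]
    simp only [r, n]
    rw [mul_pow (4 * L) (φ (k + k₀)) (d + m), pow_add (φ (k + k₀)) d m, div_pow (φ (k + k₀)) _ d,
      div_pow (2 ^ (m + 1 + h)) ((2 : ℝ) ^ (k + k₀)) d]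
    field_simp
  have hratio1 : ∀ k, (r k / ρ k) ^ d ≤ 1 := by
    intro k
    rw [hratio k, hΦn]
    refine mul_le_one₀ ?_ (le_min (by positivity) zero_le_one) (min_le_right _ _)
    rw [div_le_one (by positivity)]
    exact one_le_mul_of_one_le_of_one_le (one_le_pow₀ (one_le_pow₀ (by norm_num))) (one_le_pow₀ h4L)
  have hub := le_volume_frequently_of_ubiquity hd x₀ hr₀ (c := 1 / 6 ^ d) (by positivity) r ρ G hr0
    (fun k => by
      have h1 := hratio1 k
      have h2 : 0 ≤ r k / ρ k := (div_pos (hr0 k) (hρ0 k)).le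
      have h3 := (pow_le_one_iff_of_nonneg h2 (by omega)).1 h1
      rwa [div_le_one (hρ0 k)] at h3)
    (fun k => by
      have h1 := hΦanti (k + k₀)
      have h2 : φ (k + k₀ + 1) ≤ φ (k + k₀) := by simp only [φ]; gcongr
      change φ (k + 1 + k₀) / 2 ^ (k + 1 + k₀) ≤ φ (k + k₀) / 2 ^ (k + k₀) / 2
      rw [show k + 1 + k₀ = k + k₀ + 1 by ring, pow_succ, div_div (φ (k + k₀))]
      exact div_le_div_of_nonneg_right h2 (by positivity))
    hρr hsep hGx hGc (by
      simp_rw [hratio]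
      rw [summable_mul_left_iff (by positivity)]
      intro hs
      have := (summable_nat_add_iff (f := fun k => (2 : ℝ) ^ k * Φ k ^ n) k₀).1 hs
      simp_rw [hΦn] at this
      exact not_summable_min_one hsum' this)
  have hconst : (1 / 6 ^ d) ^ 2 / (5 * 6 ^ d) / 3 ^ d * R ^ d =
      (1 / 6 ^ d : ℝ) ^ 2 / (5 * 6 ^ d) * r₀ ^ d := by
    simp only [r₀]; rw [div_pow R 3 d]; ring
  rw [hconst]
  refine hub.trans (measure_mono ?_)
  rintro x ⟨hx, hxb⟩
  refine ⟨fun hfin => ?_, by simpa only [r₀, mul_div_cancel₀ R (three_ne_zero' ℝ)] using hxb⟩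
  -- denominators of the approximations found at level `k` are at least `2 ^ (k + k₀ - h)`, so they
  -- exceed the bound `B` on all denominators
  obtain ⟨B, hB⟩ := hfin.bddAbove
  obtain ⟨k, hkB, z, hz, hxz⟩ := frequently_atTop.1 hx ((B : ℕ) + h)
  obtain ⟨v, hv0, hvh, hvk, rfl, hvA⟩ := hGv k z hz
  obtain ⟨q, hq⟩ := Int.eq_ofNat_of_zero_le hv0.le
  have hq0 : 0 < q := by omega
  lift q to ℕ+ using hq0
  have hqk : (q : ℕ) ≤ 2 ^ (k + k₀) := by rw [hq] at hvk; exact_mod_cast hvk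
  have hqh : 2 ^ (k + k₀) ≤ (q : ℕ) * 2 ^ h := by rw [hq] at hvh; exact_mod_cast hvh
  have hmem : distInt (fun i => ((q : ℕ) : ℝ) * graphMap A x i) < (ψ' q : ℝ) := by
    refine distInt_graphMap_lt q.pos hq hqk (hφ0 (k + k₀)) hxz hvA ?_
    have h1 : 2 * L * φ (k + k₀) = Φ (k + k₀) / 2 := by simp only [φ]; field_simp; ring
    have h2 : Φ (k + k₀) ≤ ψ' q := by
      refine (min_le_left _ _).trans (NNReal.coe_le_coe.2 (hψ' ?_))
      rw [← PNat.coe_le_coe]; simpa using hqk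
    have h3 := hΦ0 (k + k₀)
    change 2 * L * φ (k + k₀) < _
    linarith
  have hqB : (q : ℕ) ≤ B := PNat.coe_le_coe _ _ |>.2 (hB hmem)
  have h1 : 2 ^ ((B : ℕ) + h) ≤ 2 ^ (k + k₀) := Nat.pow_le_pow_right (by norm_num) (by omega)
  have h2 : (B : ℕ) < 2 ^ (B : ℕ) := Nat.lt_two_pow_self
  have h3 : 2 ^ ((B : ℕ) + h) ≤ (B : ℕ) * 2 ^ h := h1.trans (hqh.trans (Nat.mul_le_mul_right _ hqB))
  rw [pow_add] at h3
  have h4 := Nat.le_of_mul_le_mul_right h3 (by positivity)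
  omega

end KhintchineAffine

theorem theorem2p1 (d m : ℕ) (hm : 1 ≤ m) (A : Matrix (Fin (d + 1)) (Fin m) ℝ)
    (hA : KhintchineAffine.diophantineExponent A ≠ ((d + m : ℕ) : EReal)) :
    KhintchineAffine.IsKhintchineType d (KhintchineAffine.affineSubspaceOf A) ↔
      KhintchineAffine.diophantineExponent A < ((d + m : ℕ) : EReal) := by
  have hn : 1 ≤ d + m := by omega
  have hn' : (0 : ℝ) < (d + m : ℕ) := by exact_mod_cast hn
  rw [KhintchineAffine.isKhintchineType_iff]
  constructor
  · intro h
    by_contra hlt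
    obtain ⟨κ, hκ, hκn, huniv⟩ :=
      KhintchineAffine.exists_approxParam_eq_univ hm A (lt_of_le_of_ne (not_lt.1 hlt) hA.symm)
    have h0 := (h _ (KhintchineAffine.antitone_powFun hκ)).1 (KhintchineAffine.summable_powFun hκn)
    rw [huniv] at h0
    exact (NeZero.ne MeasureTheory.volume) (MeasureTheory.Measure.measure_univ_eq_zero.1 h0)
  · intro hlt ψ hψ
    obtain ⟨c, w, hc, hw, hwn, hcw⟩ :=
      KhintchineAffine.exists_le_distInt_of_exponent_lt hn A hlt
    -- the exponent `κ` must lie between `1 / n` and `1 / m`, so `d = 0` is excluded beforehand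
    have hd : 1 ≤ d := by
      obtain ⟨κ, h1, h2⟩ := exists_between (one_div_lt_one_div_of_lt hw hwn)
      exact KhintchineAffine.dim_pos hm A hc hw ((one_div_pos.2 hn').trans h1) ((lt_div_iff₀ hw).1 h2)
        ((div_lt_iff₀ hn').1 h1) hcw
    have hm' : (0 : ℝ) < m := by exact_mod_cast hm
    have hmn : (m : ℝ) < (d + m : ℕ) := by exact_mod_cast (by omega : m < d + m)
    obtain ⟨κ, h1, h2⟩ := exists_between (lt_min (one_div_lt_one_div_of_lt hw hwn)
      (one_div_lt_one_div_of_lt hm' hmn))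
    obtain ⟨κ', h3, h4⟩ := exists_between h1
    have hκw := (lt_div_iff₀ hw).1 (h2.trans_le (min_le_left _ _))
    have hκm := (lt_div_iff₀ hm').1 (h2.trans_le (min_le_right _ _))
    have hκ' := (one_div_pos.2 hn').trans h3
    exact ⟨KhintchineAffine.volume_approxParam_eq_zero hm A hc hw (hκ'.trans h4) hκw
        ((div_lt_iff₀ hn').1 h1) hcw hψ,
      KhintchineAffine.volume_compl_approxParam_eq_zero hd hm A hc hw hκ' h4 hκw hκm
        ((div_lt_iff₀ hn').1 h3) hcw hψ⟩
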